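/- \textbf{Setting.} For $d\ge 1$ and even $L\ge 2$ let $\mathbb T_L$ be the torus of side length $L$, its elements identified with the $x\in\mathbb Z^d$ with all $x_i\in(-\frac L2,\frac L2]$, and regarded as a simple graph with edges between nearest neighbours; $o$ is the origin and $e_1$ the first unit vector. A potential is a function $v:\mathbb Z^d\to\mathbb R$ with $v(-x)=v(x)$, and $v_L(x,y):=\sum_{z\in\mathbb Z^d}v(y+Lz-x)$. It is \emph{tempered} if $\sum_x|v(x)|<\infty$ and $\bar v:=v(0)+\sum_x v(x)\mathbf 1_{\{v(x)<0\}}\ge 0$. It is \emph{separable} if for every even $L\ge 2$ and every $i\in\{1,\dots,d\}$ there are $k\in\mathbb N$, a finite measure space $(T,\nu)$ and bounded measurable $\alpha,\tilde\alpha:T\times\mathbb T_L\to\mathbb C^k$ such that $-v_L(x,y)=\int_T\sum_{j=1}^k\alpha_j(t,x)\tilde\alpha_j(t,y)\,d\nu(t)$ whenever $x_i>0\ge y_i$, and, for all $x$, $\tilde\alpha(t,x)=\overline{\alpha(t,\theta_ix)}$ for $\nu$-almost every $t$, where $\theta_i$ replaces $x_i$ by $1-x_i$ (the reflection through edges exchanging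 the halves $\{x_i>0\}$ and $\{x_i\le0\}$). A weight function $U:\mathbb N_0\to[0,\infty)$ is \emph{good} if for some $C<\infty$ and all $n\ge0$, $n\,\overline U(n+1)\le C\,\overline U(n)$, where $\overline U(n)=U(n)e^{-\bar vn^2}$; its \emph{range} is $\sup\{n:U(n)>0\}\in\mathbb N_0\cup\{\infty\}$. A configuration $w=(m,c,\pi,g)$ of the random path model with $N$ colours on $\mathbb T_L$ consists of numbers $m_e\in\mathbb N_0$ of links on the edges $e$ such that every vertex is touched by an even number of links; a colour in $\{1,\dots,N\}$ for each of the links $(e,p)$, $1\le p\le m_e$; for every vertex $x$ a partition $\pi_x$ of the links touching $x$ into sets of at most two links, two links in the same set having the same colour; and numbers $g_x\in\{0,1,2\}$ of ghost pairings. Let $m^{(i)}_e$ be the number of links of colour $i$ on $e$; let $u_x^i$ be the number of links of colour $i$ that are unpaired at $x$; and let $n_x$ be the number of two-element sets in $\pi_x$ plus $g_x$. For $\lambda>0$ put $$\mu(w)=\prod_e\frac{\lambda^{m_e}}{m_e!}\prod_xU(n_x)\exp\Big(-\sum_{x,y\in\mathbb T_L}v_L(x,y)n_xn_y\Big).$$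 Let $\mathbb Z^\ell$ be the total mass under $\mu$ of the closed configurations (those with $u^i_x=g_x=0$ for all $x$ and $i$), and $\mathbb E$ the expectation with respect to $\mu$ restricted to the closed configurations and divided by $\mathbb Z^\ell$. For $x\ne y$ let $\mathbb G(x,y)=\lambda^2\,\mu(\mathcal W_{x,y})/\mathbb Z^\ell$, where $\mathcal W_{x,y}$ is the set of configurations with $u^1_z=u^2_z=1$, $u^i_z=0$ for $i\ge3$ and $g_z=2$ for $z\in\{x,y\}$, and $u^i_z=g_z=0$ for all other $z$ and all $i$. \textbf{Proposition.} Let $d\ge1$, $N\ge2$ and let $v$ be a tempered and separable potential. For all $M,a\in(0,\infty)$ there is $R\in(0,\infty)$ such that for every good weight function $U$ with range at least $R$ there is $\lambda_0>0$ such that for all $\lambda\ge\lambda_0$ and all even $L\ge2$: $0<\mathbb Z^\ell<\infty$, the expectations below are finite, $$\mathbb E\big(m^{(1)}_{\{o,e_1\}}m^{(2)}_{\{o,e_1\}}\big)=\mathbb G(o,e_1),\qquad \mathbb E\big(m^{(1)}_{\{o,e_1\}}m^{(2)}_{\{o,e_1\}}\big)-a\,\mathbb E\big(m^{(2)}_{\{o,e_1\}}\big)\ge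 M .$$ -/

import Mathlib

open MeasureTheory
open scoped NNReal ENNReal ComplexConjugate

noncomputable section

/-! ### The random path model on a finite simple graph -/

namespace RPM

variable {V : Type} {G : SimpleGraph V}

/-- The links of a link configuration `m`: the pairs `(e, p)` with `e` an edge and `p` one of
the `m e` labels of links on `e`. -/
abbrev Link (m : G.edgeSet → ℕ) : Type := Σ e : G.edgeSet, Fin (m e)

/-- The links which touch the vertex `x`. -/
abbrev LinkAt (m : G.edgeSet → ℕ) (x : V) : Type :=
  {l : Link m // x ∈ (l.1 : Sym2 V)}

variable (G) in
/-- A configuration `w = (m, c, π, g)` of the random path model with colours in `Fin N`.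
A partition of the links touching `x` into sets of at most two links is encoded by the
involution of this set of links which exchanges the elements of every two-element block;
the fixed points are the unpaired links. -/
structure Config (N : ℕ) where
  /-- the number of links on every edge -/
  m : G.edgeSet → ℕ
  /-- every vertex is touched by an even number of links -/
  even_links : ∀ x : V, Even (Nat.card (LinkAt m x))
  /-- the colour of every link -/
  c : Link m → Fin N
  /-- the pairing at every vertex -/
  π : ∀ x : V, LinkAt m x → LinkAt m x
  π_involutive : ∀ x : V, Function.Involutive (π x)
  /-- paired links have the same colour -/
  π_colour : ∀ (x : V) (l : LinkAt m x), c (π x l).1 = c l.1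
  /-- the number of ghost pairings at every vertex -/
  g : V → Fin 3

namespace Config

variable {N : ℕ}

/-- `m_e^{(i)}`: the number of links on `e` of colour `i`. -/
def linkCount (w : Config G N) (e : Sym2 V) (i : Fin N) : ℕ :=
  Nat.card {l : Link w.m // (l.1 : Sym2 V) = e ∧ w.c l = i}

/-- `u_x^i`: the number of links of colour `i` touching `x` which are unpaired at `x`. -/
def unpaired (w : Config G N) (x : V) (i : Fin N) : ℕ :=
  Nat.card {l : LinkAt w.m x // w.c l.1 = i ∧ w.π x l = l}

/-- `n_x^i`: the number of pairings of links of colour `i` at `x`, that is half of the (even)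
number of links of colour `i` touching `x` which are paired at `x`. -/
def pairings (w : Config G N) (x : V) (i : Fin N) : ℕ :=
  Nat.card {l : LinkAt w.m x // w.c l.1 = i ∧ w.π x l ≠ l} / 2

/-- `n_x`: the total number of pairings at `x`, ghost or not. -/
def localTime (w : Config G N) (x : V) : ℕ :=
  (∑ i : Fin N, w.pairings x i) + (w.g x : ℕ)

/-- No unpaired links and no ghost pairings. -/
def IsClosed (w : Config G N) : Prop :=
  ∀ x : V, (∀ i : Fin N, w.unpaired x i = 0) ∧ w.g x = 0

/-- For `x ≠ y` (and `N ≥ 2`): at `x` and at `y` there are two ghost pairings and exactly one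
unpaired link of each of the first two colours (which are `0` and `1` in `Fin N`) and none of
the other colours; elsewhere there are neither unpaired links nor ghost pairings. -/
def IsTwoOpen (x y : V) (w : Config G N) : Prop :=
  (∀ z : V, z ≠ x → z ≠ y → (∀ i : Fin N, w.unpaired z i = 0) ∧ w.g z = 0) ∧
  (∀ z : V, z = x ∨ z = y →
    (∀ i : Fin N, w.unpaired z i = if (i : ℕ) < 2 then 1 else 0) ∧ w.g z = 2)

variable [Fintype V]

/-- The interaction `V(w) = ∑_{x,y} v(x,y) n_x n_y`. -/
def energy (v : V → V → ℝ) (w : Config G N) : ℝ :=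
  ∑ x : V, ∑ y : V, v x y * (w.localTime x : ℝ) * (w.localTime y : ℝ)

open Classical in
/-- The weight `μ(w)` of a configuration. -/
def weight (U : ℕ → ℝ≥0) (v : V → V → ℝ) (lam : ℝ) (w : Config G N) : ℝ :=
  (∏ e : G.edgeSet, lam ^ w.m e / (Nat.factorial (w.m e) : ℝ)) *
    (∏ x : V, (U (w.localTime x) : ℝ)) * Real.exp (-(energy v w))

end Config

variable [Fintype V]

variable (G) in
/-- The partition function of the configurations all of whose paths are closed. -/
def partitionFunction (U : ℕ → ℝ≥0) (v : V → V → ℝ) (N : ℕ) (lam : ℝ) : ℝ :=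
  ∑' w : {w : Config G N // w.IsClosed}, w.1.weight U v lam

/-- The function `f` is integrable for the measure `μ` restricted to closed configurations. -/
def HasMean (U : ℕ → ℝ≥0) (v : V → V → ℝ) (N : ℕ) (lam : ℝ) (f : Config G N → ℝ) : Prop :=
  Summable fun w : {w : Config G N // w.IsClosed} => w.1.weight U v lam * f w.1

/-- The expectation of `f` under the probability measure on the closed configurations which is
proportional to `μ`. -/
def mean (U : ℕ → ℝ≥0) (v : V → V → ℝ) (N : ℕ) (lam : ℝ) (f : Config G N → ℝ) : ℝ :=
  (∑' w : {w : Config G N // w.IsClosed}, w.1.weight U v lam * f w.1) /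
    partitionFunction G U v N lam

variable (G) in
/-- The directed partition function of two distinct vertices. -/
def directedPartitionFunction (U : ℕ → ℝ≥0) (v : V → V → ℝ) (N : ℕ) (lam : ℝ) (x y : V) : ℝ :=
  ∑' w : {w : Config G N // w.IsTwoOpen x y}, w.1.weight U v lam

variable (G) in
/-- The two-point function at two distinct vertices. -/
def twoPoint (U : ℕ → ℝ≥0) (v : V → V → ℝ) (N : ℕ) (lam : ℝ) (x y : V) : ℝ :=
  lam ^ 2 * (directedPartitionFunction G U v N lam x y / partitionFunction G U v N lam)

end RPM

/-! ### The torus, potentials and weight functions -/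

/-- The torus of side length `L`. The coordinates of its elements in the integer interval
`(-L/2, L/2]` are given by `ZMod.valMinAbs`. -/
abbrev Torus (d L : ℕ) : Type := Fin d → ZMod L

/-- The nearest-neighbour graph on the torus. -/
def torusGraph (d L : ℕ) : SimpleGraph (Torus d L) where
  Adj x y := x ≠ y ∧ ∃ i : Fin d, y = x + Pi.single i 1 ∨ x = y + Pi.single i 1
  symm := ⟨fun _ _ h => ⟨h.1.symm, h.2.imp fun _ => Or.symm⟩⟩
  loopless := ⟨fun _ h => h.1 rfl⟩

/-- The periodic potential `v_L(x, y) = ∑_{z ∈ ℤ^d} v(y + L z - x)`. -/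
def periodicPotential {d : ℕ} (v : (Fin d → ℤ) → ℝ) (L : ℕ) (x y : Torus d L) : ℝ :=
  ∑' z : Fin d → ℤ, v fun j => (y j).valMinAbs + (L : ℤ) * z j - (x j).valMinAbs

open Classical in
/-- `v̄ = v(0) + ∑_x v(x) 1_{v(x) < 0}`. -/
def vbar {d : ℕ} (v : (Fin d → ℤ) → ℝ) : ℝ :=
  v 0 + ∑' x : Fin d → ℤ, if v x < 0 then v x else 0

/-- Tempered potentials. -/
def Tempered {d : ℕ} (v : (Fin d → ℤ) → ℝ) : Prop :=
  0 ≤ vbar v ∧ Summable fun x : Fin d → ℤ => |v x|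

/-- The reflection of the torus in the plane `{x_i = 1/2}`, which passes through the midpoints
of edges and (for even `L`) exchanges the halves `{x_i > 0}` and `{x_i ≤ 0}`. -/
def edgeReflection {d L : ℕ} (i : Fin d) (x : Torus d L) : Torus d L :=
  Function.update x i (1 - x i)

/-- `i`-separability of an interaction on the torus. -/
def ISeparable {d L : ℕ} (vL : Torus d L → Torus d L → ℝ) (i : Fin d) : Prop :=
  ∃ (k : ℕ) (T : Type) (_ : MeasurableSpace T) (ν : Measure T)
    (α β : T → Torus d L → Fin k → ℂ),
    IsFiniteMeasure ν ∧
    (∀ x, Measurable fun t => α t x) ∧ (∀ x, Measurable fun t => β t x) ∧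
    (∃ C : ℝ, ∀ t x j, ‖α t x j‖ ≤ C) ∧ (∃ C : ℝ, ∀ t x j, ‖β t x j‖ ≤ C) ∧
    (∀ x y : Torus d L, 0 < (x i).valMinAbs → (y i).valMinAbs ≤ 0 →
      ((-vL x y : ℝ) : ℂ) = ∫ t, ∑ j : Fin k, α t x j * β t y j ∂ν) ∧
    (∀ x : Torus d L, ∀ᵐ t ∂ν, ∀ j : Fin k, β t x j = conj (α t (edgeReflection i x) j))

/-- Separable potentials: `v_L` is `i`-separable for every even side length and every `i`. -/
def Separable {d : ℕ} (v : (Fin d → ℤ) → ℝ) : Prop :=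
  ∀ L : ℕ, 0 < L → Even L → ∀ i : Fin d, ISeparable (periodicPotential v L) i

/-- Good weight functions for the potential `v`. -/
def Good {d : ℕ} (v : (Fin d → ℤ) → ℝ) (U : ℕ → ℝ≥0) : Prop :=
  ∃ M : ℝ, ∀ n : ℕ,
    (n : ℝ) * ((U (n + 1) : ℝ) * Real.exp (-(vbar v * ((n + 1 : ℕ) : ℝ) ^ 2))) ≤
      M * ((U n : ℝ) * Real.exp (-(vbar v * (n : ℝ) ^ 2)))

/-- The range `sup {n : U(n) > 0}` of a weight function. -/
def weightRange (U : ℕ → ℝ≥0) : ℕ∞ :=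
  ⨆ (n : ℕ) (_ : 0 < U n), (n : ℕ∞)

end

set_option linter.unusedSectionVars false

open MeasureTheory
open scoped NNReal ENNReal ComplexConjugate

noncomputable section

open scoped Classical

namespace RPM

/-! ### Counting involutions -/

/-! The first step is to sum out labels and pairings. Only the numbers k_e^i of links of colour i on
e remain, with weight ∏ λ^k/k! times, for each vertex and colour, the number of involutions of the
links there with the prescribed number of fixed points, times a Gibbs factor in the local times.

The equality with the two-point function is a bijection in disguise. The factor k_e^i removes one
link, since k·λ^k/k! = λ·λ^(k-1)/(k-1)!. Complete pairings of n+1 points correspond to pairings of n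
points with one left unpaired (`involCount_succ_zero`). The two ghost pairings at each endpoint
restore the local time lost with the two removed pairings (`tsum_twoOpen`).

For the lower bound let m be the total number of links on {o,e₁}. Fix m and all pairings except
those at an endpoint x. The links then form strands, each with zero or two ends at x, and the
pairings at x weight the colourings of the strands that end there like a Pólya urn. Two distinct
such strands have two given distinct colours with probability 1/(N(N+2)) (`sum_pairingCount`). At
most two links of an edge lie on one strand, so N(N+2) E(m¹m²) ≥ E(m(m-2)). Colours are
exchangeable, so N E(m²) = E(m), where m¹ and m² count links of the first two colours. Everything
then follows once m > K has probability at least 1/2, for a K depending on M, a and N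
(`le_correlation`).

That m ≤ K is unlikely is shown separately for each value κ of the local time at the origin.
Separability makes the model reflection positive in every plane between neighbouring layers of
vertices, and the chessboard estimate bounds the event at one vertex by the same event imposed at
every vertex (`torus_chessboard`). Its total weight is compared with that of a single configuration
having local time κ₁ everywhere (`le_sq_tsum_closedWeight`, `sq_tsum_sparse_le`). With κ₁ = κ the
Gibbs factors cancel. The edges are a union of Δ ≤ 2d perfect matchings; emptying one of them costs
e^(-r), with r = 2κ/Δ, per vertex in squared weights, up to polynomial factors. This gives a bound
summable in κ and independent of U, λ and L (`sparseProb_le`). A cutoff κ₀ makes its tail at most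
1/4, and R = κ₀ guarantees U(κ₀) > 0. For the finitely many κ < κ₀ the comparison uses κ₁ = κ₀:
there are more links, so large λ makes these terms at most 1/4 in total (`sparseProb_small_le`).

All sums converge because temperedness bounds the energy below by v̄ ∑ n_x², while goodness makes
Ū(n) 2^n n! at most exponential in n. This absorbs the number of pairings and leaves a multiple
exponential series. -/

/-- The number of involutions of a set of `n` elements with exactly `u` fixed points. -/
def involCount (n u : ℕ) : ℕ :=
  Nat.card {f : Fin n → Fin n // Function.Involutive f ∧ Nat.card {a // f a = a} = u}

lemma card_involutions {α : Type*} [Finite α] (u : ℕ) :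
    Nat.card {f : α → α // Function.Involutive f ∧ Nat.card {a // f a = a} = u} =
      involCount (Nat.card α) u := by
  let e : α ≃ Fin (Nat.card α) := Finite.equivFin α
  refine Nat.card_congr ((Equiv.arrowCongr e e).subtypeEquiv fun f => ?_)
  have hfix : Nat.card {a // f a = a} = Nat.card {b // (Equiv.arrowCongr e e) f b = b} := by
    refine Nat.card_congr (e.subtypeEquiv fun a => ?_)
    simp [Equiv.arrowCongr]
  rw [hfix]
  refine and_congr_left fun _ => ⟨fun h b => ?_, fun h a => ?_⟩
  · simp [Equiv.arrowCongr, h (e.symm b)]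
  · have := h (e a)
    simpa [Equiv.arrowCongr] using this

lemma card_fixed_eq_zero {α : Type*} [Finite α] (f : α → α) :
    Nat.card {a // f a = a} = 0 ↔ ∀ a, f a ≠ a := by
  rw [Finite.card_eq_zero_iff, isEmpty_subtype]

lemma card_fixed_eq_one {α : Type*} (f : α → α) :
    Nat.card {a // f a = a} = 1 ↔ ∃ a, ∀ b, f b = b ↔ b = a := by
  rw [Nat.card_eq_one_iff_unique]
  constructor
  · rintro ⟨h1, ⟨a, ha⟩⟩
    refine ⟨a, fun b => ⟨fun hb => ?_, fun h => h ▸ ha⟩⟩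
    exact congrArg Subtype.val (h1.elim ⟨b, hb⟩ ⟨a, ha⟩)
  · rintro ⟨a, ha⟩
    refine ⟨⟨fun x y => Subtype.ext (((ha _).1 x.2).trans ((ha _).1 y.2).symm)⟩,
      ⟨⟨a, (ha a).2 rfl⟩⟩⟩

/-- Removing the fixed point of an involution with a single fixed point. -/
lemma card_involutions_fixing {α : Type*} [Finite α] (a : α) :
    Nat.card {f : α → α // Function.Involutive f ∧ ∀ b, f b = b ↔ b = a} =
      involCount (Nat.card {b // b ≠ a}) 0 := by
  rw [← card_involutions]
  have key : ∀ f : {f : α → α // Function.Involutive f ∧ ∀ b, f b = b ↔ b = a},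
      ∀ b : {b // b ≠ a}, f.1 b ≠ a := by
    rintro ⟨f, hf, hfa⟩ ⟨b, hb⟩ h
    have h2 := hf b
    replace h : f b = a := h
    rw [h, (hfa a).2 rfl] at h2
    exact hb h2.symm
  refine Nat.card_congr (Equiv.ofBijective (fun f => ⟨fun b => ⟨f.1 b, key f b⟩, ?_, ?_⟩) ⟨?_, ?_⟩)
  · intro b
    exact Subtype.ext (f.2.1 b)
  · rw [card_fixed_eq_zero]
    intro b hb
    exact b.2 ((f.2.2 b).1 (congrArg Subtype.val hb))
  · rintro ⟨f, hf, hfa⟩ ⟨g, hg, hga⟩ h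
    refine Subtype.ext (funext fun b => ?_)
    by_cases hb : b = a
    · change f b = g b
      rw [(hfa b).2 hb, (hga b).2 hb]
    · have := congrFun (congrArg Subtype.val h) ⟨b, hb⟩
      exact congrArg Subtype.val this
  · rintro ⟨g, hg, hg0⟩
    rw [card_fixed_eq_zero] at hg0
    have h1 : ∀ b (h : b ≠ a), (g ⟨b, h⟩ : α) ≠ a := fun b h => (g ⟨b, h⟩).2
    refine ⟨⟨fun b => if h : b = a then a else g ⟨b, h⟩, fun b => ?_, fun b => ?_⟩, ?_⟩
    · by_cases hb : b = a
      · simp [hb]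
      · simp only [hb, dite_false]
        rw [dif_neg (h1 b hb)]
        exact congrArg Subtype.val (hg ⟨b, hb⟩)
    · by_cases hb : b = a
      · simp [hb]
      · simp only [hb, dite_false, iff_false]
        exact fun h => hg0 ⟨b, hb⟩ (Subtype.ext h)
    · refine Subtype.ext (funext fun b => Subtype.ext ?_)
      change (if h : (b : α) = a then a else (g ⟨b, h⟩ : α)) = _
      rw [dif_neg b.2]

/-- Any of the n+1 points can be the fixed point, and the remaining n points carry a
fixed-point-free involution. -/
lemma involCount_succ_one (n : ℕ) : involCount (n + 1) 1 = (n + 1) * involCount n 0 := by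
  let S : Fin (n + 1) → Type := fun a =>
    {f : Fin (n + 1) → Fin (n + 1) // Function.Involutive f ∧ ∀ b, f b = b ↔ b = a}
  have h1 : involCount (n + 1) 1 = Nat.card (Σ a, S a) := by
    symm
    refine Nat.card_congr (Equiv.ofBijective
      (fun s => ⟨s.2.1, s.2.2.1, (card_fixed_eq_one _).2 ⟨s.1, s.2.2.2⟩⟩) ⟨?_, ?_⟩)
    · rintro ⟨a, f, hf, hfa⟩ ⟨b, g, hg, hgb⟩ h
      have hfg : f = g := congrArg Subtype.val h
      subst hfg
      have hab : a = b := (hgb a).1 ((hfa a).2 rfl)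
      subst hab
      rfl
    · rintro ⟨f, hf, hf1⟩
      obtain ⟨a, ha⟩ := (card_fixed_eq_one f).1 hf1
      exact ⟨⟨a, f, hf, ha⟩, rfl⟩
  rw [h1, Nat.card_sigma]
  have h2 : ∀ a, Nat.card (S a) = involCount n 0 := by
    intro a
    rw [card_involutions_fixing a]
    congr 1
    simp [Nat.card_eq_fintype_card, Fintype.card_subtype_compl]
  rw [Finset.sum_congr rfl fun a _ => h2 a]
  simp

/-- Forgetting the extra point `none` turns its partner into the only fixed point, and this can be
undone. In terms of paths, a new link is paired with the single unpaired link of its colour. -/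
lemma involCount_succ_zero (n : ℕ) : involCount (n + 1) 0 = involCount n 1 := by
  have h0 : involCount (n + 1) 0 = involCount (Nat.card (Option (Fin n))) 0 := by
    simp
  rw [h0, ← card_involutions, involCount]
  have hsome : ∀ F : {F : Option (Fin n) → Option (Fin n) //
      Function.Involutive F ∧ Nat.card {a // F a = a} = 0}, ∃ a, F.1 none = some a := by
    rintro ⟨F, hF, hF0⟩
    rw [card_fixed_eq_zero] at hF0
    exact Option.ne_none_iff_exists'.1 (hF0 none)
  refine Nat.card_congr (Equiv.ofBijective
    (fun F => ⟨fun b => (F.1 (some b)).getD b, ?_, ?_⟩) ⟨?_, ?_⟩)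
  · intro b
    rcases h : F.1 (some b) with _ | c
    · simp [h]
    · have h2 := F.2.1 (some b)
      rw [h] at h2
      simp [h, h2]
  · rw [card_fixed_eq_one]
    obtain ⟨a, ha⟩ := hsome F
    refine ⟨a, fun b => ?_⟩
    have h0 := (card_fixed_eq_zero _).1 F.2.2
    rcases h : F.1 (some b) with _ | c
    · have h2 := F.2.1 (some b)
      rw [h, ha] at h2
      simpa using (Option.some_injective _ h2).symm
    · have h3 := h0 (some b)
      rw [h] at h3
      have h4 : c ≠ b := fun hc => h3 (by rw [hc])
      simp only [Option.getD_some, h4, false_iff]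
      rintro rfl
      have h2 := F.2.1 none
      rw [ha, h] at h2
      simp at h2
  · intro F F' h
    have hfun : ∀ b, (F.1 (some b)).getD b = (F'.1 (some b)).getD b := fun b =>
      congrFun (congrArg Subtype.val h) b
    have h0 := (card_fixed_eq_zero _).1 F.2.2
    have h0' := (card_fixed_eq_zero _).1 F'.2.2
    have hs : ∀ b, F.1 (some b) = F'.1 (some b) := by
      intro b
      have hb := hfun b
      have k := h0 (some b)
      have k' := h0' (some b)
      rcases h1 : F.1 (some b) with _ | c <;> rcases h2 : F'.1 (some b) with _ | c' <;>
        rw [h1] at k hb <;> rw [h2] at k' hb <;> simp at hb k k' ⊢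
      · exact k' hb.symm
      · exact k hb
      · exact hb
    refine Subtype.ext (funext fun b => ?_)
    cases b with
    | some b => exact hs b
    | none =>
      obtain ⟨a, ha⟩ := hsome F
      have h2 := F.2.1 none
      rw [ha, hs] at h2
      have h3 := F'.2.1 (some a)
      rw [h2] at h3
      rw [ha, h3]
  · rintro ⟨f, hf, hf1⟩
    obtain ⟨a, ha⟩ := (card_fixed_eq_one f).1 hf1
    have haa : f a = a := (ha a).2 rfl
    have hne : ∀ b, b ≠ a → f b ≠ a := fun b hb h => hb (by rw [← hf b, h, haa])
    refine ⟨⟨fun o => o.elim (some a) fun b => if b = a then none else some (f b), ?_, ?_⟩, ?_⟩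
    · intro o
      cases o with
      | none => simp
      | some b =>
        by_cases hb : b = a
        · simp [hb]
        · simp [hb, hne b hb, hf b]
    · rw [card_fixed_eq_zero]
      intro o
      cases o with
      | none => simp
      | some b =>
        by_cases hb : b = a
        · simp [hb]
        · simp [hb, ha b]
    · refine Subtype.ext (funext fun b => ?_)
      by_cases hb : b = a
      · simp [hb, haa]
      · simp [hb]

lemma involCount_zero_zero : involCount 0 0 = 1 := by
  rw [involCount, Nat.card_eq_one_iff_unique]
  refine ⟨⟨fun f g => Subtype.ext (Subsingleton.elim _ _)⟩, ⟨⟨id, fun _ => rfl, by simp⟩⟩⟩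

lemma involCount_zero_one : involCount 0 1 = 0 := by
  rw [involCount, Finite.card_eq_zero_iff]
  exact ⟨fun f => by simpa using f.2.2⟩

lemma involCount_one_zero : involCount 1 0 = 0 := by
  rw [involCount_succ_zero, involCount_zero_one]

lemma involCount_add_two (n : ℕ) : involCount (n + 2) 0 = (n + 1) * involCount n 0 := by
  rw [involCount_succ_zero, involCount_succ_one]

lemma involCount_odd (n : ℕ) : involCount (2 * n + 1) 0 = 0 := by
  induction n with
  | zero => exact involCount_one_zero
  | succ n ih => rw [show 2 * (n + 1) + 1 = 2 * n + 1 + 2 by ring, involCount_add_two, ih, mul_zero]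

lemma even_of_involCount_ne_zero {n : ℕ} (h : involCount n 0 ≠ 0) : Even n := by
  by_contra hn
  obtain ⟨k, rfl⟩ := Nat.not_even_iff_odd.1 hn
  exact h (involCount_odd k)

/-- `(2 n - 1)!! = (2 n)! / (2 ^ n n!)`. -/
lemma involCount_two_mul (n : ℕ) :
    involCount (2 * n) 0 * (2 ^ n * n.factorial) = (2 * n).factorial := by
  induction n with
  | zero => simp [involCount_zero_zero]
  | succ n ih =>
    rw [show 2 * (n + 1) = 2 * n + 2 by ring, involCount_add_two, Nat.factorial_succ (2 * n + 1),
      Nat.factorial_succ (2 * n), ← ih, Nat.factorial_succ n]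
    ring

lemma involCount_two_mul_le (n : ℕ) : involCount (2 * n) 0 ≤ 2 ^ n * n.factorial := by
  induction n with
  | zero => simp [involCount_zero_zero]
  | succ n ih =>
    rw [show 2 * (n + 1) = 2 * n + 2 by ring, involCount_add_two, Nat.factorial_succ n, pow_succ]
    calc (2 * n + 1) * involCount (2 * n) 0 ≤ (2 * n + 2) * (2 ^ n * n.factorial) :=
          Nat.mul_le_mul (by omega) ih
      _ = _ := by ring

/-- Involutions which preserve a colouring, with prescribed numbers of fixed points of each
colour. -/
lemma card_coloured_involutions {α : Type*} [Finite α] {N : ℕ} (c : α → Fin N) (u : Fin N → ℕ) :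
    Nat.card {f : α → α // Function.Involutive f ∧ (∀ a, c (f a) = c a) ∧
      ∀ i, Nat.card {a // c a = i ∧ f a = a} = u i} =
      ∏ i, involCount (Nat.card {a // c a = i}) (u i) := by
  have hfix : ∀ (f : α → α) (h : ∀ a, c (f a) = c a) (i : Fin N),
      Nat.card {a // c a = i ∧ f a = a} =
      Nat.card {a : {a // c a = i} // (⟨f a.1, (h a.1).trans a.2⟩ : {a // c a = i}) = a} := by
    intro f h i
    refine Nat.card_congr ((Equiv.subtypeSubtypeEquivSubtypeInter (fun a => c a = i)
      (fun a => f a = a)).symm.trans (Equiv.subtypeEquivRight fun a => ?_))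
    rw [Subtype.ext_iff]
  simp_rw [← card_involutions]
  rw [← Nat.card_pi]
  refine Nat.card_congr (Equiv.ofBijective
    (fun f i => ⟨fun a => ⟨f.1 a.1, (f.2.2.1 a.1).trans a.2⟩, ?_, ?_⟩) ⟨?_, ?_⟩)
  · exact fun a => Subtype.ext (f.2.1 a.1)
  · rw [← hfix f.1 f.2.2.1 i]
    exact f.2.2.2 i
  · intro f g h
    refine Subtype.ext (funext fun a => ?_)
    have := congrFun (congrArg Subtype.val (congrFun h (c a))) ⟨a, rfl⟩
    exact congrArg Subtype.val this
  · intro g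
    have hc : ∀ a, c ((g (c a)).1 ⟨a, rfl⟩).1 = c a := fun a => ((g (c a)).1 ⟨a, rfl⟩).2
    have hg : ∀ i (a : {a // c a = i}), ((g (c a.1)).1 ⟨a.1, rfl⟩).1 = ((g i).1 a).1 := by
      rintro i ⟨a, rfl⟩
      rfl
    refine ⟨⟨fun a => ((g (c a)).1 ⟨a, rfl⟩).1, fun a => ?_, hc, fun i => ?_⟩, ?_⟩
    · have := hg (c a) ((g (c a)).1 ⟨a, rfl⟩)
      exact this.trans (congrArg Subtype.val ((g (c a)).2.1 ⟨a, rfl⟩))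
    · rw [hfix _ hc i, ← (g i).2.2]
      refine Nat.card_congr (Equiv.subtypeEquivRight fun a => ?_)
      rw [Subtype.ext_iff, Subtype.ext_iff, ← hg i a]
    · refine funext fun i => Subtype.ext (funext fun a => Subtype.ext ?_)
      exact hg i a

end RPM

/-! ### Sums over functions on a finite type -/

lemma ENNReal.tsum_pi_prod {ι : Type} [Fintype ι] (β : ι → Type) (g : ∀ i, β i → ℝ≥0∞) :
    ∑' f : ∀ i, β i, ∏ i, g i (f i) = ∏ i, ∑' b, g i b := by
  -- The `Fintype` instance is quantified after `Finite`, so that induction over finite types may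
  -- change it.
  have main : ∀ (ι : Type) [Finite ι], ∀ [Fintype ι] (β : ι → Type) (g : ∀ i, β i → ℝ≥0∞),
      ∑' f : ∀ i, β i, ∏ i, g i (f i) = ∏ i, ∑' b, g i b := by
    intro ι _
    induction ι using Finite.induction_empty_option with
    | @of_equiv α α' e ih =>
      intro _ β g
      have : Fintype α := Fintype.ofEquiv _ e.symm
      rw [← (Equiv.piCongrLeft β e).tsum_eq, ← e.prod_comp, ← ih (fun a => β (e a))]
      refine tsum_congr fun f => ?_
      rw [← e.prod_comp]
      refine Finset.prod_congr rfl fun a _ => ?_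
      rw [Equiv.piCongrLeft_apply_apply]
    | h_empty =>
      intro _ β g
      simp
    | @h_option α _ ih =>
      intro _ β g
      have : Fintype α := Fintype.ofFinite α
      have hcongr : ∀ h : Option α → ℝ≥0∞, ∏ i, h i = h none * ∏ a : α, h (some a) := by
        intro h
        refine Eq.trans ?_ (Fintype.prod_option h)
        exact Finset.prod_congr (by ext; simp) fun _ _ => rfl
      rw [← (Equiv.piOptionEquivProd (β := β)).symm.tsum_eq, ENNReal.tsum_prod', hcongr,
        ← ih (fun a => β (some a)), ← ENNReal.tsum_mul_right]
      refine tsum_congr fun b => ?_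
      rw [← ENNReal.tsum_mul_left]
      refine tsum_congr fun f => ?_
      rw [hcongr]
      rfl
  exact main ι β g

namespace RPM

/-! ### Numbers of functions with given fibres -/

/-- The numbers of elements in the fibres of a function. -/
def fiberCount {α : Type*} {N : ℕ} (f : α → Fin N) (i : Fin N) : ℕ := Nat.card {a // f a = i}

lemma sum_fiberCount {α : Type*} [Finite α] {N : ℕ} (f : α → Fin N) :
    ∑ i, fiberCount f i = Nat.card α := by
  rw [← Nat.card_congr (Equiv.sigmaFiberEquiv f), Nat.card_sigma]
  rfl

/-- These are multinomial coefficients: both the expansion over functions and the multinomial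
theorem compute (∑ X_i)^m, and the coefficients of one monomial are compared. -/
lemma card_fiberCount_eq {N : ℕ} (m : ℕ) (k : Fin N → ℕ) (hk : ∑ i, k i = m) :
    Nat.card {f : Fin m → Fin N // fiberCount f = k} * ∏ i, (k i).factorial = m.factorial := by
  have hX : ∀ f : Fin m → Fin N, ∏ j, (MvPolynomial.X (f j) : MvPolynomial (Fin N) ℕ) =
      MvPolynomial.monomial (Finsupp.equivFunOnFinite.symm (fiberCount f)) 1 := by
    intro f
    rw [MvPolynomial.monomial_eq, MvPolynomial.C_1, one_mul, Finsupp.prod_fintype _ _ (by simp),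
      ← Finset.prod_fiberwise_of_maps_to (s := Finset.univ) (t := Finset.univ) (g := f) (by simp)]
    refine Finset.prod_congr rfl fun i _ => ?_
    rw [Finset.prod_congr rfl (g := fun _ => MvPolynomial.X i) (by simp +contextual),
      Finset.prod_const]
    congr 1
    simp [fiberCount, Nat.card_eq_fintype_card, Fintype.card_subtype]
  have h1 : (∑ i : Fin N, (MvPolynomial.X i : MvPolynomial (Fin N) ℕ)) ^ m =
      ∑ f : Fin m → Fin N, ∏ j, (MvPolynomial.X (f j) : MvPolynomial (Fin N) ℕ) := by
    rw [Fintype.sum_pow]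
  have h2 := Finset.sum_pow_eq_sum_piAntidiag (Finset.univ : Finset (Fin N))
    (fun i => (MvPolynomial.X i : MvPolynomial (Fin N) ℕ)) m
  rw [h1] at h2
  simp_rw [hX] at h2
  have hX2 : ∀ l : Fin N → ℕ, ∏ i, (MvPolynomial.X i : MvPolynomial (Fin N) ℕ) ^ l i =
      MvPolynomial.monomial (Finsupp.equivFunOnFinite.symm l) 1 := by
    intro l
    rw [MvPolynomial.monomial_eq, MvPolynomial.C_1, one_mul, Finsupp.prod_fintype _ _ (by simp)]
    rfl
  simp_rw [hX2] at h2
  have h3 := congrArg (MvPolynomial.coeff (Finsupp.equivFunOnFinite.symm k)) h2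
  simp only [MvPolynomial.coeff_sum, MvPolynomial.coeff_monomial, EmbeddingLike.apply_eq_iff_eq,
    ← map_natCast (MvPolynomial.C), MvPolynomial.coeff_C_mul] at h3
  simp only [mul_ite, mul_one, mul_zero, Finset.sum_ite_eq', Finset.mem_piAntidiag] at h3
  rw [if_pos ⟨hk, by simp⟩] at h3
  rw [Nat.card_eq_fintype_card, Fintype.card_subtype, Finset.card_filter, h3, ← hk,
    ← Nat.multinomial_spec, mul_comm]
  rfl

/-! ### Sums over configurations -/

variable {V : Type} [Fintype V] {G : SimpleGraph V} {N : ℕ}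

/-- The numbers of links of every colour. -/
def colourCount {m : G.edgeSet → ℕ} (c : Link m → Fin N) (e : G.edgeSet) : Fin N → ℕ :=
  fiberCount fun p : Fin (m e) => c ⟨e, p⟩

/-- The number of links of colour `i` at `x`. -/
def deg (k : G.edgeSet → Fin N → ℕ) (x : V) (i : Fin N) : ℕ :=
  ∑ e : G.edgeSet, if x ∈ (e : Sym2 V) then k e i else 0

lemma card_linkAt_colour {m : G.edgeSet → ℕ} (c : Link m → Fin N) (x : V) (i : Fin N) :
    Nat.card {l : LinkAt m x // c l.1 = i} = deg (colourCount c) x i := by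
  have e1 : {l : LinkAt m x // c l.1 = i} ≃
      Σ e : G.edgeSet, {p : Fin (m e) // x ∈ (e : Sym2 V) ∧ c ⟨e, p⟩ = i} :=
    { toFun := fun l => ⟨l.1.1.1, l.1.1.2, l.1.2, l.2⟩
      invFun := fun s => ⟨⟨⟨s.1, s.2.1⟩, s.2.2.1⟩, s.2.2.2⟩
      left_inv := fun _ => rfl
      right_inv := fun _ => rfl }
  rw [Nat.card_congr e1, Nat.card_sigma, deg]
  refine Finset.sum_congr rfl fun e _ => ?_
  by_cases h : x ∈ (e : Sym2 V)
  · simp [h, colourCount, fiberCount]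
  · simp [h]

lemma card_linkAt (m : G.edgeSet → ℕ) (c : Link m → Fin N) (x : V) :
    Nat.card (LinkAt m x) = ∑ i, deg (colourCount c) x i := by
  rw [← Nat.card_congr (Equiv.sigmaFiberEquiv fun l : LinkAt m x => c l.1), Nat.card_sigma]
  exact Finset.sum_congr rfl fun i _ => card_linkAt_colour c x i

/-- The configurations with prescribed numbers of unpaired links and ghost pairings. -/
def Config.HasOpen (u : V → Fin N → ℕ) (g : V → Fin 3) (w : Config G N) : Prop :=
  ∀ x, (∀ i, w.unpaired x i = u x i) ∧ w.g x = g x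

/-- The pairings at `x` compatible with the colouring `c` which leave `u i` links of colour `i`
unpaired. -/
abbrev ColourPairing {m : G.edgeSet → ℕ} (c : Link m → Fin N) (x : V) (u : Fin N → ℕ) : Type :=
  {f : LinkAt m x → LinkAt m x // Function.Involutive f ∧ (∀ l, c (f l).1 = c l.1) ∧
    ∀ i, Nat.card {l : LinkAt m x // c l.1 = i ∧ f l = l} = u i}

lemma card_colourPairing {m : G.edgeSet → ℕ} (c : Link m → Fin N) (x : V) (u : Fin N → ℕ) :
    Nat.card (ColourPairing c x u) = ∏ i, involCount (deg (colourCount c) x i) (u i) := by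
  rw [ColourPairing, card_coloured_involutions (fun l : LinkAt m x => c l.1) u]
  simp_rw [card_linkAt_colour]

/-- The map restricts to a fixed-point-free involution of the moved points, and sets of odd size
have none. -/
lemma even_card_sub_fixed {α : Type*} [Finite α] (f : α → α) (hf : Function.Involutive f) :
    Even (Nat.card {a // f a ≠ a}) := by
  have h : ∀ a : {a // f a ≠ a}, f (f a) ≠ f a := fun a h => a.2 (by rw [hf] at h; exact h.symm)
  have h1 := card_involutions (α := {a // f a ≠ a}) 0
  refine even_of_involCount_ne_zero (h1 ▸ ?_)
  rw [← Nat.pos_iff_ne_zero, Nat.card_pos_iff]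
  refine ⟨⟨⟨fun a => ⟨f a, h a⟩, fun a => Subtype.ext (hf a), ?_⟩⟩, inferInstance⟩
  rw [card_fixed_eq_zero]
  exact fun a ha => a.2 (congrArg Subtype.val ha)

lemma card_eq_fixed_add {α : Type*} [Finite α] (f : α → α) :
    Nat.card α = Nat.card {a // f a = a} + Nat.card {a // f a ≠ a} := by
  rw [← Nat.card_sum]
  exact Nat.card_congr (Equiv.sumCompl fun a => f a = a).symm

lemma card_fixed_colour {α : Type*} [Finite α] (c : α → Fin N) (P : α → Prop) :
    Nat.card {a // P a} = ∑ i, Nat.card {a // c a = i ∧ P a} := by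
  rw [← Nat.card_congr (Equiv.sigmaFiberEquiv fun a : {a // P a} => c a.1), Nat.card_sigma]
  refine Finset.sum_congr rfl fun i _ => Nat.card_congr ?_
  exact (Equiv.subtypeSubtypeEquivSubtypeInter P (fun a => c a = i)).trans
    (Equiv.subtypeEquivRight fun a => and_comm)

/-- A configuration is given by its numbers of links, its colours and its pairings. -/
def configEquiv (u : V → Fin N → ℕ) (g : V → Fin 3) (hu : ∀ x, Even (∑ i, u x i)) :
    {w : Config G N // w.HasOpen u g} ≃
      Σ m : G.edgeSet → ℕ, Σ c : Link m → Fin N, ∀ x, ColourPairing c x (u x) where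
  toFun w := ⟨w.1.m, w.1.c, fun x => ⟨w.1.π x, w.1.π_involutive x, w.1.π_colour x, (w.2 x).1⟩⟩
  invFun s := ⟨{
    m := s.1
    even_links := fun x => by
      rw [card_eq_fixed_add (s.2.2 x).1,
        card_fixed_colour (fun l : LinkAt s.1 x => s.2.1 l.1) (fun l => (s.2.2 x).1 l = l),
        Finset.sum_congr rfl fun i _ => (s.2.2 x).2.2.2 i]
      exact (hu x).add (even_card_sub_fixed _ (s.2.2 x).2.1)
    c := s.2.1
    π := fun x => (s.2.2 x).1
    π_involutive := fun x => (s.2.2 x).2.1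
    π_colour := fun x => (s.2.2 x).2.2.1
    g := g }, fun x => ⟨(s.2.2 x).2.2.2, rfl⟩⟩
  left_inv := by
    rintro ⟨⟨m, hm, c, π, h1, h2, g'⟩, hw⟩
    have hg : g' = g := funext fun x => (hw x).2
    subst hg
    rfl
  right_inv := fun _ => rfl

/-- Summation over the pairings. -/
lemma tsum_config (u : V → Fin N → ℕ) (g : V → Fin 3) (hu : ∀ x, Even (∑ i, u x i))
    (F : ∀ m : G.edgeSet → ℕ, (Link m → Fin N) → ℝ≥0∞) :
    ∑' w : {w : Config G N // w.HasOpen u g}, F w.1.m w.1.c =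
      ∑' m : G.edgeSet → ℕ, ∑ c : Link m → Fin N,
        ((∏ x, Nat.card (ColourPairing c x (u x)) : ℕ) : ℝ≥0∞) * F m c := by
  rw [← (configEquiv u g hu).symm.tsum_eq, ENNReal.tsum_sigma']
  refine tsum_congr fun m => ?_
  rw [ENNReal.tsum_sigma', tsum_fintype]
  refine Finset.sum_congr rfl fun c _ => ?_
  rw [tsum_fintype]
  change ∑ _, F m c = _
  rw [Finset.sum_const, nsmul_eq_mul, Finset.card_univ, ← Nat.card_eq_fintype_card, Nat.card_pi]

/-- The weight of the numbers of coloured links. -/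
def linkMass (lam : ℝ) (k : G.edgeSet → Fin N → ℕ) : ℝ :=
  ∏ e, ∏ i, lam ^ k e i / (k e i).factorial

/-- There are m!/∏ k_i! colourings of m labelled links with colour numbers k, which cancels the 1/m!
of the weight. -/
lemma tsum_fiberCount_eq {lam : ℝ} (k : Fin N → ℕ) :
    ∑' s : {s : Σ m : ℕ, (Fin m → Fin N) // fiberCount s.2 = k},
      ENNReal.ofReal (lam ^ s.1.1 / s.1.1.factorial) =
      ENNReal.ofReal (∏ i, lam ^ k i / (k i).factorial) := by
  let e : {s : Σ m : ℕ, (Fin m → Fin N) // fiberCount s.2 = k} ≃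
      {f : Fin (∑ i, k i) → Fin N // fiberCount f = k} :=
    (Equiv.ofBijective (fun f => ⟨⟨_, f.1⟩, f.2⟩) ⟨fun f g h => by
        have h1 := congrArg Subtype.val h
        simp only [Sigma.mk.injEq, heq_eq_eq, true_and] at h1
        exact Subtype.ext h1, by
      rintro ⟨⟨m, f⟩, hf⟩
      have hm : ∑ i, k i = m := by
        rw [← hf, sum_fiberCount]
        simp
      subst hm
      exact ⟨⟨f, hf⟩, rfl⟩⟩).symm
  rw [← e.symm.tsum_eq, tsum_fintype]
  have : ∀ f, (e.symm f).1.1 = ∑ i, k i := fun f => rfl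
  simp_rw [this]
  rw [Finset.sum_const, Finset.card_univ, ← Nat.card_eq_fintype_card, ← ENNReal.ofReal_nsmul,
    nsmul_eq_mul, ← card_fiberCount_eq (∑ i, k i) k rfl, Finset.prod_div_distrib,
    Finset.prod_pow_eq_pow_sum]
  congr 1
  have h0 : (Nat.card {f : Fin (∑ i, k i) → Fin N // fiberCount f = k} : ℝ) ≠ 0 := by
    have := card_fiberCount_eq (∑ i, k i) k rfl
    have hp := Nat.factorial_pos (∑ i, k i)
    rw [← this] at hp
    exact_mod_cast (pos_of_mul_pos_left hp (Nat.zero_le _)).ne'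
  have h1 : (∏ i, ((k i).factorial : ℝ)) ≠ 0 :=
    Finset.prod_ne_zero_iff.2 fun i _ => by positivity
  push_cast
  field_simp

/-- Summation over the labels of the links. -/
lemma tsum_colour {lam : ℝ} (hlam : 0 ≤ lam) (H : (G.edgeSet → Fin N → ℕ) → ℝ≥0∞) :
    ∑' m : G.edgeSet → ℕ, ∑ c : Link m → Fin N,
        ENNReal.ofReal (∏ e, lam ^ m e / (m e).factorial) * H (colourCount c) =
      ∑' k : G.edgeSet → Fin N → ℕ, ENNReal.ofReal (linkMass lam k) * H k := by
  let S : Type := Σ m : ℕ, (Fin m → Fin N)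
  let w : S → ℝ≥0∞ := fun s => ENNReal.ofReal (lam ^ s.1 / s.1.factorial)
  let cnt : (G.edgeSet → S) → (G.edgeSet → Fin N → ℕ) := fun s e => fiberCount (s e).2
  let E : (Σ m : G.edgeSet → ℕ, (Link m → Fin N)) ≃ (G.edgeSet → S) :=
    (Equiv.sigmaCongrRight fun m : G.edgeSet → ℕ =>
      (Equiv.piCurry fun (e : G.edgeSet) (_ : Fin (m e)) => Fin N)).trans
      { toFun := fun s e => ⟨s.1 e, s.2 e⟩
        invFun := fun s => ⟨fun e => (s e).1, fun e => (s e).2⟩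
        left_inv := fun _ => rfl
        right_inv := fun _ => rfl }
  have hlhs : ∑' m : G.edgeSet → ℕ, ∑ c : Link m → Fin N,
        ENNReal.ofReal (∏ e, lam ^ m e / (m e).factorial) * H (colourCount c) =
      ∑' s : G.edgeSet → S, (∏ e, w (s e)) * H (cnt s) := by
    rw [← E.tsum_eq, ENNReal.tsum_sigma']
    refine tsum_congr fun m => ?_
    rw [tsum_fintype]
    refine Finset.sum_congr rfl fun c _ => ?_
    rw [ENNReal.ofReal_prod_of_nonneg fun e _ => by positivity]
    rfl
  rw [hlhs, ← (Equiv.sigmaFiberEquiv cnt).tsum_eq, ENNReal.tsum_sigma']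
  refine tsum_congr fun k => ?_
  have hH : ∀ s : {s // cnt s = k}, (∏ e, w ((Equiv.sigmaFiberEquiv cnt ⟨k, s⟩) e)) *
      H (cnt (Equiv.sigmaFiberEquiv cnt ⟨k, s⟩)) = (∏ e, w (s.1 e)) * H k := by
    rintro ⟨s, rfl⟩
    rfl
  simp_rw [hH]
  rw [ENNReal.tsum_mul_right]
  congr 1
  rw [linkMass, ENNReal.ofReal_prod_of_nonneg
    fun e _ => Finset.prod_nonneg fun i _ => by positivity]
  have hone : ∀ e, ENNReal.ofReal (∏ i, lam ^ k e i / (k e i).factorial) =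
      ∑' s : {s : S // fiberCount s.2 = k e}, w s.1 := fun e => (tsum_fiberCount_eq (k e)).symm
  simp_rw [hone]
  rw [← ENNReal.tsum_pi_prod]
  let E2 : {s // cnt s = k} ≃ ∀ e, {s : S // fiberCount s.2 = k e} :=
    { toFun := fun s e => ⟨s.1 e, congrFun s.2 e⟩
      invFun := fun s => ⟨fun e => (s e).1, funext fun e => (s e).2⟩
      left_inv := fun _ => rfl
      right_inv := fun _ => rfl }
  rw [← E2.tsum_eq]
  rfl

/-- Summation over the configurations for functions of the numbers of coloured links. -/
lemma tsum_config_count {lam : ℝ} (hlam : 0 ≤ lam) (u : V → Fin N → ℕ) (g : V → Fin 3)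
    (hu : ∀ x, Even (∑ i, u x i)) (F : (G.edgeSet → Fin N → ℕ) → ℝ≥0∞) :
    ∑' w : {w : Config G N // w.HasOpen u g},
        ENNReal.ofReal (∏ e, lam ^ w.1.m e / (w.1.m e).factorial) * F (colourCount w.1.c) =
      ∑' k : G.edgeSet → Fin N → ℕ, ENNReal.ofReal (linkMass lam k) *
        (((∏ x, ∏ i, involCount (deg k x i) (u x i) : ℕ) : ℝ≥0∞) * F k) := by
  rw [tsum_config u g hu fun m c =>
    ENNReal.ofReal (∏ e, lam ^ m e / (m e).factorial) * F (colourCount c), ← tsum_colour hlam]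
  refine tsum_congr fun m => Finset.sum_congr rfl fun c _ => ?_
  simp_rw [card_colourPairing]
  ring

end RPM

/-! ### Weights as functions of the coloured link numbers -/

namespace RPM

variable {V : Type} [Fintype V] {G : SimpleGraph V} {N : ℕ}

/-- The part of the weight which depends on the local times only. -/
def gibbs (U : ℕ → ℝ≥0) (v : V → V → ℝ) (n : V → ℕ) : ℝ :=
  (∏ x, (U (n x) : ℝ)) * Real.exp (-∑ x, ∑ y, v x y * (n x : ℝ) * (n y : ℝ))

lemma gibbs_nonneg (U : ℕ → ℝ≥0) (v : V → V → ℝ) (n : V → ℕ) : 0 ≤ gibbs U v n := by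
  unfold gibbs
  positivity

/-- The local time at `x` of the closed configurations with given link numbers. -/
def closedTime (k : G.edgeSet → Fin N → ℕ) (x : V) : ℕ := ∑ i, deg k x i / 2

/-- The total weight of the closed configurations with given link numbers. -/
def closedWeight (U : ℕ → ℝ≥0) (v : V → V → ℝ) (lam : ℝ) (k : G.edgeSet → Fin N → ℕ) : ℝ :=
  linkMass lam k * (∏ x, ∏ i, (involCount (deg k x i) 0 : ℝ)) * gibbs U v (closedTime k)

lemma linkMass_nonneg {lam : ℝ} (hlam : 0 ≤ lam) (k : G.edgeSet → Fin N → ℕ) :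
    0 ≤ linkMass lam k :=
  Finset.prod_nonneg fun _ _ => Finset.prod_nonneg fun _ _ => by positivity

lemma closedWeight_nonneg (U : ℕ → ℝ≥0) (v : V → V → ℝ) {lam : ℝ} (hlam : 0 ≤ lam)
    (k : G.edgeSet → Fin N → ℕ) : 0 ≤ closedWeight U v lam k :=
  mul_nonneg (mul_nonneg (linkMass_nonneg hlam k) (by positivity)) (gibbs_nonneg U v _)

lemma Config.weight_eq (U : ℕ → ℝ≥0) (v : V → V → ℝ) (lam : ℝ) (w : Config G N) :
    w.weight U v lam =
      (∏ e : G.edgeSet, lam ^ w.m e / (w.m e).factorial) * gibbs U v w.localTime := by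
  rw [Config.weight, gibbs, mul_assoc]
  rfl

lemma Config.weight_nonneg (U : ℕ → ℝ≥0) (v : V → V → ℝ) {lam : ℝ} (hlam : 0 ≤ lam)
    (w : Config G N) : 0 ≤ w.weight U v lam := by
  rw [Config.weight_eq]
  exact mul_nonneg (Finset.prod_nonneg fun _ _ => by positivity) (gibbs_nonneg U v _)

lemma Config.pairings_eq (w : Config G N) (x : V) (i : Fin N) :
    w.pairings x i = (deg (colourCount w.c) x i - w.unpaired x i) / 2 := by
  rw [Config.pairings, Config.unpaired]
  congr 1
  refine eq_tsub_of_add_eq ?_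
  rw [← card_linkAt_colour, ← Nat.card_sum]
  refine Nat.card_congr ?_
  refine (Equiv.sumCongr (Equiv.subtypeSubtypeEquivSubtypeInter (fun l : LinkAt w.m x => w.c l.1 = i)
    fun l => w.π x l ≠ l).symm (Equiv.subtypeSubtypeEquivSubtypeInter
    (fun l : LinkAt w.m x => w.c l.1 = i) fun l => w.π x l = l).symm).trans ?_
  exact (Equiv.sumComm _ _).trans
    (Equiv.sumCompl fun l : {l : LinkAt w.m x // w.c l.1 = i} => w.π x l.1 = l.1)

/-- The local times of the configurations in `HasOpen u g`. -/
def openTime (u : V → Fin N → ℕ) (g : V → Fin 3) (k : G.edgeSet → Fin N → ℕ) (x : V) : ℕ :=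
  ∑ i, (deg k x i - u x i) / 2 + (g x : ℕ)

lemma Config.HasOpen.localTime_eq {u : V → Fin N → ℕ} {g : V → Fin 3} {w : Config G N}
    (h : w.HasOpen u g) : w.localTime = openTime u g (colourCount w.c) := by
  funext x
  rw [Config.localTime, openTime, (h x).2]
  congr 1
  refine Finset.sum_congr rfl fun i _ => ?_
  rw [Config.pairings_eq, (h x).1]

lemma tsum_hasOpen (U : ℕ → ℝ≥0) (v : V → V → ℝ) {lam : ℝ} (hlam : 0 ≤ lam)
    (u : V → Fin N → ℕ) (g : V → Fin 3) (hu : ∀ x, Even (∑ i, u x i))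
    (f : (G.edgeSet → Fin N → ℕ) → ℝ) :
    ∑' w : {w : Config G N // w.HasOpen u g},
        ENNReal.ofReal (w.1.weight U v lam * f (colourCount w.1.c)) =
      ∑' k : G.edgeSet → Fin N → ℕ, ENNReal.ofReal (linkMass lam k *
        (∏ x, ∏ i, (involCount (deg k x i) (u x i) : ℝ)) *
          gibbs U v (openTime u g k) * f k) := by
  have h := tsum_config_count hlam u g hu
    (fun k : G.edgeSet → Fin N → ℕ => ENNReal.ofReal (gibbs U v (openTime u g k) * f k))
  refine Eq.trans (tsum_congr fun w => ?_) (h.trans (tsum_congr fun k => ?_))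
  · rw [Config.weight_eq, w.2.localTime_eq, mul_assoc,
      ENNReal.ofReal_mul (Finset.prod_nonneg fun _ _ => by positivity)]
  · rw [mul_assoc, mul_assoc, ENNReal.ofReal_mul (linkMass_nonneg hlam k),
      ENNReal.ofReal_mul (Finset.prod_nonneg fun _ _ =>
        Finset.prod_nonneg fun _ _ => Nat.cast_nonneg _)]
    congr 2
    rw [← ENNReal.ofReal_natCast]
    push_cast
    rfl

lemma tsum_closed (U : ℕ → ℝ≥0) (v : V → V → ℝ) {lam : ℝ} (hlam : 0 ≤ lam)
    (f : (G.edgeSet → Fin N → ℕ) → ℝ) :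
    ∑' w : {w : Config G N // w.IsClosed},
        ENNReal.ofReal (w.1.weight U v lam * f (colourCount w.1.c)) =
      ∑' k : G.edgeSet → Fin N → ℕ, ENNReal.ofReal (closedWeight U v lam k * f k) := by
  have h := tsum_hasOpen (G := G) U v hlam (0 : V → Fin N → ℕ) 0 (by simp) f
  refine h.trans (tsum_congr fun k => ?_)
  have : openTime (0 : V → Fin N → ℕ) 0 k = closedTime k := by
    funext x
    simp [openTime, closedTime]
  rw [this]
  rfl

/-! ### The two-point function of neighbours -/

/-- Adding a link of colour `i` to the edge `e`. -/
def addLink (k : G.edgeSet → Fin N → ℕ) (e : G.edgeSet) (i : Fin N) : G.edgeSet → Fin N → ℕ :=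
  k + Pi.single e (Pi.single i 1)

lemma addLink_apply (k : G.edgeSet → Fin N → ℕ) (e e' : G.edgeSet) (i i' : Fin N) :
    addLink k e i e' i' = k e' i' + if e' = e ∧ i' = i then 1 else 0 := by
  by_cases h : e' = e
  · subst h
    by_cases h2 : i' = i
    · subst h2
      simp [addLink]
    · simp [addLink, h2]
  · simp [addLink, h]

lemma linkMass_addLink (lam : ℝ) (k : G.edgeSet → Fin N → ℕ) (e : G.edgeSet) (i : Fin N) :
    (addLink k e i e i : ℝ) * linkMass lam (addLink k e i) = lam * linkMass lam k := by
  have h1 : ∀ k : G.edgeSet → Fin N → ℕ, linkMass lam k =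
      ∏ p : G.edgeSet × Fin N, lam ^ k p.1 p.2 / (k p.1 p.2).factorial := fun k => by
    rw [linkMass, Fintype.prod_prod_type]
  rw [h1, h1, ← Finset.mul_prod_erase _ _ (Finset.mem_univ (e, i)),
    ← Finset.mul_prod_erase _ _ (Finset.mem_univ (e, i)), ← mul_assoc, ← mul_assoc]
  congr 1
  · simp only [addLink_apply, and_self, if_true]
    rw [Nat.factorial_succ, pow_succ]
    have := Nat.factorial_ne_zero (k e i)
    push_cast
    field_simp
  · refine Finset.prod_congr rfl fun p hp => ?_
    have : ¬ (p.1 = e ∧ p.2 = i) := fun h => Finset.ne_of_mem_erase hp (Prod.ext h.1 h.2)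
    rw [addLink_apply, if_neg this, add_zero]

/-- A factor k_e^i is traded for λ and one additional link. The terms with k_e^i = 0 vanish, so
nothing is lost when reindexing by the injection `addLink`. -/
lemma tsum_addLink {lam : ℝ} (hlam : 0 ≤ lam) (e : G.edgeSet) (i : Fin N)
    (H : (G.edgeSet → Fin N → ℕ) → ℝ≥0∞) :
    ∑' k, ENNReal.ofReal (k e i * linkMass lam k) * H k =
      ENNReal.ofReal lam * ∑' k, ENNReal.ofReal (linkMass lam k) * H (addLink k e i) := by
  have hinj : Function.Injective fun k : G.edgeSet → Fin N → ℕ => addLink k e i :=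
    fun k k' h => add_right_cancel h
  rw [← hinj.tsum_eq, ← ENNReal.tsum_mul_left]
  · refine tsum_congr fun k => ?_
    rw [linkMass_addLink, ENNReal.ofReal_mul hlam, mul_assoc]
  · intro k hk
    have hk0 : k e i ≠ 0 := by
      intro h
      apply hk
      simp [h]
    -- Truncated subtraction is harmless here because k e i ≠ 0.
    refine ⟨fun e' i' => k e' i' - if e' = e ∧ i' = i then 1 else 0, ?_⟩
    funext e' i'
    simp only [addLink_apply]
    split_ifs with h
    · obtain ⟨rfl, rfl⟩ := h
      omega
    · rfl

lemma deg_addLink (k : G.edgeSet → Fin N → ℕ) (e : G.edgeSet) (i j : Fin N) (x : V) :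
    deg (addLink k e i) x j = deg k x j + if x ∈ (e : Sym2 V) ∧ j = i then 1 else 0 := by
  have h : ∀ e' : G.edgeSet, (if x ∈ (e' : Sym2 V) then addLink k e i e' j else 0) =
      (if x ∈ (e' : Sym2 V) then k e' j else 0) +
        if e' = e then (if x ∈ (e : Sym2 V) ∧ j = i then 1 else 0) else 0 := by
    intro e'
    rw [addLink_apply]
    by_cases h1 : e' = e
    · subst h1
      by_cases h2 : x ∈ (e' : Sym2 V) <;> simp [h2]
    · simp [h1]
  rw [deg, Finset.sum_congr rfl fun e' _ => h e', Finset.sum_add_distrib]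
  simp [deg]

/-- The numbers of unpaired links in the two-point function. -/
def twoOpenUnpaired (N : ℕ) (x y z : V) (i : Fin N) : ℕ :=
  if (z = x ∨ z = y) ∧ (i : ℕ) < 2 then 1 else 0

/-- The numbers of ghost pairings in the two-point function. -/
def twoOpenGhost (x y z : V) : Fin 3 := if z = x ∨ z = y then 2 else 0

lemma isTwoOpen_iff (x y : V) (w : Config G N) :
    w.IsTwoOpen x y ↔ w.HasOpen (twoOpenUnpaired N x y) (twoOpenGhost x y) := by
  constructor
  · intro h z
    by_cases hz : z = x ∨ z = y
    · simpa [twoOpenUnpaired, twoOpenGhost, hz] using h.2 z hz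
    · push Not at hz
      simpa [twoOpenUnpaired, twoOpenGhost, hz] using h.1 z hz.1 hz.2
  · intro h
    refine ⟨fun z h1 h2 => ?_, fun z hz => ?_⟩
    · simpa [twoOpenUnpaired, twoOpenGhost, h1, h2] using h z
    · simpa [twoOpenUnpaired, twoOpenGhost, hz] using h z

lemma sum_lt_two (hN : 2 ≤ N) : ∑ i : Fin N, (if (i : ℕ) < 2 then 1 else 0) = 2 := by
  obtain ⟨n, rfl⟩ := Nat.exists_eq_add_of_le hN
  rw [Fin.sum_univ_add, Fin.sum_univ_two, Finset.sum_eq_zero (s := (Finset.univ : Finset (Fin n)))]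
  · rfl
  · intro i _
    rw [Fin.val_natAdd, if_neg (by omega)]

lemma sum_twoOpenUnpaired (hN : 2 ≤ N) (x y z : V) :
    ∑ i, twoOpenUnpaired N x y z i = (twoOpenGhost x y z : ℕ) := by
  by_cases hz : z = x ∨ z = y
  · simp only [twoOpenUnpaired, twoOpenGhost, hz, true_and, if_true]
    exact sum_lt_two hN
  · simp [twoOpenUnpaired, twoOpenGhost, hz]

/-- Adding one link of each of the first two colours between two neighbours turns the directed
configurations into closed ones. -/
lemma tsum_twoOpen (hN : 2 ≤ N) (U : ℕ → ℝ≥0) (v : V → V → ℝ) {lam : ℝ} (hlam : 0 ≤ lam)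
    {x y : V} (hxy : s(x, y) ∈ G.edgeSet) :
    ENNReal.ofReal (lam ^ 2) * ∑' w : {w : Config G N // w.IsTwoOpen x y},
        ENNReal.ofReal (w.1.weight U v lam) =
      ∑' k : G.edgeSet → Fin N → ℕ, ENNReal.ofReal (closedWeight U v lam k *
        (k ⟨s(x, y), hxy⟩ ⟨0, by omega⟩ * k ⟨s(x, y), hxy⟩ ⟨1, by omega⟩)) := by
  set e : G.edgeSet := ⟨s(x, y), hxy⟩
  set i0 : Fin N := ⟨0, by omega⟩
  set i1 : Fin N := ⟨1, by omega⟩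
  have hi : i0 ≠ i1 := by simp [i0, i1]
  have hsum := sum_twoOpenUnpaired hN (V := V) x y
  have h1 : ∑' w : {w : Config G N // w.IsTwoOpen x y}, ENNReal.ofReal (w.1.weight U v lam) =
      ∑' w : {w : Config G N // w.HasOpen (twoOpenUnpaired N x y) (twoOpenGhost x y)},
        ENNReal.ofReal (w.1.weight U v lam * 1) := by
    rw [← (Equiv.subtypeEquivRight fun w : Config G N => isTwoOpen_iff x y w).tsum_eq]
    simp
  let H : (G.edgeSet → Fin N → ℕ) → ℝ≥0∞ := fun k =>
    ENNReal.ofReal ((∏ x, ∏ i, (involCount (deg k x i) 0 : ℝ)) * gibbs U v (closedTime k))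
  have heven : ∀ z, Even (∑ i, twoOpenUnpaired N x y z i) := by
    intro z
    rw [hsum]
    by_cases hz : z = x ∨ z = y <;> simp [twoOpenGhost, hz]
  rw [h1, tsum_hasOpen U v hlam _ _ heven fun _ => 1]
  have h2 : ∀ k : G.edgeSet → Fin N → ℕ, ENNReal.ofReal (closedWeight U v lam k *
        (k e i0 * k e i1)) =
      ENNReal.ofReal (k e i1 * linkMass lam k) * (ENNReal.ofReal (k e i0) * H k) := by
    intro k
    rw [← ENNReal.ofReal_mul (by positivity), ← ENNReal.ofReal_mul
      (mul_nonneg (by positivity) (linkMass_nonneg hlam k)), closedWeight]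
    congr 1
    ring
  simp_rw [h2]
  rw [tsum_addLink hlam e i1]
  have h3 : ∀ k : G.edgeSet → Fin N → ℕ, ENNReal.ofReal (linkMass lam k) *
        (ENNReal.ofReal (addLink k e i1 e i0) * H (addLink k e i1)) =
      ENNReal.ofReal (k e i0 * linkMass lam k) * H (addLink k e i1) := by
    intro k
    have : addLink k e i1 e i0 = k e i0 := by
      rw [addLink_apply, if_neg (by simp [hi]), add_zero]
    rw [this, ← mul_assoc, ← ENNReal.ofReal_mul (linkMass_nonneg hlam k), mul_comm (linkMass _ _)]
  simp_rw [h3]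
  rw [tsum_addLink hlam e i0, ← mul_assoc, ← ENNReal.ofReal_mul hlam, ← sq]
  congr 1
  refine tsum_congr fun k => ?_
  rw [mul_one, mul_assoc, ENNReal.ofReal_mul (linkMass_nonneg hlam k)]
  congr 1
  -- The two new links raise the degrees exactly where a link was unpaired: at x and y, in the first
  -- two colours.
  set k' := addLink (addLink k e i0) e i1 with hk'
  have hdeg : ∀ z i, deg k' z i = deg k z i + twoOpenUnpaired N x y z i := by
    intro z i
    rw [hk', deg_addLink, deg_addLink, twoOpenUnpaired]
    have he : z ∈ (e : Sym2 V) ↔ z = x ∨ z = y := by simp [e]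
    simp only [he]
    by_cases hz : z = x ∨ z = y
    · have h0 : i = i0 ↔ (i : ℕ) = 0 := by rw [Fin.ext_iff]
      have h1 : i = i1 ↔ (i : ℕ) = 1 := by rw [Fin.ext_iff]
      simp only [hz, true_and, h0, h1]
      split_ifs <;> omega
    · simp [hz]
  have hinv : ∀ z i, involCount (deg k z i) (twoOpenUnpaired N x y z i) =
      involCount (deg k' z i) 0 := by
    intro z i
    rw [hdeg]
    unfold twoOpenUnpaired
    split_ifs
    · rw [involCount_succ_zero]
    · rfl
  simp_rw [hinv]
  change _ = ENNReal.ofReal ((∏ x, ∏ i, (involCount (deg k' x i) 0 : ℝ)) * gibbs U v (closedTime k'))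
  -- If some degree is odd both sides vanish. Otherwise all degrees of k' are even, and each
  -- unpaired link, together with its new partner, accounts for one of the ghost pairings.
  by_cases hz : (∏ x, ∏ i, (involCount (deg k' x i) 0 : ℝ)) = 0
  · rw [hz, zero_mul, zero_mul]
  congr 3
  funext z
  rw [openTime, closedTime, ← hsum, ← Finset.sum_add_distrib]
  refine Finset.sum_congr rfl fun i _ => ?_
  have hz2 := Finset.prod_ne_zero_iff.1 (Finset.prod_ne_zero_iff.1 hz z (Finset.mem_univ z)) i (Finset.mem_univ i)
  obtain ⟨r, hr⟩ := even_of_involCount_ne_zero (by exact_mod_cast hz2)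
  have hd := hdeg z i
  have hu : twoOpenUnpaired N x y z i ≤ 1 := by
    unfold twoOpenUnpaired
    split_ifs <;> omega
  omega

lemma Config.linkCount_eq (w : Config G N) (e : G.edgeSet) (i : Fin N) :
    w.linkCount e i = colourCount w.c e i := by
  rw [Config.linkCount, colourCount, fiberCount]
  refine Nat.card_congr
    { toFun := fun l => ⟨Fin.cast (by rw [Subtype.ext l.2.1]) l.1.2, ?_⟩
      invFun := fun p => ⟨⟨e, p.1⟩, rfl, p.2⟩
      left_inv := ?_
      right_inv := fun _ => rfl }
  · rcases l with ⟨⟨e', p⟩, h1, h2⟩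
    obtain rfl : e' = e := Subtype.ext h1
    exact h2
  · rintro ⟨⟨e', p⟩, h1, h2⟩
    obtain rfl : e' = e := Subtype.ext h1
    rfl

end RPM

namespace RPM

/-! ### Random colourings of strands -/

section Strands

variable {Q : Type} [Fintype Q] {N : ℕ}

/-- Resampling the colour of b leaves the uniform measure invariant: swapping c b with the new
colour j is an involution of the pairs (c, j). -/
lemma sum_update (b : Q) (F : (Q → Fin N) → ℕ) :
    ∑ c : Q → Fin N, ∑ j, F (Function.update c b j) = N * ∑ c, F c := by
  have hinv : Function.Involutive fun s : (Q → Fin N) × Fin N =>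
      (Function.update s.1 b s.2, s.1 b) := by
    rintro ⟨c, j⟩
    simp
  rw [← Fintype.sum_prod_type', ← Equiv.sum_comp hinv.toPerm]
  simp only [Function.Involutive.coe_toPerm, Function.update_idem, Function.update_eq_self]
  rw [Fintype.sum_prod_type]
  simp [Finset.mul_sum]

/-- The number of ways to pair up two points for every element of `A` respecting colours. -/
def pairingCount (A : Finset Q) (c : Q → Fin N) : ℕ :=
  ∏ i, involCount (2 * (A.filter fun a => c a = i).card) 0

/-- A strand adds two points to its colour class, and the first of two new points can be matched in
2n+1 ways when the class has 2n points. This is the rule of a Pólya urn. -/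
lemma pairingCount_insert {A : Finset Q} {b : Q} (hb : b ∉ A) (c : Q → Fin N) (j : Fin N) :
    pairingCount (insert b A) (Function.update c b j) =
      (2 * (A.filter fun a => c a = j).card + 1) * pairingCount A c := by
  have h1 : ∀ i, ((insert b A).filter fun a => Function.update c b j a = i).card =
      (A.filter fun a => c a = i).card + if i = j then 1 else 0 := by
    intro i
    have h2 : A.filter (fun a => Function.update c b j a = i) = A.filter fun a => c a = i := by
      refine Finset.filter_congr fun a ha => ?_
      rw [Function.update_of_ne (fun h : a = b => hb (h ▸ ha))]
    rw [Finset.filter_insert, h2, Function.update_self]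
    by_cases h : j = i
    · rw [if_pos h, if_pos h.symm, Finset.card_insert_of_notMem (by simp [hb])]
    · rw [if_neg h, if_neg (Ne.symm h), add_zero]
  rw [pairingCount, pairingCount, ← Finset.mul_prod_erase _ _ (Finset.mem_univ j),
    ← Finset.mul_prod_erase _ _ (Finset.mem_univ j), ← mul_assoc]
  congr 1
  · rw [h1, if_pos rfl, mul_add, mul_one, involCount_add_two]
  · refine Finset.prod_congr rfl fun i hi => ?_
    rw [h1, if_neg (Finset.ne_of_mem_erase hi), add_zero]

/-- Summed over the colour of the new strand, the urn factor is 2|A| + N whatever the other colours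
are. Hence a further strand does not change the joint law of the colours already present. -/
lemma sum_pairingCount_insert {A : Finset Q} {b : Q} (hb : b ∉ A) (g : (Q → Fin N) → ℕ)
    (hg : ∀ c j, g (Function.update c b j) = g c) :
    N * ∑ c, g c * pairingCount (insert b A) c =
      (2 * A.card + N) * ∑ c, g c * pairingCount A c := by
  rw [← sum_update b, Finset.mul_sum]
  refine Finset.sum_congr rfl fun c _ => ?_
  simp_rw [hg, pairingCount_insert hb]
  rw [← Finset.mul_sum, ← Finset.sum_mul]
  have h : ∑ j, (2 * (A.filter fun a => c a = j).card + 1) = 2 * A.card + N := by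
    rw [Finset.sum_add_distrib, ← Finset.mul_sum,
      ← Finset.card_eq_sum_card_fiberwise (f := c) (t := Finset.univ) (by simp)]
    simp
  rw [h]
  ring

lemma pairingCount_pair {p q : Q} (hpq : p ≠ q) (c : Q → Fin N) :
    pairingCount {p, q} c = if c p = c q then 3 else 1 := by
  have h2 : involCount 2 0 = 1 := by
    rw [involCount_add_two 0, involCount_zero_zero]
  have h4 : involCount 4 0 = 3 := by
    rw [involCount_add_two 2, h2]
  rw [pairingCount]
  split_ifs with h
  · rw [Finset.prod_eq_single (c q)]
    · rw [Finset.filter_true_of_mem (by simp [h]), Finset.card_pair hpq]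
      exact h4
    · intro i _ hi
      rw [Finset.filter_false_of_mem (by simp [h, hi.symm])]
      exact involCount_zero_zero
    · simp
  · refine Finset.prod_eq_one fun i _ => ?_
    rw [Finset.filter_insert, Finset.filter_singleton]
    split_ifs with h1 h2'
    · exact absurd (h1.trans h2'.symm) h
    · simpa using h2
    · simpa using h2
    · simpa using involCount_zero_zero

/-- Two strands have the two given colours with probability `1 / (N (N + 2))`. -/
lemma sum_pairingCount {A : Finset Q} {p q : Q} (hpq : p ≠ q) (hp : p ∈ A) (hq : q ∈ A)
    {i₀ i₁ : Fin N} (hi : i₀ ≠ i₁) :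
    N * (N + 2) * ∑ c : Q → Fin N, (if c p = i₀ ∧ c q = i₁ then 1 else 0) * pairingCount A c =
      ∑ c : Q → Fin N, pairingCount A c := by
  have hN : 0 < N := i₀.pos
  -- The strands other than p and q are split off, to be added one at a time.
  obtain ⟨B, hB, rfl⟩ : ∃ B : Finset Q, Disjoint B {p, q} ∧ B ∪ {p, q} = A :=
    ⟨A \ {p, q}, Finset.sdiff_disjoint, Finset.sdiff_union_of_subset (by
      intro a ha
      rcases Finset.mem_insert.1 ha with rfl | ha
      · exact hp
      · rwa [Finset.mem_singleton.1 ha])⟩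
  clear hp hq
  induction B using Finset.induction_on with
  | empty =>
    rw [Finset.empty_union]
    -- With two strands only, equal colours have weight 3 and different colours weight 1; the total
    -- is 3N + N(N-1) = N(N+2).
    have h2 : ∀ F : Fin N → Fin N → ℕ, N * (N * ∑ c : Q → Fin N, F (c p) (c q)) =
        N ^ Fintype.card Q * ∑ i, ∑ j, F i j := by
      intro F
      rw [← sum_update q fun c => F (c p) (c q), ← sum_update p]
      simp only [Function.update_self, Function.update_of_ne hpq]
      simp
    have h3 := h2 fun i j => (if i = i₀ ∧ j = i₁ then 1 else 0) * if i = j then 3 else 1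
    have h4 := h2 fun i j => if i = j then 3 else 1
    have s3 : ∑ i : Fin N, ∑ j : Fin N,
        (if i = i₀ ∧ j = i₁ then 1 else 0) * (if i = j then 3 else 1) = 1 := by
      rw [Finset.sum_eq_single i₀, Finset.sum_eq_single i₁]
      · simp [hi]
      · intro j _ hj
        simp [hj]
      · simp
      · intro i _ h
        simp [h]
      · simp
    have s4 : ∑ i : Fin N, ∑ j : Fin N, (if i = j then 3 else 1) = N * (N + 2) := by
      have : ∀ i : Fin N, ∑ j : Fin N, (if i = j then 3 else 1) = N + 2 := by
        intro i
        have h : ∀ j : Fin N, (if i = j then 3 else 1) = 1 + if i = j then 2 else 0 := by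
          intro j
          split_ifs <;> rfl
        simp [h, Finset.sum_add_distrib]
      simp [this]
    rw [s3, mul_one] at h3
    rw [s4, ← h3] at h4
    simp_rw [pairingCount_pair hpq]
    have hN2 : 0 < N * N := by positivity
    refine Nat.eq_of_mul_eq_mul_left hN2 ?_
    linarith
  | insert b B hb ih =>
    rw [Finset.disjoint_insert_left] at hB
    have hbA : b ∉ B ∪ {p, q} := by
      rw [Finset.mem_union]
      exact fun h => h.elim hb hB.1
    have hbp : p ≠ b := fun h => hB.1 (by simp [h])
    have hbq : q ≠ b := fun h => hB.1 (by simp [h])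
    rw [Finset.insert_union]
    have h1 := sum_pairingCount_insert hbA
      (fun c : Q → Fin N => if c p = i₀ ∧ c q = i₁ then 1 else 0) (by
        intro c j
        simp only [Function.update_of_ne hbp, Function.update_of_ne hbq])
    have h2 := sum_pairingCount_insert hbA (fun _ : Q → Fin N => 1) (fun _ _ => rfl)
    simp only [one_mul] at h2
    rw [← ih hB.2] at h2
    refine Nat.eq_of_mul_eq_mul_left hN ?_
    rw [h2]
    linear_combination (N * (N + 2)) * h1

end Strands

/-! ### The strands obtained by cutting all loops at a vertex -/

variable {V : Type} [Fintype V] {G : SimpleGraph V} {N : ℕ}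

/-- The complete pairings at all vertices other than `x`. -/
abbrev OuterPairing (m : G.edgeSet → ℕ) (x : V) : Type :=
  ∀ z : {z // z ≠ x}, {f : LinkAt m z.1 → LinkAt m z.1 // Function.Involutive f ∧ ∀ l, f l ≠ l}

variable {m : G.edgeSet → ℕ} {x : V}

/-- Two links are adjacent if they are paired at a vertex other than `x`. -/
def strandGraph (P : OuterPairing m x) : SimpleGraph (Link m) where
  Adj l l' := ∃ (z : {z // z ≠ x}) (h : z.1 ∈ (l.1 : Sym2 V)), ((P z).1 ⟨l, h⟩).1 = l'
  symm := ⟨by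
    rintro l l' ⟨z, h, rfl⟩
    exact ⟨z, ((P z).1 ⟨l, h⟩).2, congrArg Subtype.val ((P z).2.1 ⟨l, h⟩)⟩⟩
  loopless := ⟨by
    rintro l ⟨z, h, h2⟩
    exact (P z).2.2 ⟨l, h⟩ (Subtype.ext h2)⟩

/-- The component of a link. -/
abbrev strand (P : OuterPairing m x) (l : Link m) : (strandGraph P).ConnectedComponent :=
  (strandGraph P).connectedComponentMk l

lemma card_vertices (e : G.edgeSet) : Nat.card {z // z ∈ (e : Sym2 V)} = 2 := by
  rw [Nat.card_eq_fintype_card, ← Sym2.card_toFinset_of_not_isDiag (e : Sym2 V)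
    (G.not_isDiag_of_mem_edgeSet e.2), Fintype.card_subtype]
  congr 1
  ext z
  simp

lemma card_outer_vertices (l : Link m) :
    Nat.card {z : {z // z ≠ x} // z.1 ∈ (l.1 : Sym2 V)} +
      (if x ∈ (l.1 : Sym2 V) then 1 else 0) = 2 := by
  rw [← card_vertices l.1]
  have h := Nat.card_congr (Equiv.sumCompl fun z : {z // z ∈ (l.1 : Sym2 V)} => z.1 ≠ x)
  rw [← h, Nat.card_sum]
  congr 1
  · refine Nat.card_congr
      { toFun := fun z => ⟨⟨z.1.1, z.2⟩, z.1.2⟩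
        invFun := fun z => ⟨⟨z.1.1, z.2⟩, z.1.2⟩
        left_inv := fun _ => rfl
        right_inv := fun _ => rfl }
  · split_ifs with hx
    · symm
      rw [Nat.card_eq_one_iff_unique]
      refine ⟨⟨?_⟩, ⟨⟨⟨x, hx⟩, by simp⟩⟩⟩
      rintro ⟨⟨a, ha⟩, ha'⟩ ⟨⟨b, hb⟩, hb'⟩
      simp only [ne_eq, not_not] at ha' hb'
      subst ha' hb'
      rfl
    · symm
      rw [Finite.card_eq_zero_iff]
      refine ⟨?_⟩
      rintro ⟨⟨a, ha⟩, ha'⟩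
      simp only [ne_eq, not_not] at ha'
      subst ha'
      exact hx ha

variable (P : OuterPairing m x) (q : (strandGraph P).ConnectedComponent)

lemma strand_pairing (z : {z // z ≠ x}) (l : LinkAt m z.1) :
    strand P ((P z).1 l).1 = strand P l.1 := by
  rw [SimpleGraph.ConnectedComponent.eq]
  exact (SimpleGraph.Adj.reachable (show (strandGraph P).Adj _ _ from ⟨z, l.2, rfl⟩)).symm

/-- Every link has two ends, each of them at x or at another vertex. -/
lemma sum_outer_vertices :
    ∑ l : {l // strand P l = q}, Nat.card {z : {z // z ≠ x} // z.1 ∈ (l.1.1 : Sym2 V)} +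
      Nat.card {l : LinkAt m x // strand P l.1 = q} = 2 * Nat.card {l // strand P l = q} := by
  have h1 : Nat.card {l : LinkAt m x // strand P l.1 = q} =
      ∑ l : {l // strand P l = q}, if x ∈ (l.1.1 : Sym2 V) then 1 else 0 := by
    rw [← Finset.card_filter, ← Fintype.card_subtype, ← Nat.card_eq_fintype_card]
    exact Nat.card_congr
      { toFun := fun l => ⟨⟨l.1.1, l.2⟩, l.1.2⟩
        invFun := fun l => ⟨⟨l.1.1, l.2⟩, l.1.2⟩
        left_inv := fun _ => rfl
        right_inv := fun _ => rfl }
  rw [h1, ← Finset.sum_add_distrib, Finset.sum_congr rfl fun l _ => card_outer_vertices l.1]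
  simp [mul_comm]

/-- The ends of a strand at vertices other than x are matched by the pairings there, so their number
is even, and so is the total number of ends. -/
lemma even_card_strand_ends : Even (Nat.card {l : LinkAt m x // strand P l.1 = q}) := by
  have h := sum_outer_vertices P q
  have h1 : Even (∑ l : {l // strand P l = q},
      Nat.card {z : {z // z ≠ x} // z.1 ∈ (l.1.1 : Sym2 V)}) := by
    rw [← Nat.card_sigma]
    have e1 : (Σ l : {l // strand P l = q}, {z : {z // z ≠ x} // z.1 ∈ (l.1.1 : Sym2 V)}) ≃
        Σ z : {z // z ≠ x}, {l : LinkAt m z.1 // strand P l.1 = q} :=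
      { toFun := fun s => ⟨s.2.1, ⟨s.1.1, s.2.2⟩, s.1.2⟩
        invFun := fun s => ⟨⟨s.2.1.1, s.2.2⟩, s.1, s.2.1.2⟩
        left_inv := fun _ => rfl
        right_inv := fun _ => rfl }
    rw [Nat.card_congr e1, Nat.card_sigma]
    refine Finset.even_sum _ fun z _ => ?_
    have hq := strand_pairing P z
    let f : {l : LinkAt m z.1 // strand P l.1 = q} → {l : LinkAt m z.1 // strand P l.1 = q} :=
      fun l => ⟨(P z).1 l.1, (hq l.1).trans l.2⟩
    have hf := even_card_sub_fixed f fun l => Subtype.ext ((P z).2.1 l.1)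
    have hne : ∀ l, f l ≠ l := fun l h => (P z).2.2 l.1 (congrArg Subtype.val h)
    rwa [Nat.card_congr (Equiv.subtypeUnivEquiv hne)] at hf
  rw [← Nat.even_add.1 (h ▸ even_two_mul _)]
  exact h1

/-- A connected graph on n links has at least n-1 edges, so its degrees sum to at least 2n-2. Each
neighbour of a link uses one of its ends away from x, and of the 2n ends at most two are left for x.
-/
lemma card_strand_ends_le_two : Nat.card {l : LinkAt m x // strand P l.1 = q} ≤ 2 := by
  have h := sum_outer_vertices P q
  have hconn := q.connected_toSimpleGraph
  have h1 := hconn.card_vert_le_card_edgeSet_add_one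
  have h2 := q.toSimpleGraph.sum_degrees_eq_twice_card_edges
  have h3 : ∀ l : q, q.toSimpleGraph.degree l ≤
      Nat.card {z : {z // z ≠ x} // z.1 ∈ (l.1.1 : Sym2 V)} := by
    intro l
    rw [← SimpleGraph.card_neighborSet_eq_degree, ← Nat.card_eq_fintype_card]
    have hadj : ∀ l' : q.toSimpleGraph.neighborSet l, (strandGraph P).Adj l.1 l'.1.1 :=
      fun l' => l'.2
    choose z hz hz2 using hadj
    refine Nat.card_le_card_of_injective (fun l' => ⟨z l', hz l'⟩) ?_
    intro l' l'' hl
    have hl2 : z l' = z l'' := congrArg Subtype.val hl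
    refine Subtype.ext (Subtype.ext ?_)
    rw [← hz2 l', ← hz2 l'']
    -- The membership proof depends on the vertex, so the equality of vertices is substituted in a
    -- general form.
    have key : ∀ z z' : {z // z ≠ x}, z = z' → ∀ (h : z.1 ∈ (l.1.1 : Sym2 V))
        (h' : z'.1 ∈ (l.1.1 : Sym2 V)), ((P z).1 ⟨l.1, h⟩).1 = ((P z').1 ⟨l.1, h'⟩).1 := by
      rintro z _ rfl _ _
      rfl
    exact key _ _ hl2 _ _
  have h4 := Finset.sum_le_sum fun l (_ : l ∈ Finset.univ) => h3 l
  rw [h2] at h4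
  rw [Nat.card_eq_fintype_card, Nat.card_eq_fintype_card, ← SimpleGraph.edgeFinset_card] at h1
  have h5 : ∑ l : q, Nat.card {z : {z // z ≠ x} // z.1 ∈ (l.1.1 : Sym2 V)} =
      ∑ l : {l // strand P l = q}, Nat.card {z : {z // z ≠ x} // z.1 ∈ (l.1.1 : Sym2 V)} :=
    rfl
  have h6 : Fintype.card q = Nat.card {l // strand P l = q} := by
    rw [Nat.card_eq_fintype_card]
    rfl
  omega

/-- The strands which end at `x`. -/
def openStrands : Finset (strandGraph P).ConnectedComponent :=
  Finset.univ.filter fun q => ∃ l : LinkAt m x, strand P l.1 = q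

lemma mem_openStrands (l : LinkAt m x) : strand P l.1 ∈ openStrands P := by
  simp only [openStrands, Finset.mem_filter, Finset.mem_univ, true_and]
  exact ⟨l, rfl⟩

lemma card_strand_ends :
    Nat.card {l : LinkAt m x // strand P l.1 = q} = if q ∈ openStrands P then 2 else 0 := by
  split_ifs with h
  · obtain ⟨l, hl⟩ : ∃ l : LinkAt m x, strand P l.1 = q := by simpa [openStrands] using h
    have h1 : 0 < Nat.card {l : LinkAt m x // strand P l.1 = q} :=
      Nat.card_pos_iff.2 ⟨⟨⟨l, hl⟩⟩, inferInstance⟩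
    obtain ⟨r, hr⟩ := even_card_strand_ends P q
    have := card_strand_ends_le_two P q
    omega
  · rw [Finite.card_eq_zero_iff]
    refine ⟨fun l => h ?_⟩
    rw [← l.2]
    exact mem_openStrands P l.1

/-- The colouring is constant along strands. -/
def Compatible (c : Link m → Fin N) : Prop :=
  ∀ (z : {z // z ≠ x}) (l : LinkAt m z.1), c ((P z).1 l).1 = c l.1

lemma Compatible.eq_of_strand_eq {c : Link m → Fin N} (hc : Compatible P c) {l l' : Link m}
    (h : strand P l = strand P l') : c l = c l' := by
  rw [SimpleGraph.ConnectedComponent.eq, SimpleGraph.reachable_iff_reflTransGen] at h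
  induction h with
  | refl => rfl
  | tail _ h ih =>
    obtain ⟨z, hz, rfl⟩ := h
    rw [ih, hc]

/-- Compatible colourings are colourings of the strands. -/
def compatibleEquiv :
    ((strandGraph P).ConnectedComponent → Fin N) ≃ {c : Link m → Fin N // Compatible P c} where
  toFun c := ⟨fun l => c (strand P l), fun z l => by
    exact congrArg c (strand_pairing P z l)⟩
  invFun c q := c.1 q.out
  left_inv c := by
    funext q
    change c (strand P q.out) = c q
    congr 1
    exact Quot.out_eq q
  right_inv c := by
    refine Subtype.ext (funext fun l => ?_)
    refine c.2.eq_of_strand_eq P ?_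
    exact Quot.out_eq (strand P l)

/-- Each strand that ends at x contributes two ends of its colour there, and every other strand
none. -/
lemma card_colourPairing_strands (c : (strandGraph P).ConnectedComponent → Fin N) :
    Nat.card (ColourPairing (compatibleEquiv P c).1 x (0 : Fin N → ℕ)) =
      pairingCount (openStrands P) c := by
  rw [ColourPairing, card_coloured_involutions (fun l : LinkAt m x => (compatibleEquiv P c).1 l.1),
    pairingCount]
  refine Finset.prod_congr rfl fun i _ => ?_
  congr 1
  change Nat.card {l : LinkAt m x // c (strand P l.1) = i} = _
  rw [← Nat.card_congr (Equiv.sigmaFiberEquiv fun l : {l : LinkAt m x // c (strand P l.1) = i} =>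
    strand P l.1.1), Nat.card_sigma]
  have h : ∀ q, Nat.card {l : {l : LinkAt m x // c (strand P l.1) = i} // strand P l.1.1 = q} =
      if q ∈ openStrands P ∧ c q = i then 2 else 0 := by
    intro q
    by_cases hq : c q = i
    · simp only [hq, and_true]
      rw [← card_strand_ends P q]
      refine Nat.card_congr
        { toFun := fun l => ⟨l.1.1, l.2⟩
          invFun := fun l => ⟨⟨l.1, by rw [l.2, hq]⟩, l.2⟩
          left_inv := fun _ => rfl
          right_inv := fun _ => rfl }
    · rw [if_neg (fun h => hq h.2), Finite.card_eq_zero_iff]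
      refine ⟨fun l => hq ?_⟩
      rw [← l.2]
      exact l.1.2
  rw [Finset.sum_congr rfl fun q _ => h q, ← Finset.sum_filter, Finset.sum_const, smul_eq_mul,
    mul_comm]
  congr 2
  ext q
  simp

/-- Choosing the pairings away from x first forces the colouring to be constant along strands. Only
the pairings at x still depend on the colours. -/
lemma sum_colourings_eq (f : (Link m → Fin N) → ℕ) :
    ∑ c : Link m → Fin N, (∏ z, Nat.card (ColourPairing c z (0 : Fin N → ℕ))) * f c =
      ∑ P : OuterPairing m x, ∑ c : (strandGraph P).ConnectedComponent → Fin N,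
        pairingCount (openStrands P) c * f (compatibleEquiv P c).1 := by
  have h1 : ∀ c : Link m → Fin N, ∏ z, Nat.card (ColourPairing c z (0 : Fin N → ℕ)) =
      ∑ P : OuterPairing m x, if Compatible P c then
        Nat.card (ColourPairing c x (0 : Fin N → ℕ)) else 0 := by
    intro c
    rw [← Finset.sum_filter, Finset.sum_const, smul_eq_mul, ← Fintype.card_subtype,
      ← Nat.card_eq_fintype_card]
    have e1 : {P : OuterPairing m x // Compatible P c} ≃
        ∀ z : {z // z ≠ x}, ColourPairing c z.1 (0 : Fin N → ℕ) :=
      { toFun := fun P z => ⟨(P.1 z).1, (P.1 z).2.1, P.2 z, fun i => by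
          rw [Pi.zero_apply, Finite.card_eq_zero_iff]
          exact ⟨fun l => (P.1 z).2.2 l.1 l.2.2⟩⟩
        invFun := fun P => ⟨fun z => ⟨(P z).1, (P z).2.1, fun l hl => by
          have := (P z).2.2.2 (c l.1)
          rw [Pi.zero_apply, Finite.card_eq_zero_iff] at this
          exact this.elim ⟨l, rfl, hl⟩⟩, fun z => (P z).2.2.1⟩
        left_inv := fun _ => rfl
        right_inv := fun _ => rfl }
    rw [Nat.card_congr e1, Nat.card_pi, mul_comm, ← Finset.mul_prod_erase _ _ (Finset.mem_univ x),
      Finset.prod_subtype (Finset.univ.erase x) (p := fun z => z ≠ x) (by simp)]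
  simp_rw [h1, Finset.sum_mul]
  rw [Finset.sum_comm]
  refine Finset.sum_congr rfl fun P _ => ?_
  simp_rw [ite_mul, zero_mul]
  rw [← Finset.sum_filter, ← Finset.sum_subtype_eq_sum_filter, Finset.subtype_univ,
    ← (compatibleEquiv P).sum_comp]
  refine Finset.sum_congr rfl fun c _ => ?_
  rw [card_colourPairing_strands]

/-- Two links on an edge at `x` are on different strands unless they are the two ends of the
same strand, so that they often have the first two colours. -/
lemma sum_strands (e : G.edgeSet) (he : x ∈ (e : Sym2 V)) {i₀ i₁ : Fin N} (hi : i₀ ≠ i₁) :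
    (m e * (m e - 2)) * ∑ c : (strandGraph P).ConnectedComponent → Fin N,
        pairingCount (openStrands P) c ≤
      N * (N + 2) * ∑ c : (strandGraph P).ConnectedComponent → Fin N,
        pairingCount (openStrands P) c * (colourCount (compatibleEquiv P c).1 e i₀ *
          colourCount (compatibleEquiv P c).1 e i₁) := by
  set s : Fin (m e) → (strandGraph P).ConnectedComponent := fun p => strand P ⟨e, p⟩ with hs
  have hcount : ∀ (c : (strandGraph P).ConnectedComponent → Fin N) (i : Fin N),
      colourCount (compatibleEquiv P c).1 e i = ∑ p, if c (s p) = i then 1 else 0 := by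
    intro c i
    rw [colourCount, fiberCount, ← Finset.card_filter, ← Fintype.card_subtype,
      ← Nat.card_eq_fintype_card]
    rfl
  have h1 : ∑ c : (strandGraph P).ConnectedComponent → Fin N,
        pairingCount (openStrands P) c * (colourCount (compatibleEquiv P c).1 e i₀ *
          colourCount (compatibleEquiv P c).1 e i₁) =
      ∑ p, ∑ p', ∑ c : (strandGraph P).ConnectedComponent → Fin N,
        (if c (s p) = i₀ ∧ c (s p') = i₁ then 1 else 0) * pairingCount (openStrands P) c := by
    simp_rw [hcount, Finset.sum_mul_sum, Finset.mul_sum]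
    rw [Finset.sum_comm]
    refine Finset.sum_congr rfl fun p _ => ?_
    rw [Finset.sum_comm]
    refine Finset.sum_congr rfl fun p' _ => Finset.sum_congr rfl fun c _ => ?_
    rw [mul_comm]
    congr 1
    split_ifs <;> simp_all
  have hmem : ∀ p, s p ∈ openStrands P := fun p => mem_openStrands P ⟨⟨e, p⟩, he⟩
  rw [h1]
  have h2 : ∀ p : Fin (m e), (m e - 2) * ∑ c : (strandGraph P).ConnectedComponent → Fin N,
        pairingCount (openStrands P) c ≤
      N * (N + 2) * ∑ p', ∑ c : (strandGraph P).ConnectedComponent → Fin N,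
        (if c (s p) = i₀ ∧ c (s p') = i₁ then 1 else 0) * pairingCount (openStrands P) c := by
    intro p
    -- The strand of p meets the edge e in p and in at most one further link, the other end of that
    -- strand.
    have hcard : m e - 2 ≤ (Finset.univ.filter fun p' => s p ≠ s p').card := by
      have h3 := Finset.card_filter_add_card_filter_not (s := (Finset.univ : Finset (Fin (m e))))
        (fun p' => s p ≠ s p')
      have h4 : (Finset.univ.filter fun p' => ¬ s p ≠ s p').card ≤ 2 := by
        refine le_trans ?_ (card_strand_ends_le_two P (s p))
        rw [← Fintype.card_subtype, ← Nat.card_eq_fintype_card]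
        refine Nat.card_le_card_of_injective
          (fun p' => ⟨⟨⟨e, p'.1⟩, he⟩, (not_not.1 p'.2).symm⟩) ?_
        intro p' p'' h
        have := congrArg (fun l => l.1.1) h
        simpa [Subtype.ext_iff] using this
      rw [Finset.card_univ, Fintype.card_fin] at h3
      omega
    calc (m e - 2) * ∑ c : (strandGraph P).ConnectedComponent → Fin N,
        pairingCount (openStrands P) c
        ≤ (Finset.univ.filter fun p' => s p ≠ s p').card *
          ∑ c : (strandGraph P).ConnectedComponent → Fin N, pairingCount (openStrands P) c :=
          Nat.mul_le_mul_right _ hcard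
      _ = ∑ p' ∈ Finset.univ.filter fun p' => s p ≠ s p', N * (N + 2) *
          ∑ c : (strandGraph P).ConnectedComponent → Fin N,
          (if c (s p) = i₀ ∧ c (s p') = i₁ then 1 else 0) * pairingCount (openStrands P) c := by
          rw [← smul_eq_mul, ← Finset.sum_const]
          refine Finset.sum_congr rfl fun p' hp' => ?_
          rw [sum_pairingCount (Finset.mem_filter.1 hp').2 (hmem p) (hmem p') hi]
      _ ≤ _ := by
          rw [Finset.mul_sum]
          exact Finset.sum_le_sum_of_subset (Finset.filter_subset _ _)
  have h3 := Finset.sum_le_sum fun p (_ : p ∈ (Finset.univ : Finset (Fin (m e)))) => h2 p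
  rw [Finset.sum_const, Finset.card_univ, Fintype.card_fin, smul_eq_mul, ← mul_assoc] at h3
  exact h3.trans (Finset.mul_sum _ _ _).ge

/-! ### Correlation of two colours given the uncoloured link numbers -/

/-- The uncoloured numbers of links. -/
def linkTotal (k : G.edgeSet → Fin N → ℕ) (e : G.edgeSet) : ℕ := ∑ i, k e i

lemma linkTotal_colourCount {m : G.edgeSet → ℕ} (c : Link m → Fin N) (e : G.edgeSet) :
    linkTotal (colourCount c) e = m e := by
  rw [linkTotal, colourCount, sum_fiberCount]
  simp

lemma sum_colourings_le (m : G.edgeSet → ℕ) (e : G.edgeSet) {i₀ i₁ : Fin N} (hi : i₀ ≠ i₁) :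
    (m e * (m e - 2)) *
        ∑ c : Link m → Fin N, ∏ z, Nat.card (ColourPairing c z (0 : Fin N → ℕ)) ≤
      N * (N + 2) * ∑ c : Link m → Fin N, (∏ z, Nat.card (ColourPairing c z (0 : Fin N → ℕ))) *
        (colourCount c e i₀ * colourCount c e i₁) := by
  obtain ⟨x, hx⟩ : ∃ x, x ∈ (e : Sym2 V) := by
    induction (e : Sym2 V) with
    | _ x y => exact ⟨x, by simp⟩
  have h := sum_colourings_eq (x := x) (m := m) (N := N) fun _ => 1
  simp only [mul_one] at h
  rw [h, sum_colourings_eq (x := x), Finset.mul_sum, Finset.mul_sum]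
  exact Finset.sum_le_sum fun P _ => sum_strands P e hx hi

lemma deg_sum_eq (m : G.edgeSet → ℕ) (c : Link m → Fin N) (x : V) :
    ∑ i, deg (colourCount c) x i = Nat.card (LinkAt m x) := (card_linkAt m c x).symm

/-- Given the numbers of links, the first two colours are positively correlated enough. -/
lemma tsum_closedWeight_le (U : ℕ → ℝ≥0) (v : V → V → ℝ) {lam : ℝ} (hlam : 0 ≤ lam)
    (e : G.edgeSet) {i₀ i₁ : Fin N} (hi : i₀ ≠ i₁) :
    ∑' k : G.edgeSet → Fin N → ℕ, ENNReal.ofReal (closedWeight U v lam k *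
        ((linkTotal k e * (linkTotal k e - 2) : ℕ) : ℝ)) ≤
      ENNReal.ofReal (N * (N + 2)) * ∑' k : G.edgeSet → Fin N → ℕ,
        ENNReal.ofReal (closedWeight U v lam k * (k e i₀ * k e i₁)) := by
  -- When all colours can be completely paired, the local time is half the number of links at the
  -- vertex. The Gibbs factor then depends on the uncoloured link numbers alone and is common to
  -- both sides.
  let n : (G.edgeSet → ℕ) → V → ℕ := fun m x => Nat.card (LinkAt m x) / 2
  have h0 : ∀ f : (G.edgeSet → Fin N → ℕ) → ℕ,
      ∑' k : G.edgeSet → Fin N → ℕ, ENNReal.ofReal (closedWeight U v lam k * f k) =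
      ∑' m : G.edgeSet → ℕ, ENNReal.ofReal
        ((∏ e, lam ^ m e / (m e).factorial) * gibbs U v (n m)) *
        ((∑ c : Link m → Fin N, (∏ z, Nat.card (ColourPairing c z (0 : Fin N → ℕ))) *
          f (colourCount c) : ℕ) : ℝ≥0∞) := by
    intro f
    have h1 : ∀ k : G.edgeSet → Fin N → ℕ, ENNReal.ofReal (closedWeight U v lam k * f k) =
        ENNReal.ofReal (linkMass lam k) * ENNReal.ofReal
          ((∏ x, ∏ i, (involCount (deg k x i) 0 : ℝ)) * gibbs U v (closedTime k) * f k) := by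
      intro k
      rw [← ENNReal.ofReal_mul (linkMass_nonneg hlam k), closedWeight]
      congr 1
      ring
    simp_rw [h1]
    rw [← tsum_colour hlam]
    refine tsum_congr fun m => ?_
    push_cast
    rw [Finset.mul_sum]
    refine Finset.sum_congr rfl fun c _ => ?_
    have hp : ∏ x, ∏ i, (involCount (deg (colourCount c) x i) 0 : ℝ) =
        ((∏ z, Nat.card (ColourPairing c z (0 : Fin N → ℕ)) : ℕ) : ℝ) := by
      simp_rw [card_colourPairing]
      push_cast
      rfl
    rw [hp]
    by_cases hz : ∏ z, Nat.card (ColourPairing c z (0 : Fin N → ℕ)) = 0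
    · have hz2 : ∏ z, (Nat.card (ColourPairing c z (0 : Fin N → ℕ)) : ℝ≥0∞) = 0 := by
        exact_mod_cast hz
      rw [hz, hz2]
      simp
    · have hn : closedTime (colourCount c) = n m := by
        funext x
        have hz1 := Finset.prod_ne_zero_iff.1 hz x (Finset.mem_univ x)
        rw [card_colourPairing] at hz1
        have hev : ∀ i, 2 * (deg (colourCount c) x i / 2) = deg (colourCount c) x i := fun i =>
          Nat.two_mul_div_two_of_even
            (even_of_involCount_ne_zero (Finset.prod_ne_zero_iff.1 hz1 i (Finset.mem_univ i)))
        have : 2 * closedTime (colourCount c) x = Nat.card (LinkAt m x) := by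
          rw [closedTime, Finset.mul_sum, Finset.sum_congr rfl fun i _ => hev i, deg_sum_eq]
        simp only [n]
        omega
      have hmul : (∏ z, (Nat.card (ColourPairing c z (0 : Fin N → ℕ)) : ℝ≥0∞)) *
          (f (colourCount c) : ℝ≥0∞) = ENNReal.ofReal
          (((∏ z, Nat.card (ColourPairing c z (0 : Fin N → ℕ)) : ℕ) : ℝ) * f (colourCount c)) := by
        rw [ENNReal.ofReal_mul (by positivity), ENNReal.ofReal_natCast, ENNReal.ofReal_natCast]
        push_cast
        rfl
      have hnn : (0 : ℝ) ≤ ∏ e : G.edgeSet, lam ^ m e / (m e).factorial :=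
        Finset.prod_nonneg fun _ _ => by positivity
      rw [hn, hmul, ← ENNReal.ofReal_mul hnn,
        ← ENNReal.ofReal_mul (mul_nonneg hnn (gibbs_nonneg _ _ _))]
      congr 1
      ring
  have h2 := h0 fun k => linkTotal k e * (linkTotal k e - 2)
  have h3 := h0 fun k => k e i₀ * k e i₁
  push_cast at h3
  rw [h2, h3, ← ENNReal.tsum_mul_left]
  refine ENNReal.tsum_le_tsum fun m => ?_
  rw [mul_left_comm]
  refine mul_le_mul_right ?_ _
  have h4 := sum_colourings_le (N := N) m e hi
  have h5 : ENNReal.ofReal (N * (N + 2)) = ((N * (N + 2) : ℕ) : ℝ≥0∞) := by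
    rw [← ENNReal.ofReal_natCast]
    push_cast
    rfl
  rw [h5]
  simp_rw [linkTotal_colourCount]
  rw [← Finset.sum_mul, mul_comm]
  exact_mod_cast h4

end RPM

/-! ### Positive semidefinite kernels -/

/-- The indicator function of the diagonal. -/
def eqKernel {ρ : Type*} (a b : ρ) : ℝ := if a = b then 1 else 0

namespace Matrix.PosSemidef

variable {ι : Type*} [Fintype ι]

lemma sum_sum_nonneg {K : Matrix ι ι ℝ} (hK : K.PosSemidef) (f : ι → ℝ) :
    0 ≤ ∑ a, ∑ b, f a * f b * K a b := by
  have h := hK.dotProduct_mulVec_nonneg f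
  simp only [dotProduct, mulVec, star_trivial, Finset.mul_sum] at h
  refine h.trans_eq (Finset.sum_congr rfl fun a _ => Finset.sum_congr rfl fun b _ => ?_)
  ring

lemma of_sum_sum_nonneg {K : Matrix ι ι ℝ} (hs : ∀ a b, K a b = K b a)
    (h : ∀ f : ι → ℝ, 0 ≤ ∑ a, ∑ b, f a * f b * K a b) : K.PosSemidef := by
  refine Matrix.PosSemidef.of_dotProduct_mulVec_nonneg (Matrix.ext fun a b => ?_) fun f => ?_
  · simp [Matrix.conjTranspose_apply, hs b a]
  · simp only [dotProduct, mulVec, Finset.mul_sum]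
    refine (h f).trans_eq (Finset.sum_congr rfl fun a _ => Finset.sum_congr rfl fun b _ => ?_)
    simp only [Pi.star_apply, star_trivial]
    ring

/-- The Cauchy–Schwarz inequality for a positive semidefinite kernel. -/
lemma sq_sum_sum_le {K : Matrix ι ι ℝ} (hK : K.PosSemidef) (f g : ι → ℝ) :
    (∑ a, ∑ b, f a * g b * K a b) ^ 2 ≤
      (∑ a, ∑ b, f a * f b * K a b) * ∑ a, ∑ b, g a * g b * K a b := by
  have hs : ∀ a b, K a b = K b a := fun a b => by
    have := hK.isHermitian.apply a b
    simpa using this.symm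
  have hsymm : ∑ a, ∑ b, g a * f b * K a b = ∑ a, ∑ b, f a * g b * K a b := by
    rw [Finset.sum_comm]
    refine Finset.sum_congr rfl fun a _ => Finset.sum_congr rfl fun b _ => ?_
    rw [hs b a]
    ring
  have h : ∀ t : ℝ, 0 ≤ (∑ a, ∑ b, g a * g b * K a b) * (t * t) +
      (2 * ∑ a, ∑ b, f a * g b * K a b) * t + ∑ a, ∑ b, f a * f b * K a b := by
    intro t
    have h1 := hK.sum_sum_nonneg fun a => f a + t * g a
    have h2 : ∑ a, ∑ b, (f a + t * g a) * (f b + t * g b) * K a b =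
        (∑ a, ∑ b, g a * g b * K a b) * (t * t) + (∑ a, ∑ b, f a * g b * K a b) * t +
          (∑ a, ∑ b, g a * f b * K a b) * t + ∑ a, ∑ b, f a * f b * K a b := by
      simp only [Finset.sum_mul, ← Finset.sum_add_distrib]
      refine Finset.sum_congr rfl fun a _ => Finset.sum_congr rfl fun b _ => ?_
      ring
    rw [h2, hsymm] at h1
    linarith
  -- The quadratic form at f + t·g is a nonnegative polynomial in t.
  have h3 := discrim_le_zero h
  rw [discrim] at h3
  nlinarith

/-- Entrywise powers are positive semidefinite by the Schur product theorem, and the exponential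
series has nonnegative coefficients. -/
lemma map_exp {K : Matrix ι ι ℝ} (hK : K.PosSemidef) :
    (Matrix.of fun a b => Real.exp (K a b)).PosSemidef := by
  have hs : ∀ a b, K a b = K b a := fun a b => by
    have := hK.isHermitian.apply a b
    simpa using this.symm
  have hpow : ∀ n : ℕ, (Matrix.of fun a b => K a b ^ n).PosSemidef := by
    intro n
    induction n with
    | zero =>
      refine of_sum_sum_nonneg (by simp) fun f => ?_
      simp only [Matrix.of_apply, pow_zero, mul_one, ← Finset.sum_mul_sum]
      exact mul_self_nonneg _
    | succ n ih =>
      have h : (Matrix.of fun a b => K a b ^ (n + 1)) =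
          Matrix.hadamard (Matrix.of fun a b => K a b ^ n) K := by
        ext a b
        simp [pow_succ]
      rw [h]
      exact ih.hadamard hK
  refine of_sum_sum_nonneg (fun a b => by simp [hs a b]) fun f => ?_
  have hsum : HasSum (fun n : ℕ => ∑ a, ∑ b, f a * f b * (K a b ^ n / n.factorial))
      (∑ a, ∑ b, f a * f b * Real.exp (K a b)) := by
    refine hasSum_sum fun a _ => hasSum_sum fun b _ => HasSum.mul_left _ ?_
    rw [Real.exp_eq_exp_ℝ]
    exact NormedSpace.expSeries_div_hasSum_exp (K a b)
  refine hsum.nonneg fun n => ?_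
  have h := (hpow n).sum_sum_nonneg f
  have h2 : ∑ a, ∑ b, f a * f b * (K a b ^ n / n.factorial) =
      (∑ a, ∑ b, f a * f b * (Matrix.of fun a b => K a b ^ n) a b) / n.factorial := by
    simp only [Finset.sum_div, Matrix.of_apply]
    refine Finset.sum_congr rfl fun a _ => Finset.sum_congr rfl fun b _ => ?_
    ring
  rw [h2]
  positivity

/-- The quadratic form is a sum of squares, one for each value s: the square of the sum of f over
the indices with r a = s. -/
lemma indicator_eq {ρ : Type*} [Fintype ρ] (r : ι → ρ) :
    (Matrix.of fun a b => eqKernel (r a) (r b)).PosSemidef := by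
  refine of_sum_sum_nonneg (fun a b => by simp [eqKernel, eq_comm]) fun f => ?_
  have h : ∑ a, ∑ b, f a * f b * (Matrix.of fun a b => eqKernel (r a) (r b)) a b =
      ∑ s, (∑ a, if r a = s then f a else 0) ^ 2 := by
    simp only [sq, Finset.sum_mul_sum, Matrix.of_apply]
    rw [Finset.sum_comm]
    conv_rhs => rw [Finset.sum_comm]
    rw [Finset.sum_comm]
    refine Finset.sum_congr rfl fun a _ => ?_
    rw [Finset.sum_comm]
    refine Finset.sum_congr rfl fun b _ => ?_
    rw [Finset.sum_eq_single (r a)]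
    · by_cases hab : r a = r b
      · simp [hab, eqKernel]
      · simp [hab, Ne.symm hab, eqKernel]
    · intro s _ hs
      simp [hs.symm]
    · simp
  rw [h]
  positivity

end Matrix.PosSemidef

namespace RPM

/-! ### Reflection positivity -/

section Reflection

/-- A reflection of the edges of a graph: `plus` is the set of the edges in one half, and the edges
which belong to none of the halves are invariant. -/
structure EdgeReflection (E : Type) where
  refl : E → E
  plus : E → Prop
  involutive : Function.Involutive refl
  not_plus : ∀ e, plus e → ¬ plus (refl e)
  crossing : ∀ e, ¬ plus e → ¬ plus (refl e) → refl e = e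

variable {E : Type} [Fintype E] (R : EdgeReflection E) {A : Type} [Fintype A]

/-- The edges in the closed half. -/
abbrev EdgeReflection.Half : Type := {e // ¬ R.plus (R.refl e)}

/-- Restriction to the half. -/
def EdgeReflection.res (k : E → A) : R.Half → A := fun e => k e.1

/-- The symmetric extension. -/
def EdgeReflection.ext (p : R.Half → A) : E → A := fun e =>
  if h : ¬ R.plus (R.refl e) then p ⟨e, h⟩ else
    p ⟨R.refl e, by
      rw [R.involutive]
      exact fun h2 => R.not_plus _ h2 (not_not.1 h)⟩

lemma EdgeReflection.ext_res (k : E → A) (e : E) (he : ¬ R.plus (R.refl e)) :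
    R.ext (R.res k) e = k e := by
  rw [EdgeReflection.ext, dif_pos he]
  rfl

/-- The restriction of a configuration on the half to the crossing edges. -/
def EdgeReflection.cross (p : R.Half → A) : {e : R.Half // R.refl e.1 = e.1} → A := fun e => p e.1

/-- A configuration consists of its restrictions to both halves, which agree on the crossing
edges. -/
def EdgeReflection.splitEquiv : (E → A) ≃ {p : (R.Half → A) × (R.Half → A) //
    R.cross p.1 = R.cross p.2} where
  toFun k := ⟨(R.res k, R.res (k ∘ R.refl)), by
    funext e
    simp [EdgeReflection.res, EdgeReflection.cross, e.2]⟩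
  invFun p e := if h : ¬ R.plus (R.refl e) then p.1.1 ⟨e, h⟩ else
    p.1.2 ⟨R.refl e, by
      rw [R.involutive]
      exact fun h2 => R.not_plus _ h2 (not_not.1 h)⟩
  left_inv k := by
    funext e
    by_cases h : ¬ R.plus (R.refl e)
    · exact dif_pos h
    · exact (dif_neg h).trans (congrArg k (R.involutive e))
  right_inv := by
    rintro ⟨⟨p, p'⟩, hp⟩
    have hpos : ∀ (e : R.Half) (e' : E), e' = e.1 → ∀ q : ¬ ¬ R.plus (R.refl e') → A,
        (if h : ¬ R.plus (R.refl e') then p ⟨e', h⟩ else q h) = p e := by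
      rintro e _ rfl q
      exact dif_pos e.2
    refine Subtype.ext (Prod.ext ?_ ?_)
    · funext e
      exact hpos e e.1 rfl _
    · funext e
      by_cases h : R.refl e.1 = e.1
      · exact (hpos e (R.refl e.1) h _).trans (congrFun hp ⟨e, h⟩)
      · have h2 : R.plus e.1 := by
          by_contra h3
          exact h (R.crossing _ h3 e.2)
        have h3 : ¬ ¬ R.plus (R.refl (R.refl e.1)) := by
          rw [R.involutive]
          exact not_not.2 h2
        exact (dif_neg h3).trans (congrArg p' (Subtype.ext (R.involutive _)))

lemma EdgeReflection.sum_split (H : (R.Half → A) → (R.Half → A) → ℝ) :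
    ∑ k : E → A, H (R.res k) (R.res (k ∘ R.refl)) =
      ∑ p : R.Half → A, ∑ p' : R.Half → A, H p p' * eqKernel (R.cross p) (R.cross p') := by
  rw [← Fintype.sum_prod_type' (f := fun p p' : R.Half → A =>
    H p p' * eqKernel (R.cross p) (R.cross p'))]
  simp only [eqKernel, mul_ite, mul_one, mul_zero]
  rw [← Finset.sum_filter, ← Finset.sum_subtype_eq_sum_filter, Finset.subtype_univ]
  exact R.splitEquiv.sum_comp fun p => H p.1.1 p.1.2

/-- Both factors of the kernel between the halves, agreement on the crossing edges and exp K, are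
positive semidefinite. So is their entrywise product, and the claim is its Cauchy–Schwarz
inequality. -/
lemma EdgeReflection.sq_sum_le {K : Matrix (R.Half → A) (R.Half → A) ℝ} (hK : K.PosSemidef)
    (f g : (R.Half → A) → ℝ) :
    (∑ k : E → A, f (R.res k) * g (R.res (k ∘ R.refl)) *
        Real.exp (K (R.res k) (R.res (k ∘ R.refl)))) ^ 2 ≤
      (∑ k : E → A, f (R.res k) * f (R.res (k ∘ R.refl)) *
        Real.exp (K (R.res k) (R.res (k ∘ R.refl)))) *
      ∑ k : E → A, g (R.res k) * g (R.res (k ∘ R.refl)) *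
        Real.exp (K (R.res k) (R.res (k ∘ R.refl))) := by
  let I : Matrix (R.Half → A) (R.Half → A) ℝ :=
    Matrix.of fun p p' => eqKernel (R.cross p) (R.cross p')
  have hI : I.PosSemidef := Matrix.PosSemidef.indicator_eq R.cross
  let X : Matrix (R.Half → A) (R.Half → A) ℝ := Matrix.of fun p p' => Real.exp (K p p')
  have hX : X.PosSemidef := hK.map_exp
  have hK2 : (Matrix.hadamard I X).PosSemidef := hI.hadamard hX
  have h : ∀ f g : (R.Half → A) → ℝ, ∑ k : E → A, f (R.res k) * g (R.res (k ∘ R.refl)) *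
        Real.exp (K (R.res k) (R.res (k ∘ R.refl))) =
      ∑ p, ∑ p', f p * g p' * (Matrix.hadamard I X) p p' := by
    intro f g
    rw [R.sum_split fun p p' => f p * g p' * Real.exp (K p p')]
    refine Finset.sum_congr rfl fun p _ => Finset.sum_congr rfl fun p' _ => ?_
    rw [Matrix.hadamard_apply]
    simp only [I, X, Matrix.of_apply]
    ring
  rw [h, h, h]
  exact hK2.sq_sum_sum_le f g

variable {V : Type} [Fintype V] (θ : V → V) (hθ : Function.Involutive θ) (H : V → Prop)
  (hH : ∀ x, H (θ x) ↔ ¬ H x)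

include hθ hH in
lemma sum_half (h : V → ℝ) : ∑ x, h x = ∑ x : {x // H x}, (h x + h (θ x)) := by
  rw [← Fintype.sum_subtype_add_sum_subtype H, Finset.sum_add_distrib]
  congr 1
  refine Fintype.sum_equiv (Equiv.ofBijective (fun x : {x // ¬ H x} => (⟨θ x, (hH x).2 x.2⟩ :
    {x // H x})) ⟨fun x y h => ?_, fun x => ?_⟩) _ _ fun x => ?_
  · exact Subtype.ext (hθ.injective (congrArg Subtype.val h))
  · exact ⟨⟨θ x, fun h => (hH x).1 h x.2⟩, Subtype.ext (hθ x)⟩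
  · exact congrArg h (hθ x.1).symm

include hθ hH in
lemma prod_half (h : V → ℝ) : ∏ x, h x = ∏ x : {x // H x}, (h x * h (θ x)) := by
  rw [← Fintype.prod_subtype_mul_prod_subtype H, Finset.prod_mul_distrib]
  congr 1
  refine Fintype.prod_equiv (Equiv.ofBijective (fun x : {x // ¬ H x} => (⟨θ x, (hH x).2 x.2⟩ :
    {x // H x})) ⟨fun x y h => ?_, fun x => ?_⟩) _ _ fun x => ?_
  · exact Subtype.ext (hθ.injective (congrArg Subtype.val h))
  · exact ⟨⟨θ x, fun h => (hH x).1 h x.2⟩, Subtype.ext (hθ x)⟩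
  · exact congrArg h (hθ x.1).symm

lemma EdgeReflection.prod_edges (w : E → ℝ) :
    ∏ e, w e = (∏ e : {e // R.plus e}, w e * w (R.refl e)) *
      ∏ e : {e // ¬ R.plus e ∧ ¬ R.plus (R.refl e)}, w e := by
  rw [← Fintype.prod_subtype_mul_prod_subtype R.plus, Finset.prod_mul_distrib, mul_assoc]
  congr 1
  rw [← Fintype.prod_subtype_mul_prod_subtype
    (fun e : {e // ¬ R.plus e} => R.plus (R.refl e.1))]
  congr 1
  · refine Fintype.prod_equiv
      { toFun := fun e => ⟨R.refl e.1.1, e.2⟩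
        invFun := fun e => ⟨⟨R.refl e.1, R.not_plus _ e.2⟩, by rw [R.involutive]; exact e.2⟩
        left_inv := fun e => Subtype.ext (Subtype.ext (R.involutive e.1.1))
        right_inv := fun e => Subtype.ext (R.involutive e.1) } _ _ fun e => ?_
    exact congrArg w (R.involutive e.1.1).symm
  · exact Fintype.prod_equiv
      { toFun := fun e => ⟨e.1.1, e.1.2, e.2⟩
        invFun := fun e => ⟨⟨e.1, e.2.1⟩, e.2.2⟩
        left_inv := fun _ => rfl
        right_inv := fun _ => rfl } _ _ fun e => rfl

/-! ### Reflection positivity of symmetric lattice models -/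

/-- The data of a lattice model which is symmetric under a reflection. -/
structure ReflectionModel (E V A ι : Type) where
  /-- the reflection of the edges -/
  R : EdgeReflection E
  /-- the reflection of the vertices -/
  θ : V → V
  θ_involutive : Function.Involutive θ
  /-- one half of the vertices -/
  H : V → Prop
  half : ∀ x, H (θ x) ↔ ¬ H x
  /-- the edge weight -/
  w : A → ℝ
  w_nonneg : ∀ a, 0 ≤ w a
  /-- the local functions, with labels in `ι` -/
  φ : ι → V → (E → A) → ℝ
  φ_refl : ∀ i x k, φ i (θ x) k = φ i x (k ∘ R.refl)
  φ_local : ∀ i x k k', H x → (∀ e, ¬ R.plus (R.refl e) → k e = k' e) → φ i x k = φ i x k'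
  /-- the local times -/
  n : V → (E → A) → ℝ
  n_refl : ∀ x k, n (θ x) k = n x (k ∘ R.refl)
  n_local : ∀ x k k', H x → (∀ e, ¬ R.plus (R.refl e) → k e = k' e) → n x k = n x k'
  /-- the interaction -/
  v : V → V → ℝ
  v_symm : ∀ x y, v x y = v y x
  v_refl : ∀ x y, v (θ x) (θ y) = v x y

namespace ReflectionModel

variable {ι : Type} (D : ReflectionModel E V A ι)

/-- The weight of a configuration for given labels. -/
def term (b : V → ι) (k : E → A) : ℝ :=
  (∏ e, D.w (k e)) * (∏ x, D.φ (b x) x k) * Real.exp (-∑ x, ∑ y, D.v x y * D.n x k * D.n y k)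

/-- The labels which are symmetric and agree with `b` on the half. -/
def symmetrize (b : V → ι) : V → ι := fun x => if D.H x then b x else b (D.θ x)

/-- The part of the weight which belongs to the half. -/
def halfTerm (b : V → ι) (p : D.R.Half → A) : ℝ :=
  (∏ e : {e // D.R.plus e}, D.w (D.R.ext p e)) *
  (∏ e : {e // ¬ D.R.plus e ∧ ¬ D.R.plus (D.R.refl e)}, √(D.w (D.R.ext p e))) *
  (∏ x : {x // D.H x}, D.φ (b x) x (D.R.ext p)) *
  Real.exp (-∑ x : {x // D.H x}, ∑ y : {x // D.H x}, D.v x y * D.n x (D.R.ext p) *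
    D.n y (D.R.ext p))

/-- The interaction kernel between the halves. -/
def kernel : Matrix (D.R.Half → A) (D.R.Half → A) ℝ := Matrix.of fun p p' =>
  ∑ x : {x // D.H x}, ∑ y : {x // D.H x}, (-(2 * D.v x (D.θ y))) * D.n x (D.R.ext p) *
    D.n y (D.R.ext p')

lemma φ_ext (i : ι) (x : V) (hx : D.H x) (k : E → A) :
    D.φ i x (D.R.ext (D.R.res k)) = D.φ i x k :=
  D.φ_local i x _ _ hx fun e he => D.R.ext_res k e he

lemma n_ext (x : V) (hx : D.H x) (k : E → A) : D.n x (D.R.ext (D.R.res k)) = D.n x k :=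
  D.n_local x _ _ hx fun e he => D.R.ext_res k e he

/-- The second half is read through the reflection, so that both factors are functions on the same
half. All that couples them, besides the agreement on crossing edges, is the interaction across the
plane. -/
lemma term_eq (b : V → ι) (k : E → A) :
    D.term b k = D.halfTerm b (D.R.res k) * D.halfTerm (b ∘ D.θ) (D.R.res (k ∘ D.R.refl)) *
      Real.exp (D.kernel (D.R.res k) (D.R.res (k ∘ D.R.refl))) := by
  have hplus : ∀ e : {e // D.R.plus e}, ¬ D.R.plus (D.R.refl e.1) := fun e => D.R.not_plus _ e.2
  have hcr : ∀ e : {e // ¬ D.R.plus e ∧ ¬ D.R.plus (D.R.refl e)}, D.R.refl e.1 = e.1 :=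
    fun e => D.R.crossing _ e.2.1 e.2.2
  -- The weight of a crossing edge is shared as two square roots, one for each half.
  have e1 : ∏ e, D.w (k e) =
      (∏ e : {e // D.R.plus e}, D.w (D.R.ext (D.R.res k) e)) *
      (∏ e : {e // D.R.plus e}, D.w (D.R.ext (D.R.res (k ∘ D.R.refl)) e)) *
      ((∏ e : {e // ¬ D.R.plus e ∧ ¬ D.R.plus (D.R.refl e)},
        √(D.w (D.R.ext (D.R.res k) e))) *
      ∏ e : {e // ¬ D.R.plus e ∧ ¬ D.R.plus (D.R.refl e)},
        √(D.w (D.R.ext (D.R.res (k ∘ D.R.refl)) e))) := by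
    rw [D.R.prod_edges, ← Finset.prod_mul_distrib, ← Finset.prod_mul_distrib]
    congr 1
    · refine Finset.prod_congr rfl fun e _ => ?_
      rw [D.R.ext_res _ _ (hplus e), D.R.ext_res _ _ (hplus e)]
      rfl
    · refine Finset.prod_congr rfl fun e _ => ?_
      rw [D.R.ext_res _ _ e.2.2, D.R.ext_res _ _ e.2.2, Function.comp_apply, hcr e,
        Real.mul_self_sqrt (D.w_nonneg _)]
  have e2 : ∏ x, D.φ (b x) x k = (∏ x : {x // D.H x}, D.φ (b x) x (D.R.ext (D.R.res k))) *
      ∏ x : {x // D.H x}, D.φ ((b ∘ D.θ) x) x (D.R.ext (D.R.res (k ∘ D.R.refl))) := by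
    rw [prod_half D.θ D.θ_involutive D.H D.half, Finset.prod_mul_distrib]
    congr 1
    · exact Finset.prod_congr rfl fun x _ => (D.φ_ext _ _ x.2 _).symm
    · refine Finset.prod_congr rfl fun x _ => ?_
      rw [D.φ_refl, D.φ_ext _ _ x.2]
      rfl
  -- By symmetry of v the two kinds of cross terms agree, which explains the factor 2 in `kernel`.
  have e3 : ∑ x, ∑ y, D.v x y * D.n x k * D.n y k =
      ∑ x : {x // D.H x}, ∑ y : {x // D.H x}, D.v x y * D.n x (D.R.ext (D.R.res k)) *
        D.n y (D.R.ext (D.R.res k)) +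
      ∑ x : {x // D.H x}, ∑ y : {x // D.H x}, D.v x y *
        D.n x (D.R.ext (D.R.res (k ∘ D.R.refl))) * D.n y (D.R.ext (D.R.res (k ∘ D.R.refl))) -
      D.kernel (D.R.res k) (D.R.res (k ∘ D.R.refl)) := by
    have hn : ∀ x : {x // D.H x}, D.n x (D.R.ext (D.R.res k)) = D.n x k := fun x =>
      D.n_ext _ x.2 _
    have hn' : ∀ x : {x // D.H x}, D.n x (D.R.ext (D.R.res (k ∘ D.R.refl))) = D.n (D.θ x) k :=
      fun x => by rw [D.n_ext _ x.2, D.n_refl]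
    simp only [kernel, Matrix.of_apply, hn, hn']
    rw [sum_half D.θ D.θ_involutive D.H D.half]
    simp only [sum_half D.θ D.θ_involutive D.H D.half (fun y => D.v _ y * _ * D.n y k)]
    have hcross : ∑ x : {x // D.H x}, ∑ y : {x // D.H x},
        D.v (D.θ x) y * D.n (D.θ x) k * D.n y k =
        ∑ x : {x // D.H x}, ∑ y : {x // D.H x}, D.v x (D.θ y) * D.n x k * D.n (D.θ y) k := by
      rw [Finset.sum_comm]
      refine Finset.sum_congr rfl fun x _ => Finset.sum_congr rfl fun y _ => ?_
      rw [D.v_symm]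
      ring
    simp only [Finset.sum_add_distrib, D.v_refl]
    rw [hcross]
    have hk : ∑ x : {x // D.H x}, ∑ y : {x // D.H x},
        (-(2 * D.v x (D.θ y))) * D.n x k * D.n (D.θ y) k =
        -(2 * ∑ x : {x // D.H x}, ∑ y : {x // D.H x},
          D.v x (D.θ y) * D.n x k * D.n (D.θ y) k) := by
      simp only [Finset.mul_sum, ← Finset.sum_neg_distrib]
      refine Finset.sum_congr rfl fun x _ => Finset.sum_congr rfl fun y _ => ?_
      ring
    rw [hk]
    ring
  rw [term, halfTerm, halfTerm, e1, e2, e3, neg_sub, sub_eq_add_neg, Real.exp_add, neg_add,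
    Real.exp_add]
  ring

lemma halfTerm_congr {b b' : V → ι} (h : ∀ x, D.H x → b x = b' x) :
    D.halfTerm b = D.halfTerm b' := by
  funext p
  have : ∏ x : {x // D.H x}, D.φ (b x) x (D.R.ext p) =
      ∏ x : {x // D.H x}, D.φ (b' x) x (D.R.ext p) :=
    Finset.prod_congr rfl fun x _ => by rw [h x x.2]
  rw [halfTerm, halfTerm, this]

/-- The kernel is 2 B Q Bᵀ, where B consists of the local times and Q is the interaction matrix of
the hypothesis. -/
lemma posSemidef_kernel (hq : (Matrix.of fun x y : {x // D.H x} =>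
    -D.v x (D.θ y)).PosSemidef) : D.kernel.PosSemidef := by
  have h := ((hq.smul (by norm_num : (0 : ℝ) ≤ 2)).mul_mul_conjTranspose_same
    (Matrix.of fun (p : D.R.Half → A) (x : {x // D.H x}) => D.n x (D.R.ext p)))
  convert h using 1
  ext p p'
  simp only [kernel, Matrix.of_apply, Matrix.mul_apply, Matrix.smul_apply,
    Matrix.conjTranspose_apply, star_trivial, smul_eq_mul, Finset.sum_mul]
  rw [Finset.sum_comm]
  refine Finset.sum_congr rfl fun x _ => Finset.sum_congr rfl fun y _ => ?_
  ring

/-- Reflection positivity. -/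
theorem sq_sum_term_le (hq : (Matrix.of fun x y : {x // D.H x} =>
    -D.v x (D.θ y)).PosSemidef) (b : V → ι) :
    (∑ k, D.term b k) ^ 2 ≤
      (∑ k, D.term (D.symmetrize b) k) * ∑ k, D.term (D.symmetrize (b ∘ D.θ)) k := by
  have hs : ∀ b : V → ι, D.halfTerm (D.symmetrize b) = D.halfTerm b := fun b =>
    D.halfTerm_congr fun x hx => by simp [symmetrize, hx]
  have hs' : ∀ b : V → ι, D.halfTerm (D.symmetrize b ∘ D.θ) = D.halfTerm b := fun b =>
    D.halfTerm_congr fun x hx => by simp [symmetrize, D.half, hx, D.θ_involutive x]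
  simp only [term_eq, hs, hs']
  exact D.R.sq_sum_le (D.posSemidef_kernel hq) (D.halfTerm b) (D.halfTerm (b ∘ D.θ))

end ReflectionModel

end Reflection

end RPM

/-! ### Reflection positivity with infinitely many edge states -/

namespace RPM

namespace ReflectionModel

variable {E V A ι : Type} [Fintype E] [Fintype V]

/-- Restriction of the edge states to the values of a function. -/
def comap (D : ReflectionModel E V A ι) {B : Type} (f : B → A) : ReflectionModel E V B ι where
  R := D.R
  θ := D.θ
  θ_involutive := D.θ_involutive
  H := D.H
  half := D.half
  w b := D.w (f b)
  w_nonneg _ := D.w_nonneg _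
  φ i x k := D.φ i x (f ∘ k)
  φ_refl i x _ := D.φ_refl i x _
  φ_local i x _ _ hx h := D.φ_local i x _ _ hx fun e he => congrArg f (h e he)
  n x k := D.n x (f ∘ k)
  n_refl x _ := D.n_refl x _
  n_local x _ _ hx h := D.n_local x _ _ hx fun e he => congrArg f (h e he)
  v := D.v
  v_symm := D.v_symm
  v_refl := D.v_refl

/-- Reflection positivity for infinitely many edge states. -/
theorem sq_tsum_term_le (D : ReflectionModel E V A ι)
    (hq : (Matrix.of fun x y : {x // D.H x} => -D.v x (D.θ y)).PosSemidef)
    (hs : ∀ b, Summable (D.term b)) (b : V → ι) :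
    (∑' k, D.term b k) ^ 2 ≤
      (∑' k, D.term (D.symmetrize b) k) * ∑' k, D.term (D.symmetrize (b ∘ D.θ)) k := by
  -- Finite state spaces s suffice: the boxes of configurations with values in s exhaust all
  -- configurations, and the inequality passes to the limit.
  have hbox : Filter.Tendsto (fun s : Finset A => Fintype.piFinset fun _ : E => s)
      Filter.atTop Filter.atTop := by
    refine Filter.tendsto_atTop_finset_of_monotone (fun s t h => ?_) fun k => ?_
    · exact Fintype.piFinset_subset _ _ fun _ => h
    · exact ⟨Finset.univ.image k, by simp⟩
  have hlim : ∀ b, Filter.Tendsto (fun s : Finset A => ∑ k ∈ Fintype.piFinset fun _ : E => s,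
      D.term b k) Filter.atTop (nhds (∑' k, D.term b k)) := fun b =>
    (hs b).hasSum.comp hbox
  have hfin : ∀ (s : Finset A) (b : V → ι), ∑ k ∈ Fintype.piFinset fun _ : E => s, D.term b k =
      ∑ k : E → {a // a ∈ s}, (D.comap (Subtype.val : {a // a ∈ s} → A)).term b k := by
    intro s b
    symm
    refine Finset.sum_bij (fun k _ e => (k e).1) ?_ ?_ ?_ ?_
    · intro k _
      simp
    · intro k _ k' _ h
      exact funext fun e => Subtype.ext (congrFun h e)
    · intro k hk
      exact ⟨fun e => ⟨k e, Fintype.mem_piFinset.1 hk e⟩, Finset.mem_univ _, rfl⟩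
    · intro k _
      rfl
  refine le_of_tendsto_of_tendsto' ((hlim b).pow 2) ((hlim _).mul (hlim _)) fun s => ?_
  rw [hfin, hfin, hfin]
  exact (D.comap (Subtype.val : {a // a ∈ s} → A)).sq_sum_term_le hq b

end ReflectionModel

end RPM

/-! ### The chessboard estimate -/

section Chessboard

variable {d L : ℕ} [NeZero L]

/-- The reflection in the plane between `a` and `a + 1` in direction `i`. -/
def planeReflection (i : Fin d) (a : ZMod L) (x : Torus d L) : Torus d L :=
  Function.update x i (2 * a + 1 - x i)

/-- The half of the torus to the right of the plane between `a` and `a + 1`. -/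
def planeHalf (i : Fin d) (a : ZMod L) (x : Torus d L) : Prop := 0 < (x i - a).valMinAbs

lemma planeReflection_involutive (i : Fin d) (a : ZMod L) :
    Function.Involutive (planeReflection i a : Torus d L → Torus d L) := by
  intro x
  simp [planeReflection]

lemma ZMod.valMinAbs_pos_iff (s : ZMod L) : 0 < s.valMinAbs ↔ 0 < s.val ∧ s.val ≤ L / 2 := by
  rw [ZMod.valMinAbs_def_pos]
  have := s.val_lt
  split_ifs <;> omega

lemma ZMod.val_add_natCast (s : ZMod L) (n : ℕ) : (s + n).val = (s.val + n) % L := by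
  conv_lhs => rw [← ZMod.natCast_zmod_val s, ← Nat.cast_add, ZMod.val_natCast]

lemma ZMod.val_neg_one_sub (s : ZMod L) : (-1 - s).val = L - 1 - s.val := by
  have h := s.val_lt
  have : -1 - s = ((L - 1 - s.val : ℕ) : ZMod L) := by
    rw [Nat.cast_sub (by omega), Nat.cast_sub (by omega)]
    simp
  rw [this, ZMod.val_natCast, Nat.mod_eq_of_lt (by omega)]

lemma planeHalf_planeReflection (hL : Even L) (i : Fin d) (a : ZMod L) (x : Torus d L) :
    planeHalf i a (planeReflection i a x) ↔ ¬ planeHalf i a x := by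
  have hL0 := NeZero.ne L
  obtain ⟨r, hr⟩ := hL
  rw [planeHalf, planeHalf, planeReflection, Function.update_self, ZMod.valMinAbs_pos_iff,
    ZMod.valMinAbs_pos_iff]
  set s := x i - a
  have h1 : 2 * a + 1 - x i - a = -1 - s + (2 : ℕ) := by
    simp only [s]
    push_cast
    ring
  rw [h1, ZMod.val_add_natCast, ZMod.val_neg_one_sub]
  have := s.val_lt
  rcases Nat.lt_or_ge (L - 1 - s.val + 2) L with h | h
  · rw [Nat.mod_eq_of_lt h]
    omega
  · rw [Nat.mod_eq_sub_mod h]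
    rcases Nat.lt_or_ge (L - 1 - s.val + 2 - L) L with h2 | h2
    · rw [Nat.mod_eq_of_lt h2]
      omega
    · omega

/-- The labels which agree with `b` in the half and are symmetric. -/
def planeSymmetrize (i : Fin d) (a : ZMod L) (b : Torus d L → Bool) (x : Torus d L) : Bool :=
  if planeHalf i a x then b x else b (planeReflection i a x)

/-- One direction is filled at a time: reflection in the plane next to a box doubles its length, as
long as the result still fits into the torus. -/
lemma exists_box (hL : Even L) (P : Set (Torus d L → Bool))
    (hP : ∀ b ∈ P, ∀ i a, planeSymmetrize i a b ∈ P) {b : Torus d L → Bool} (hb : b ∈ P)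
    {x : Torus d L} (hx : b x = true) (D : Finset (Fin d)) :
    ∃ b ∈ P, ∃ x : Torus d L, ∀ y, (∀ i ∉ D, y i = x i) → b y = true := by
  have hL0 := NeZero.ne L
  obtain ⟨r, hr⟩ := hL
  induction D using Finset.induction_on with
  | empty => exact ⟨b, hb, x, fun y hy => by rwa [funext fun i => hy i (by simp)]⟩
  | insert j D hj ih =>
    let Q : ℕ → Prop := fun l => ∃ b ∈ P, ∃ x : Torus d L, ∀ y, (∀ i ∉ insert j D, y i = x i) →
      (y j - x j).val < l → b y = true
    have hQ1 : Q 1 := by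
      obtain ⟨b, hb, x, hx⟩ := ih
      refine ⟨b, hb, x, fun y hy hl => hx y fun i hi => ?_⟩
      by_cases hij : i = j
      · subst hij
        exact sub_eq_zero.1 ((ZMod.val_eq_zero _).1 (by omega))
      · exact hy i (by simp [hij, hi])
    have hQmono : ∀ l l', l ≤ l' → Q l' → Q l := by
      rintro l l' hl ⟨b, hb, x, hx⟩
      exact ⟨b, hb, x, fun y hy h => hx y hy (h.trans_le hl)⟩
    have hQ2 : ∀ l, 1 ≤ l → 2 * l ≤ L → Q l → Q (2 * l) := by
      rintro l hl1 hl ⟨b, hb, x, hx⟩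
      -- The plane lies between x j - 1 and x j, so the box of length l starting at x j and its
      -- mirror image form a box of length 2l starting at x j - l.
      refine ⟨planeSymmetrize j (x j - 1) b, hP b hb _ _, Function.update x j (x j - l),
        fun y hy hyl => ?_⟩
      rw [Function.update_self] at hyl
      have hy' : ∀ i ∉ insert j D, y i = x i := fun i hi => by
        rw [hy i hi, Function.update_of_ne]
        rintro rfl
        exact hi (by simp)
      set s := y j - x j with hs
      have h1 : y j - (x j - l) = s + (l : ℕ) := by
        simp only [hs]
        ring
      rw [h1, ZMod.val_add_natCast] at hyl
      have hsL := s.val_lt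
      have hhalf : planeHalf j (x j - 1) y ↔ 0 < (s.val + 1) % L ∧ (s.val + 1) % L ≤ L / 2 := by
        have : y j - (x j - 1) = s + (1 : ℕ) := by
          simp only [hs]
          push_cast
          ring
        rw [planeHalf, this, ZMod.valMinAbs_pos_iff, ZMod.val_add_natCast]
      rw [planeSymmetrize]
      split_ifs with hH
      · rw [hhalf] at hH
        refine hx y hy' ?_
        rw [← hs]
        rcases Nat.lt_or_ge (s.val + 1) L with h | h
        · rw [Nat.mod_eq_of_lt h] at hH
          rw [Nat.mod_eq_of_lt (by omega)] at hyl
          omega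
        · have : s.val + 1 = L := by omega
          rw [this, Nat.mod_self] at hH
          omega
      · rw [hhalf] at hH
        refine hx _ (fun i hi => ?_) ?_
        · rw [planeReflection, Function.update_of_ne, hy' i hi]
          rintro rfl
          exact hi (by simp)
        · have : planeReflection j (x j - 1) y j - x j = -1 - s := by
            rw [planeReflection, Function.update_self]
            simp only [hs]
            ring
          rw [this, ZMod.val_neg_one_sub]
          rcases Nat.lt_or_ge (s.val + 1) L with h | h
          · rw [Nat.mod_eq_of_lt h] at hH
            rcases Nat.lt_or_ge (s.val + l) L with h2 | h2
            · rw [Nat.mod_eq_of_lt h2] at hyl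
              omega
            · omega
          · omega
    -- L need not be a power of two: doubling l gives at least l + 1, so every length up to L/2 is
    -- reached, and one more doubling gives L.
    have hQ3 : ∀ l, 1 ≤ l → 2 * l ≤ L → Q l := by
      intro l hl
      induction l, hl using Nat.le_induction with
      | base => exact fun _ => hQ1
      | succ l hl ih2 =>
        intro h
        exact hQmono _ _ (by omega) (hQ2 l hl (by omega) (ih2 (by omega)))
    obtain ⟨b, hb, x, hx⟩ := hQ2 (L / 2) (by omega) (by omega) (hQ3 (L / 2) (by omega) (by omega))
    refine ⟨b, hb, x, fun y hy => hx y hy ?_⟩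
    have := (y j - x j).val_lt
    omega

/-- Repeated reflections spread a single label to the whole torus. -/
lemma top_mem_of_planeSymmetrize (hL : Even L) (P : Set (Torus d L → Bool))
    (hP : ∀ b ∈ P, ∀ i a, planeSymmetrize i a b ∈ P) {b : Torus d L → Bool} (hb : b ∈ P)
    {x : Torus d L} (hx : b x = true) : (fun _ => true) ∈ P := by
  obtain ⟨b', hb', x', hx'⟩ := exists_box hL P hP hb hx Finset.univ
  have : b' = fun _ => true := funext fun y => hx' y (by simp)
  rwa [← this]

/-- The chessboard estimate for one label. -/
theorem chessboard (hL : Even L) (F : (Torus d L → Bool) → ℝ) (h0 : ∀ b, 0 ≤ F b)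
    (hmono : ∀ b, F (fun _ => true) ≤ F b) (hpos : 0 < F fun _ => false)
    (hRP : ∀ i a b, F b ^ 2 ≤
      F (planeSymmetrize i a b) * F (planeSymmetrize i a (b ∘ planeReflection i a)))
    (x : Torus d L) :
    (F (fun y => decide (y = x)) / F fun _ => false) ^ Fintype.card (Torus d L) ≤
      F (fun _ => true) / F fun _ => false := by
  have hT : 0 < Fintype.card (Torus d L) := Fintype.card_pos
  rcases (h0 fun _ => true).eq_or_lt with htop | htop
  · have hzero : F (fun y => decide (y = x)) = 0 := by
      by_contra h
      have := top_mem_of_planeSymmetrize hL {b | 0 < F b} (fun b hb i a => by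
        simp only [Set.mem_ofPred_eq] at hb ⊢
        have h1 := hRP i a b
        refine (h0 _).lt_of_ne fun h2 => ?_
        rw [← h2, zero_mul] at h1
        exact absurd h1 (not_le.2 (by positivity)))
        (b := fun y => decide (y = x)) ((h0 _).lt_of_ne (Ne.symm h)) (x := x) (by simp)
      simp only [Set.mem_ofPred_eq] at this
      exact this.ne htop
    rw [hzero, zero_div, zero_pow hT.ne']
    exact div_nonneg htop.le hpos.le
  have hF : ∀ b, 0 < F b := fun b => htop.trans_le (hmono b)
  set T : ℝ := (Fintype.card (Torus d L) : ℝ) with hTdef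
  have hT' : 0 < T := Nat.cast_pos.2 hT
  let cnt : (Torus d L → Bool) → ℝ := fun b => ∑ y, if b y then 1 else 0
  -- The slope is chosen to make g below vanish at both constant labellings.
  set α : ℝ := (Real.log (F fun _ => true) - Real.log (F fun _ => false)) / T with hα
  let g : (Torus d L → Bool) → ℝ := fun b =>
    Real.log (F b) - cnt b * α - Real.log (F fun _ => false)
  -- The two symmetrizations double the numbers of labels in the two halves respectively, so
  -- subtracting a multiple of `cnt` preserves the midpoint inequality.
  have hcnt : ∀ i a b, cnt (planeSymmetrize i a b) +
      cnt (planeSymmetrize i a (b ∘ planeReflection i a)) = 2 * cnt b := by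
    intro i a b
    simp only [cnt]
    have hh := planeHalf_planeReflection (d := d) hL i a
    have hi := planeReflection_involutive (L := L) i a
    rw [RPM.sum_half (planeReflection i a) hi (planeHalf i a) hh,
      RPM.sum_half (planeReflection i a) hi (planeHalf i a) hh,
      RPM.sum_half (planeReflection i a) hi (planeHalf i a) hh, ← Finset.sum_add_distrib,
      Finset.mul_sum]
    refine Finset.sum_congr rfl fun y _ => ?_
    have h1 : ¬ planeHalf i a (planeReflection i a y.1) := fun h => (hh _).1 h y.2
    simp only [planeSymmetrize, y.2, if_true, h1, if_false, hi y.1, Function.comp_apply]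
    ring
  have hg : ∀ i a b, 2 * g b ≤ g (planeSymmetrize i a b) +
      g (planeSymmetrize i a (b ∘ planeReflection i a)) := by
    intro i a b
    have h1 := Real.log_le_log (pow_pos (hF b) 2) (hRP i a b)
    rw [Real.log_pow, Real.log_mul (hF _).ne' (hF _).ne'] at h1
    have h2 := congrArg (· * α) (hcnt i a b)
    simp only [g]
    push_cast at h1
    linarith
  have hg0 : g (fun _ => false) = 0 := by simp [g, cnt]
  have hg1 : g (fun _ => true) = 0 := by
    have : cnt (fun _ => true) = T := by simp [cnt, hTdef]
    simp only [g, this, hα]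
    field_simp
    ring
  obtain ⟨b, hb⟩ := Finite.exists_max g
  have hmax : g b ≤ 0 := by
    by_contra hgb
    push Not at hgb
    have hex : ∃ y, b y = true := by
      by_contra hne
      push Not at hne
      have : b = fun _ => false := funext fun y => by simpa using hne y
      rw [this, hg0] at hgb
      exact lt_irrefl _ hgb
    obtain ⟨y, hy⟩ := hex
    -- By the midpoint inequality both symmetrizations of a maximizer are maximizers. If g had a
    -- positive maximum, the label `true` everywhere would attain it, although g is zero there.
    have := top_mem_of_planeSymmetrize hL {b' | g b' = g b} (fun b' hb' i a => by
      simp only [Set.mem_ofPred_eq] at hb' ⊢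
      have h1 := hg i a b'
      have h2 := hb (planeSymmetrize i a b')
      have h3 := hb (planeSymmetrize i a (b' ∘ planeReflection i a))
      linarith) (b := b) rfl hy
    simp only [Set.mem_ofPred_eq] at this
    linarith
  have hx := (hb fun y => decide (y = x)).trans hmax
  have hcx : cnt (fun y => decide (y = x)) = 1 := by
    simp only [cnt, decide_eq_true_eq]
    rw [Finset.sum_eq_single x (fun y _ h => if_neg h) (by simp), if_pos rfl]
  simp only [g, hcx, one_mul] at hx
  rw [← Real.log_le_log_iff (by have := hF fun y => decide (y = x); positivity) (by positivity),
    Real.log_pow, Real.log_div (hF _).ne' (hF _).ne', Real.log_div (hF _).ne' (hF _).ne', ← hTdef]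
  have h1 : T * (Real.log (F fun y => decide (y = x)) - Real.log (F fun _ => false)) ≤ T * α :=
    mul_le_mul_of_nonneg_left (by linarith) hT'.le
  have h2 : T * α = Real.log (F fun _ => true) - Real.log (F fun _ => false) := by
    rw [hα]
    field_simp
  linarith

end Chessboard

/-! ### Periodic potentials -/

section Potential

variable {d L : ℕ} [NeZero L] (v : (Fin d → ℤ) → ℝ)

/-- The sum over translates may start from any integer representative of the displacement; changing
it only shifts the summation index. -/
lemma periodicPotential_eq (x y : Torus d L) (w : Fin d → ℤ)
    (hw : ∀ j, (w j : ZMod L) = y j - x j) :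
    periodicPotential v L x y = ∑' z : Fin d → ℤ, v fun j => w j + L * z j := by
  have h : ∀ j, ∃ c : ℤ, (y j).valMinAbs - (x j).valMinAbs = w j + L * c := by
    intro j
    have h1 : (((y j).valMinAbs - (x j).valMinAbs - w j : ℤ) : ZMod L) = 0 := by
      push_cast
      rw [hw]
      simp
    obtain ⟨c, hc⟩ := (ZMod.intCast_zmod_eq_zero_iff_dvd _ _).1 h1
    exact ⟨c, by linarith⟩
  choose c hc using h
  rw [periodicPotential, ← (Equiv.addRight c).tsum_eq fun z => v fun j => w j + L * z j]
  refine tsum_congr fun z => congrArg v (funext fun j => ?_)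
  have := hc j
  simp only [Equiv.coe_addRight, Pi.add_apply]
  linarith

lemma periodicPotential_congr {x y x' y' : Torus d L} (h : y - x = y' - x') :
    periodicPotential v L x y = periodicPotential v L x' y' := by
  rw [periodicPotential_eq v x y (fun j => (y j - x j).valMinAbs) (by simp),
    periodicPotential_eq v x' y' (fun j => (y j - x j).valMinAbs) fun j => by
      rw [ZMod.coe_valMinAbs]
      exact congrFun h j]

lemma periodicPotential_symm (hv : ∀ x, v (-x) = v x) (x y : Torus d L) :
    periodicPotential v L x y = periodicPotential v L y x := by
  rw [periodicPotential_eq v x y (fun j => (y j - x j).valMinAbs) (by simp),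
    periodicPotential_eq v y x (fun j => -(y j - x j).valMinAbs) (by simp),
    ← (Equiv.neg _).tsum_eq]
  refine tsum_congr fun z => ?_
  rw [← hv]
  refine congrArg v (funext fun j => ?_)
  simp only [Equiv.neg_apply, Pi.neg_apply]
  ring

/-- The translates of the torus tile the lattice. -/
def latticeEquiv (x : Torus d L) : Torus d L × (Fin d → ℤ) ≃ (Fin d → ℤ) :=
  Equiv.ofBijective
    (fun s j => (s.1 j).valMinAbs + (L : ℤ) * s.2 j - (x j).valMinAbs) ⟨by
    rintro ⟨y, z⟩ ⟨y', z'⟩ h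
    have h1 : ∀ j, (y j).valMinAbs + (L : ℤ) * z j = (y' j).valMinAbs + (L : ℤ) * z' j :=
      fun j => by
        have := congrFun h j
        simp only at this
        linarith
    have hy : y = y' := funext fun j => by
      have := congrArg (Int.cast : ℤ → ZMod L) (h1 j)
      simpa using this
    subst hy
    have hz : z = z' := funext fun j => by
      have h2 := h1 j
      have hL : (L : ℤ) ≠ 0 := by exact_mod_cast NeZero.ne L
      exact mul_left_cancel₀ hL (by linarith)
    rw [hz], by
    intro w
    have h : ∀ j, ∃ c : ℤ, w j + (x j).valMinAbs -
        ((w j + (x j).valMinAbs : ℤ) : ZMod L).valMinAbs = L * c := by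
      intro j
      refine (ZMod.intCast_zmod_eq_zero_iff_dvd _ _).1 ?_
      push_cast
      simp
    choose c hc using h
    refine ⟨(fun j => ((w j + (x j).valMinAbs : ℤ) : ZMod L), c), funext fun j => ?_⟩
    have := hc j
    simp only
    linarith⟩

lemma sum_tsum_translate {h : (Fin d → ℤ) → ℝ} (hs : Summable h) (x : Torus d L) :
    ∑ y, periodicPotential h L x y = ∑' w, h w := by
  have hs2 : Summable (h ∘ latticeEquiv x) := (latticeEquiv x).summable_iff.2 hs
  rw [← (latticeEquiv x).tsum_eq]
  exact (hs2.tsum_prod.trans (tsum_fintype _)).symm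

lemma summable_translate {h : (Fin d → ℤ) → ℝ} (hs : Summable h) (x y : Torus d L) :
    Summable fun z : Fin d → ℤ => h fun j =>
      (y j).valMinAbs + (L : ℤ) * z j - (x j).valMinAbs :=
  ((latticeEquiv x).summable_iff.2 hs).prod_factor y

lemma abs_sum_periodicPotential_le (hv : Summable fun x => |v x|) :
    |∑ x : Torus d L, ∑ y : Torus d L, periodicPotential v L x y| ≤
      Fintype.card (Torus d L) * ∑' x, |v x| := by
  have h1 : ∀ x : Torus d L, ∑ y : Torus d L, periodicPotential v L x y = ∑' w, v w :=
    fun x => sum_tsum_translate hv.of_abs x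
  simp_rw [h1]
  rw [Finset.sum_const, nsmul_eq_mul, abs_mul, Nat.abs_cast, Finset.card_univ]
  refine mul_le_mul_of_nonneg_left ?_ (by positivity)
  have h2 : Summable fun x => ‖v x‖ := hv
  exact norm_tsum_le_tsum_norm h2

lemma apply_zero_nonneg (ht : Tempered v) : 0 ≤ v 0 := by
  by_contra h
  push Not at h
  have h1 := ht.1
  rw [vbar] at h1
  have : ∑' x : Fin d → ℤ, (if v x < 0 then v x else 0) ≤ 0 :=
    tsum_nonpos fun x => by split_ifs with h <;> linarith
  linarith

/-- Stability of tempered potentials. -/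
lemma energy_ge (hv : ∀ x, v (-x) = v x) (ht : Tempered v) (n : Torus d L → ℝ)
    (hn : ∀ x, 0 ≤ n x) :
    vbar v * ∑ x, n x ^ 2 ≤ ∑ x, ∑ y, periodicPotential v L x y * n x * n y := by
  -- The potential is bounded below by its negative part plus its value at the origin. The positive
  -- part elsewhere is dropped, as local times are nonnegative.
  let vm : (Fin d → ℤ) → ℝ := fun x => if v x < 0 then v x else 0
  let dl : (Fin d → ℤ) → ℝ := fun x => if x = 0 then v 0 else 0
  have hvm : Summable vm := by
    refine Summable.of_norm_bounded ht.2 fun x => ?_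
    simp only [vm]
    split_ifs
    · exact le_rfl
    · simp
  have hdl : Summable dl := by
    refine summable_of_ne_finset_zero (s := {0}) fun x hx => ?_
    simp only [Finset.mem_singleton] at hx
    simp [dl, hx]
  have h0 := apply_zero_nonneg v ht
  have hle : ∀ x, vm x + dl x ≤ v x := by
    intro x
    simp only [vm, dl]
    by_cases hx : x = 0
    · subst hx
      simp [not_lt.2 h0]
    · simp only [hx, if_false, add_zero]
      split_ifs with h
      · exact le_rfl
      · exact not_lt.1 h
  have hpp : ∀ x y : Torus d L, periodicPotential vm L x y + periodicPotential dl L x y ≤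
      periodicPotential v L x y := by
    intro x y
    have hs := summable_translate hvm x y
    have hs2 := summable_translate hdl x y
    rw [periodicPotential, periodicPotential, ← hs.tsum_add hs2]
    exact (hs.add hs2).tsum_le_tsum (fun z => hle _) (summable_translate ht.2.of_abs x y)
  have hvm0 : ∀ x y : Torus d L, periodicPotential vm L x y ≤ 0 := fun x y =>
    tsum_nonpos fun z => by
      simp only [vm]
      split_ifs with h
      · exact h.le
      · exact le_rfl
  have hdl0 : ∀ x y : Torus d L, 0 ≤ periodicPotential dl L x y := fun x y =>
    tsum_nonneg fun z => by
      simp only [dl]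
      split_ifs
      · exact h0
      · exact le_rfl
  have hdlx : ∀ x : Torus d L, v 0 ≤ periodicPotential dl L x x := by
    intro x
    have hs2 := summable_translate hdl x x
    refine le_trans ?_ (hs2.le_tsum 0 fun z _ => ?_)
    · simp only [Pi.zero_apply, mul_zero, add_zero, sub_self, dl]
      exact (if_pos rfl).ge
    · simp only [dl]
      split_ifs
      · exact h0
      · exact le_rfl
  have hvmsymm : ∀ x y : Torus d L, periodicPotential vm L x y = periodicPotential vm L y x :=
    periodicPotential_symm vm fun x => by simp only [vm, hv]
  -- For the negative part, n_x n_y is replaced by the mean of the squares; each row of its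
  -- periodization sums to the full sum of `vm`.
  have hA : ∑ x : Torus d L, ∑ y, periodicPotential vm L x y * ((n x ^ 2 + n y ^ 2) / 2) =
      (∑' w, vm w) * ∑ x, n x ^ 2 := by
    have e1 : ∑ x : Torus d L, ∑ y, periodicPotential vm L x y * n x ^ 2 =
        (∑' w, vm w) * ∑ x, n x ^ 2 := by
      rw [Finset.mul_sum]
      refine Finset.sum_congr rfl fun x _ => ?_
      rw [← Finset.sum_mul, sum_tsum_translate hvm]
    have e2 : ∑ x : Torus d L, ∑ y, periodicPotential vm L x y * n y ^ 2 =
        (∑' w, vm w) * ∑ x, n x ^ 2 := by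
      rw [Finset.sum_comm, ← e1]
      exact Finset.sum_congr rfl fun x _ => Finset.sum_congr rfl fun y _ => by rw [hvmsymm]
    have e3 : ∑ x : Torus d L, ∑ y, periodicPotential vm L x y * ((n x ^ 2 + n y ^ 2) / 2) =
        (∑ x : Torus d L, ∑ y, periodicPotential vm L x y * n x ^ 2 +
          ∑ x : Torus d L, ∑ y, periodicPotential vm L x y * n y ^ 2) / 2 := by
      simp only [← Finset.sum_add_distrib, Finset.sum_div]
      refine Finset.sum_congr rfl fun x _ => Finset.sum_congr rfl fun y _ => ?_
      ring
    rw [e3, e1, e2]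
    ring
  have hB : v 0 * ∑ x, n x ^ 2 ≤
      ∑ x : Torus d L, ∑ y, periodicPotential dl L x y * n x * n y := by
    rw [Finset.mul_sum]
    refine Finset.sum_le_sum fun x _ => ?_
    refine le_trans ?_ (Finset.single_le_sum (f := fun y => periodicPotential dl L x y * n x * n y)
      (fun y _ => mul_nonneg (mul_nonneg (hdl0 x y) (hn x)) (hn y)) (Finset.mem_univ x))
    have := mul_le_mul_of_nonneg_right (hdlx x) (sq_nonneg (n x))
    linarith
  have hC : ∑ x : Torus d L, ∑ y, periodicPotential vm L x y * ((n x ^ 2 + n y ^ 2) / 2) +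
      ∑ x : Torus d L, ∑ y, periodicPotential dl L x y * n x * n y ≤
      ∑ x, ∑ y, periodicPotential v L x y * n x * n y := by
    simp only [← Finset.sum_add_distrib]
    refine Finset.sum_le_sum fun x _ => Finset.sum_le_sum fun y _ => ?_
    have h1 := mul_le_mul_of_nonneg_right (hpp x y) (mul_nonneg (hn x) (hn y))
    have h2 := hvm0 x y
    nlinarith [mul_nonneg (neg_nonneg.2 h2) (sq_nonneg (n x - n y))]
  have : vbar v = v 0 + ∑' w, vm w := rfl
  rw [this, add_mul]
  linarith

end Potential

/-! ### Consequences of separability -/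

section Separable

variable {d L : ℕ} [NeZero L] {v : (Fin d → ℤ) → ℝ}

lemma edgeReflection_eq (i : Fin d) (x : Torus d L) :
    edgeReflection i x = planeReflection i 0 x := by
  simp [edgeReflection, planeReflection]

/-- The kernel between the halves is positive semidefinite. -/
lemma ISeparable.exists_kernel (hL : Even L) {vL : Torus d L → Torus d L → ℝ} {i : Fin d}
    (h : ISeparable vL i) :
    (Matrix.of fun x y : {x : Torus d L // planeHalf i 0 x} =>
      -vL x (planeReflection i 0 y)).PosSemidef := by
  obtain ⟨k, T, _, ν, α, β, _, hα, -, ⟨C, hC⟩, -, hint, hβ⟩ := h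
  have hq : ∀ x y : {x : Torus d L // planeHalf i 0 x},
      ((-vL x (planeReflection i 0 y) : ℝ) : ℂ) =
        ∫ t, ∑ j, α t x j * conj (α t y j) ∂ν := by
    intro x y
    have hx : 0 < (x.1 i).valMinAbs := by simpa [planeHalf] using x.2
    have hy : (planeReflection i 0 y.1 i).valMinAbs ≤ 0 := by
      have := (planeHalf_planeReflection hL i 0 (planeReflection i 0 y.1)).1
        (by rw [planeReflection_involutive]; exact y.2)
      simpa [planeHalf] using this
    rw [hint _ _ hx hy]
    refine integral_congr_ae ?_
    filter_upwards [hβ (planeReflection i 0 y.1)] with t ht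
    refine Finset.sum_congr rfl fun j _ => ?_
    rw [ht j, edgeReflection_eq, planeReflection_involutive]
  have hmeas : ∀ x j, Measurable fun t => α t x j := fun x j => measurable_pi_iff.1 (hα x) j
  have hI : ∀ x y j, Integrable (fun t => α t x j * conj (α t y j)) ν := by
    intro x y j
    refine Integrable.of_bound (C := C * C) ?_ (Filter.Eventually.of_forall fun t => ?_)
    · exact ((hmeas x j).mul (Complex.continuous_conj.measurable.comp
        (hmeas y j))).aestronglyMeasurable
    · rw [norm_mul, RCLike.norm_conj]
      exact mul_le_mul (hC t x j) (hC t y j) (norm_nonneg _) ((norm_nonneg _).trans (hC t x j))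
  refine Matrix.PosSemidef.of_sum_sum_nonneg (fun x y => ?_) fun f => ?_
  · have h1 : ((-vL x (planeReflection i 0 y) : ℝ) : ℂ) =
        conj ((-vL y (planeReflection i 0 x) : ℝ) : ℂ) := by
      rw [hq, hq, ← integral_conj]
      refine integral_congr_ae (Filter.Eventually.of_forall fun t => ?_)
      simp only [map_sum, map_mul, Complex.conj_conj]
      exact Finset.sum_congr rfl fun j _ => mul_comm _ _
    rw [Complex.conj_ofReal] at h1
    exact_mod_cast h1
  · have h1 : ((∑ x, ∑ y, f x * f y * (Matrix.of fun x y : {x : Torus d L // planeHalf i 0 x} =>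
        -vL x (planeReflection i 0 y)) x y : ℝ) : ℂ) =
        ∫ t, ((∑ j, Complex.normSq (∑ x, f x * α t x.1 j) : ℝ) : ℂ) ∂ν := by
      have h2 : ∀ t, ((∑ j, Complex.normSq (∑ x, f x * α t x.1 j) : ℝ) : ℂ) =
          ∑ x, ∑ y, (f x * f y : ℂ) * ∑ j, α t x.1 j * conj (α t y.1 j) := by
        intro t
        have h3 : ∀ j, ((Complex.normSq (∑ x, f x * α t x.1 j) : ℝ) : ℂ) =
            ∑ x, ∑ y, (f x * f y : ℂ) * (α t x.1 j * conj (α t y.1 j)) := by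
          intro j
          rw [← Complex.mul_conj, map_sum, Finset.sum_mul_sum]
          refine Finset.sum_congr rfl fun x _ => Finset.sum_congr rfl fun y _ => ?_
          rw [map_mul, Complex.conj_ofReal]
          ring
        rw [Complex.ofReal_sum, Finset.sum_congr rfl fun j _ => h3 j, Finset.sum_comm]
        refine Finset.sum_congr rfl fun x _ => ?_
        rw [Finset.sum_comm]
        exact Finset.sum_congr rfl fun y _ => (Finset.mul_sum _ _ _).symm
      simp_rw [h2]
      rw [integral_finsetSum _ fun x _ => integrable_finsetSum _ fun y _ =>
        (integrable_finsetSum _ fun j _ => hI _ _ j).const_mul _]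
      push_cast
      refine Finset.sum_congr rfl fun x _ => ?_
      rw [integral_finsetSum _ fun y _ => (integrable_finsetSum _ fun j _ => hI _ _ j).const_mul _]
      refine Finset.sum_congr rfl fun y _ => ?_
      rw [integral_const_mul, ← hq]
      simp
    have h2 := Complex.ofReal_injective (h1.trans (integral_ofReal (𝕜 := ℂ)))
    rw [h2]
    refine integral_nonneg fun t => ?_
    change (0 : ℝ) ≤ ∑ j, Complex.normSq (∑ x, f x * α t x.1 j)
    exact Finset.sum_nonneg fun j _ => Complex.normSq_nonneg _

/-- The periodic potential depends on displacements only, so the plane can be translated to a = 0,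
where separability applies. -/
lemma posSemidef_plane (hL : Even L) (hsep : Separable v) (i : Fin d) (a : ZMod L) :
    (Matrix.of fun x y : {x : Torus d L // planeHalf i a x} =>
      -periodicPotential v L x (planeReflection i a y)).PosSemidef := by
  have h0 := (hsep L (Nat.pos_of_ne_zero (NeZero.ne L)) hL i).exists_kernel hL
  have h1 := h0.submatrix fun x : {x : Torus d L // planeHalf i a x} =>
    (⟨x.1 - Pi.single i a, by simpa [planeHalf] using x.2⟩ : {x : Torus d L // planeHalf i 0 x})
  convert h1 using 1
  ext x y
  simp only [Matrix.of_apply, Matrix.submatrix_apply]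
  congr 1
  refine periodicPotential_congr v (funext fun j => ?_)
  by_cases hj : j = i
  · subst hj
    simp [planeReflection]
    ring
  · simp [planeReflection, hj]

/-- Invariance under a single sign change is not assumed of v; it comes from separability. Symmetry
of the kernel between the halves gives v_L(x, θy) = v_L(y, θx). The two displacements have the same
i-th coordinate and opposite other coordinates, and evenness of v turns this into a flip of
coordinate i. -/
lemma periodicPotential_flip (hL : Even L) (hv : ∀ x, v (-x) = v x) (hsep : Separable v)
    (i : Fin d) (t : Torus d L) :
    periodicPotential v L 0 (Function.update t i (-t i)) = periodicPotential v L 0 t := by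
  have hL0 := NeZero.ne L
  by_cases ht : t i = 0
  · rw [ht, neg_zero, ← ht, Function.update_eq_self]
  obtain ⟨r, hr⟩ := hL
  have hn : (1 - t i).val ≠ 1 := by
    intro h
    apply ht
    have h2 : (1 - t i) = ((1 : ℕ) : ZMod L) := by rw [← h, ZMod.natCast_zmod_val]
    rw [Nat.cast_one] at h2
    simpa using h2
  -- With p and q in 1, …, L/2 the sum takes all values from 2 to L, hence all residues except 1.
  -- The missing residue is the trivial case t i = 0.
  obtain ⟨p, q, hp, hq, hp', hq', hpq⟩ : ∃ p q : ℕ, 0 < p ∧ 0 < q ∧ p ≤ L / 2 ∧ q ≤ L / 2 ∧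
      ((p + q : ℕ) : ZMod L) = 1 - t i := by
    have hlt := (1 - t i).val_lt
    rcases Nat.eq_zero_or_pos (1 - t i).val with h | h
    · refine ⟨L / 2, L / 2, by omega, by omega, le_rfl, le_rfl, ?_⟩
      rw [show L / 2 + L / 2 = L by omega, (ZMod.val_eq_zero _).1 h, ZMod.natCast_self]
    · refine ⟨min ((1 - t i).val - 1) (L / 2), (1 - t i).val - min ((1 - t i).val - 1) (L / 2),
        by omega, by omega, by omega, by omega, ?_⟩
      rw [show min ((1 - t i).val - 1) (L / 2) + ((1 - t i).val - min ((1 - t i).val - 1) (L / 2)) =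
        (1 - t i).val by omega, ZMod.natCast_zmod_val]
  have hhalf : ∀ (p : ℕ) (x : Torus d L), 0 < p → p ≤ L / 2 → x i = (p : ZMod L) →
      planeHalf i 0 x := by
    intro p x h1 h2 h3
    rw [planeHalf, ZMod.valMinAbs_pos_iff, sub_zero, h3, ZMod.val_natCast,
      Nat.mod_eq_of_lt (by omega)]
    exact ⟨h1, h2⟩
  set x : Torus d L := Pi.single i (p : ZMod L) with hx
  set y : Torus d L := Function.update t i (q : ZMod L) with hy
  have hs := (posSemidef_plane ⟨r, hr⟩ hsep i 0).isHermitian.apply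
    ⟨x, hhalf p x hp hp' (by simp [hx])⟩ ⟨y, hhalf q y hq hq' (by simp [hy])⟩
  simp only [Matrix.of_apply, star_trivial, neg_inj] at hs
  have h1 : periodicPotential v L x (planeReflection i 0 y) = periodicPotential v L 0 t := by
    refine periodicPotential_congr v (funext fun j => ?_)
    by_cases hj : j = i
    · subst hj
      push_cast at hpq
      simp only [hx, hy, planeReflection, Pi.sub_apply, Function.update_self, Pi.single_eq_same,
        Pi.zero_apply]
      linear_combination -hpq
    · simp [planeReflection, hx, hy, hj]
  have h2 : periodicPotential v L y (planeReflection i 0 x) =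
      periodicPotential v L (Function.update t i (-t i)) 0 := by
    refine periodicPotential_congr v (funext fun j => ?_)
    by_cases hj : j = i
    · subst hj
      push_cast at hpq
      simp only [hx, hy, planeReflection, Pi.sub_apply, Function.update_self, Pi.single_eq_same,
        Pi.zero_apply]
      linear_combination -hpq
    · simp [planeReflection, hx, hy, hj]
  rw [periodicPotential_symm v hv, ← h1, ← h2, hs]

lemma periodicPotential_planeReflection (hL : Even L) (hv : ∀ x, v (-x) = v x)
    (hsep : Separable v) (i : Fin d) (a : ZMod L) (x y : Torus d L) :
    periodicPotential v L (planeReflection i a x) (planeReflection i a y) =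
      periodicPotential v L x y := by
  have h1 : periodicPotential v L x y = periodicPotential v L 0 (y - x) :=
    periodicPotential_congr v (by simp)
  rw [h1, ← periodicPotential_flip hL hv hsep i]
  refine periodicPotential_congr v (funext fun j => ?_)
  by_cases hj : j = i
  · subst hj
    simp [planeReflection]
  · simp [planeReflection, hj]

end Separable

/-! ### Factorizations of graphs into perfect matchings -/

/-- A factorization of a graph into perfect matchings: `p j` exchanges the end points of the edges
of the matching `j`. -/
structure MatchingFactorization {V : Type} (G : SimpleGraph V) (J : Type) where
  p : J → V → V
  involutive : ∀ j, Function.Involutive (p j)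
  adj : ∀ j x, G.Adj x (p j x)
  injective : ∀ x, Function.Injective fun j => p j x
  surjective : ∀ x y, G.Adj x y → ∃ j, p j x = y

/-! ### The graph structure of the torus -/

section TorusGraph

variable {d L : ℕ} [NeZero L]

lemma planeReflection_adj (i : Fin d) (a : ZMod L) {x y : Torus d L}
    (h : (torusGraph d L).Adj x y) :
    (torusGraph d L).Adj (planeReflection i a x) (planeReflection i a y) := by
  have key : ∀ (x : Torus d L) (j : Fin d),
      planeReflection i a (x + Pi.single j 1) = planeReflection i a x + Pi.single j 1 ∨
      planeReflection i a x = planeReflection i a (x + Pi.single j 1) + Pi.single j 1 := by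
    intro x j
    by_cases hj : j = i
    · subst hj
      right
      funext l
      by_cases hl : l = j
      · subst hl
        simp [planeReflection]
        ring
      · simp [planeReflection, hl]
    · left
      funext l
      by_cases hl : l = i
      · subst hl
        simp [planeReflection, Ne.symm hj]
      · simp [planeReflection, hl]
  obtain ⟨hne, j, rfl | rfl⟩ := h
  · exact ⟨fun h => hne ((planeReflection_involutive i a).injective h), j, key x j⟩
  · exact ⟨fun h => hne ((planeReflection_involutive i a).injective h), j, (key y j).symm⟩

/-- A plane cuts the torus twice, after a and after a + L/2. At both places the reflection exchanges
the endpoints of the crossing edges. -/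
lemma eq_planeReflection_of_adj (hL : Even L) (i : Fin d) (a : ZMod L) {x y : Torus d L}
    (h : (torusGraph d L).Adj x y) (hx : planeHalf i a x) (hy : ¬ planeHalf i a y) :
    y = planeReflection i a x := by
  have hL0 := NeZero.ne L
  obtain ⟨r, hr⟩ := hL
  have hsum : x i - a + (y i - a) = 1 ∧ ∀ l, l ≠ i → y l = x l := by
    rw [planeHalf, ZMod.valMinAbs_pos_iff] at hx hy
    obtain ⟨-, j, hj⟩ := h
    have hji : j = i := by
      by_contra hne
      apply hy
      have : y i = x i := by
        rcases hj with rfl | rfl <;> simp [Ne.symm hne]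
      rwa [this]
    subst hji
    refine ⟨?_, fun l hl => by rcases hj with rfl | rfl <;> simp [hl]⟩
    rcases hj with rfl | rfl
    · have h1 : (x + Pi.single j 1 : Torus d L) j - a = (x j - a) + (1 : ℕ) := by
        simp
        ring
      rw [h1, ZMod.val_add_natCast] at hy
      have h2 : (x j - a).val = L / 2 := by
        rcases Nat.lt_or_ge ((x j - a).val + 1) L with h | h
        · rw [Nat.mod_eq_of_lt h] at hy
          omega
        · omega
      have h3 : x j - a = ((L / 2 : ℕ) : ZMod L) := by rw [← h2, ZMod.natCast_zmod_val]
      rw [h1, h3, ← add_assoc, ← Nat.cast_add, show L / 2 + L / 2 = L by omega, ZMod.natCast_self]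
      simp
    · have h1 : (y + Pi.single j 1 : Torus d L) j - a = (y j - a) + (1 : ℕ) := by
        simp
        ring
      rw [h1, ZMod.val_add_natCast] at hx
      have h2 : (y j - a).val = 0 := by
        have := (y j - a).val_lt
        rcases Nat.lt_or_ge ((y j - a).val + 1) L with h | h
        · rw [Nat.mod_eq_of_lt h] at hx
          omega
        · have h3 : (y j - a).val + 1 = L := by omega
          rw [h3, Nat.mod_self] at hx
          omega
      rw [h1, (ZMod.val_eq_zero _).1 h2]
      simp
  funext l
  by_cases hl : l = i
  · subst hl
    rw [planeReflection, Function.update_self]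
    linear_combination hsum.1
  · rw [planeReflection, Function.update_of_ne hl, hsum.2 l hl]

/-- The neighbour of `x` in direction `i` on the side determined by the parity of `x i`. -/
def torusPartner (i : Fin d) (s : Bool) (x : Torus d L) : Torus d L :=
  if Even ((x i).val + s.toNat) then x + Pi.single i 1 else x - Pi.single i 1

lemma even_val_add_one (hL : Even L) (s : ZMod L) : Even (s + 1).val ↔ ¬ Even s.val := by
  have h := ZMod.val_add_natCast s 1
  rw [Nat.cast_one] at h
  rw [h, Nat.even_iff, Nat.mod_mod_of_dvd _ (even_iff_two_dvd.1 hL), ← Nat.even_iff,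
    Nat.even_add_one]

lemma even_val_neg (hL : Even L) (s : ZMod L) : Even (-s).val ↔ Even s.val := by
  rw [ZMod.neg_val]
  have := s.val_lt
  split_ifs with h
  · simp [h]
  · rw [Nat.even_sub this.le]
    simp [hL]

lemma even_val_sub_one (hL : Even L) (s : ZMod L) : Even (s - 1).val ↔ ¬ Even s.val := by
  have := even_val_add_one hL (s - 1)
  rw [sub_add_cancel] at this
  tauto

lemma torusPartner_involutive (hL : Even L) (i : Fin d) (s : Bool) :
    Function.Involutive (torusPartner i s : Torus d L → Torus d L) := by
  intro x
  unfold torusPartner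
  split_ifs with h1 h2 h2
  · simp only [Pi.add_apply, Pi.single_eq_same, Nat.even_add, even_val_add_one hL] at h1 h2
    tauto
  · simp
  · simp
  · simp only [Pi.sub_apply, Pi.single_eq_same, Nat.even_add, even_val_sub_one hL] at h1 h2
    tauto

lemma one_ne_zero_of_even (hL : Even L) : (1 : ZMod L) ≠ 0 := by
  have hL0 := NeZero.ne L
  have : Fact (1 < L) := ⟨by
    obtain ⟨r, hr⟩ := hL
    omega⟩
  exact one_ne_zero

lemma single_one_ne_zero (hL : Even L) (i : Fin d) : (Pi.single i 1 : Torus d L) ≠ 0 := by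
  intro h
  have := congrFun h i
  simp only [Pi.single_eq_same, Pi.zero_apply] at this
  exact one_ne_zero_of_even hL this

lemma torusPartner_adj (hL : Even L) (i : Fin d) (s : Bool) (x : Torus d L) :
    (torusGraph d L).Adj x (torusPartner i s x) := by
  have h0 := single_one_ne_zero (L := L) hL i
  unfold torusPartner
  split_ifs
  · exact ⟨fun h => h0 (left_eq_add.1 h), i, Or.inl rfl⟩
  · exact ⟨fun h => h0 (sub_eq_self.1 h.symm), i, Or.inr (by simp)⟩

/-- The matchings of the torus: there are two in every direction, unless the side length is two. -/
abbrev TorusMatching (d L : ℕ) : Type := {j : Fin d × Bool // L = 2 → j.2 = false}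

/-- The torus is the union of perfect matchings. -/
def torusFactorization (d : ℕ) {L : ℕ} [NeZero L] (hL : Even L) :
    MatchingFactorization (torusGraph d L) (TorusMatching d L) where
  p j := torusPartner j.1.1 j.1.2
  involutive j := torusPartner_involutive hL j.1.1 j.1.2
  adj j x := torusPartner_adj hL j.1.1 j.1.2 x
  injective := by
    rintro x ⟨⟨i, s⟩, hs⟩ ⟨⟨i', s'⟩, hs'⟩ h
    simp only at h hs hs'
    have h1 := one_ne_zero_of_even hL
    have hii : i = i' := by
      by_contra hne
      have := congrFun h i
      unfold torusPartner at this
      split_ifs at this <;> simp [hne, h1] at this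
    subst hii
    have : s = s' := by
      -- For L = 2 both neighbours in one direction coincide, and so would the two matchings; only
      -- the label `false` is kept. Otherwise 1 ≠ -1 distinguishes them.
      by_cases hL2 : L = 2
      · rw [hs hL2, hs' hL2]
      have h2 : (1 : ZMod L) ≠ -1 := by
        intro h2
        have h3 : ((2 : ℕ) : ZMod L) = 0 := by
          push_cast
          linear_combination h2
        rw [ZMod.natCast_eq_zero_iff] at h3
        have := Nat.le_of_dvd (by norm_num) h3
        have hL0 := NeZero.ne L
        obtain ⟨r, hr⟩ := hL
        omega
      have h3 := congrFun h i
      unfold torusPartner at h3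
      split_ifs at h3 with e1 e2 e2
      · rw [Nat.even_iff] at e1 e2
        cases s <;> cases s' <;> first
          | rfl
          | (exfalso; simp only [Bool.toNat_true, Bool.toNat_false] at e1 e2; omega)
      · simp only [Pi.add_apply, Pi.sub_apply, Pi.single_eq_same, sub_eq_add_neg] at h3
        exact absurd (add_left_cancel h3) h2
      · simp only [Pi.add_apply, Pi.sub_apply, Pi.single_eq_same, sub_eq_add_neg] at h3
        exact absurd (add_left_cancel h3).symm h2
      · rw [Nat.even_iff] at e1 e2
        cases s <;> cases s' <;> first
          | rfl
          | (exfalso; simp only [Bool.toNat_true, Bool.toNat_false] at e1 e2; omega)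
    subst this
    rfl
  surjective := by
    intro x y h
    have hsub : L = 2 → ∀ i : Fin d, ∀ z : Torus d L, z + Pi.single i 1 = z - Pi.single i 1 := by
      rintro rfl i z
      rw [sub_eq_add_neg, ← Pi.single_neg]
      congr 1
    obtain ⟨-, i, rfl | rfl⟩ := h
    · by_cases hL2 : L = 2
      · refine ⟨⟨(i, false), fun _ => rfl⟩, ?_⟩
        simp only [torusPartner]
        split_ifs
        · rfl
        · exact (hsub hL2 i x).symm
      · refine ⟨⟨(i, !decide (Even (x i).val)), fun h => absurd h hL2⟩, ?_⟩
        simp only [torusPartner]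
        rw [if_pos]
        by_cases he : Even (x i).val <;> simp [he, Nat.even_add_one]
    · by_cases hL2 : L = 2
      · refine ⟨⟨(i, false), fun _ => rfl⟩, ?_⟩
        simp only [torusPartner]
        split_ifs
        · rw [hsub hL2 i]
          simp
        · simp
      · refine ⟨⟨(i, decide (Even ((y + Pi.single i 1 : Torus d L) i).val)), fun h => absurd h hL2⟩, ?_⟩
        simp only [torusPartner]
        rw [if_neg]
        · simp
        · generalize ((y + Pi.single i 1 : Torus d L) i).val = n
          by_cases he : Even n <;> simp [he, Nat.even_add_one]

/-- The map s ↦ 2a + 1 - s changes parity, since L is even, and also reverses the orientation. The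
two effects cancel, so every matching is invariant under all plane reflections. -/
lemma torusPartner_planeReflection (hL : Even L) (i : Fin d) (a : ZMod L) (j : Fin d) (s : Bool)
    (x : Torus d L) :
    torusPartner j s (planeReflection i a x) = planeReflection i a (torusPartner j s x) := by
  by_cases hj : j = i
  · subst hj
    have h1 : Even (planeReflection j a x j).val ↔ ¬ Even (x j).val := by
      have h2 : planeReflection j a x j = a + a - x j + 1 := by
        rw [planeReflection, Function.update_self]
        ring
      have hadd : ∀ s t : ZMod L, Even (s + t).val ↔ (Even s.val ↔ Even t.val) := by
        intro s t
        rw [ZMod.val_add, Nat.even_iff, Nat.mod_mod_of_dvd _ (even_iff_two_dvd.1 hL),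
          ← Nat.even_iff, Nat.even_add]
      rw [h2, even_val_add_one hL, sub_eq_add_neg, hadd, hadd, even_val_neg hL]
      tauto
    have h3 : Even ((planeReflection j a x j).val + s.toNat) ↔
        ¬ Even ((x j).val + s.toNat) := by
      rw [Nat.even_add, Nat.even_add, h1]
      tauto
    unfold torusPartner
    by_cases h : Even ((x j).val + s.toNat)
    · rw [if_pos h, if_neg (fun h4 => h3.1 h4 h)]
      funext l
      by_cases hl : l = j
      · subst hl
        simp [planeReflection]
        ring
      · simp [planeReflection, hl]
    · rw [if_neg h, if_pos (h3.2 h)]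
      funext l
      by_cases hl : l = j
      · subst hl
        simp [planeReflection]
        ring
      · simp [planeReflection, hl]
  · have h1 : planeReflection i a x j = x j := by
      rw [planeReflection, Function.update_of_ne hj]
    unfold torusPartner
    rw [h1]
    split_ifs
    all_goals
      funext l
      by_cases hl : l = i
      · subst hl
        simp [planeReflection, Ne.symm hj]
      · simp [planeReflection, hl]

end TorusGraph

/-! ### The chessboard estimate for the random path model -/

section TorusModel

variable {d L N : ℕ} [NeZero L]

/-- The reflection of the edges of the torus. -/
def torusEdgeReflection (hL : Even L) (i : Fin d) (a : ZMod L) :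
    RPM.EdgeReflection (torusGraph d L).edgeSet where
  refl e := ⟨Sym2.map (planeReflection i a) e, by
    obtain ⟨e, he⟩ := e
    induction e with
    | _ x y => exact planeReflection_adj i a he⟩
  plus e := ∀ x ∈ (e : Sym2 (Torus d L)), planeHalf i a x
  involutive := by
    rintro ⟨e, he⟩
    refine Subtype.ext ?_
    simp only [Sym2.map_map, (planeReflection_involutive i a).comp_self]
    exact congrFun Sym2.map_id e
  not_plus := by
    rintro ⟨e, he⟩
    induction e with
    | _ x y =>
      intro h h2
      have h3 := h2 (planeReflection i a x) (by simp)
      exact (planeHalf_planeReflection hL i a x).1 h3 (h x (by simp))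
  crossing := by
    rintro ⟨e, he⟩
    induction e with
    | _ x y =>
      intro h1 h2
      have hP := planeHalf_planeReflection (d := d) hL i a
      have hI := planeReflection_involutive (d := d) i a
      have he' : (torusGraph d L).Adj x y := he
      simp only [Sym2.mem_iff, forall_eq_or_imp, forall_eq, not_and_or, Sym2.map_mk, hP,
        not_not] at h1 h2
      refine Subtype.ext ?_
      simp only [Sym2.map_mk]
      rcases h2 with hx | hy
      · rcases h1 with h1 | h1
        · exact absurd hx h1
        · have := eq_planeReflection_of_adj hL i a he' hx h1
          rw [← this, this, hI, Sym2.eq_swap]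
      · rcases h1 with h1 | h1
        · have := eq_planeReflection_of_adj hL i a he'.symm hy h1
          rw [← this, this, hI, Sym2.eq_swap]
        · exact absurd hy h1

lemma mem_torusEdgeReflection (hL : Even L) (i : Fin d) (a : ZMod L) (x : Torus d L)
    (e : (torusGraph d L).edgeSet) :
    planeReflection i a x ∈ ((torusEdgeReflection hL i a).refl e : Sym2 (Torus d L)) ↔
      x ∈ (e : Sym2 (Torus d L)) := by
  simp only [torusEdgeReflection, Sym2.mem_map]
  constructor
  · rintro ⟨y, hy, hxy⟩
    rwa [← (planeReflection_involutive i a).injective hxy]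
  · exact fun h => ⟨x, h, rfl⟩

lemma deg_planeReflection (hL : Even L) (i : Fin d) (a : ZMod L)
    (k : (torusGraph d L).edgeSet → Fin N → ℕ) (x : Torus d L) (c : Fin N) :
    RPM.deg k (planeReflection i a x) c =
      RPM.deg (k ∘ (torusEdgeReflection hL i a).refl) x c := by
  rw [RPM.deg, ← Equiv.sum_comp (torusEdgeReflection hL i a).involutive.toPerm]
  refine Finset.sum_congr rfl fun e _ => ?_
  simp only [Function.Involutive.coe_toPerm, mem_torusEdgeReflection, Function.comp_apply]

lemma not_plus_of_mem (hL : Even L) (i : Fin d) (a : ZMod L) {x : Torus d L}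
    (hx : planeHalf i a x) {e : (torusGraph d L).edgeSet} (he : x ∈ (e : Sym2 (Torus d L))) :
    ¬ (torusEdgeReflection hL i a).plus ((torusEdgeReflection hL i a).refl e) := fun h =>
  (planeHalf_planeReflection hL i a x).1 (h _ ((mem_torusEdgeReflection hL i a x e).2 he)) hx

lemma deg_congr_half (hL : Even L) (i : Fin d) (a : ZMod L)
    {k k' : (torusGraph d L).edgeSet → Fin N → ℕ} {x : Torus d L} (hx : planeHalf i a x)
    (h : ∀ e, ¬ (torusEdgeReflection hL i a).plus ((torusEdgeReflection hL i a).refl e) →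
      k e = k' e) (c : Fin N) : RPM.deg k x c = RPM.deg k' x c := by
  refine Finset.sum_congr rfl fun e _ => ?_
  split_ifs with he
  · rw [h e (not_plus_of_mem hL i a hx he)]
  · rfl

/-- The edge at `x` in the first matching of direction `j`. -/
def matchingEdge (hL : Even L) (j : Fin d) (x : Torus d L) : (torusGraph d L).edgeSet :=
  ⟨s(x, torusPartner j false x), torusPartner_adj hL j false x⟩

lemma matchingEdge_planeReflection (hL : Even L) (j i : Fin d) (a : ZMod L) (x : Torus d L) :
    matchingEdge hL j (planeReflection i a x) =
      (torusEdgeReflection hL i a).refl (matchingEdge hL j x) := by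
  refine Subtype.ext ?_
  simp [matchingEdge, torusEdgeReflection, torusPartner_planeReflection hL]

/-- At `x` there are `κ` pairings, and the edge of the matching at `x` has at most `K` links. -/
def SparseAt (hL : Even L) (j : Fin d) (κ K : ℕ) (k : (torusGraph d L).edgeSet → Fin N → ℕ)
    (x : Torus d L) : Prop :=
  RPM.closedTime k x = κ ∧ RPM.linkTotal k (matchingEdge hL j x) ≤ K

/-- The indicator function of the event that all vertices with label `true` are sparse. -/
def sparseIndicator (hL : Even L) (j : Fin d) (κ K : ℕ) (b : Torus d L → Bool)
    (k : (torusGraph d L).edgeSet → Fin N → ℕ) : ℝ :=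
  if ∀ x, b x = true → SparseAt hL j κ K k x then 1 else 0

/-- The random path model on the torus with the reflection in a plane. -/
def torusModel (hL : Even L) {v : (Fin d → ℤ) → ℝ} (hv : ∀ x, v (-x) = v x) (hsep : Separable v)
    (U : ℕ → ℝ≥0) {lam : ℝ} (hlam : 0 ≤ lam) (j : Fin d) (κ K : ℕ) (i : Fin d) (a : ZMod L) :
    RPM.ReflectionModel (torusGraph d L).edgeSet (Torus d L) (Fin N → ℕ) Bool where
  R := torusEdgeReflection hL i a
  θ := planeReflection i a
  θ_involutive := planeReflection_involutive i a
  H := planeHalf i a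
  half := planeHalf_planeReflection hL i a
  w m := ∏ c, lam ^ m c / (m c).factorial
  w_nonneg m := Finset.prod_nonneg fun c _ => by positivity
  φ b x k := (∏ c, (RPM.involCount (RPM.deg k x c) 0 : ℝ)) * (U (RPM.closedTime k x) : ℝ) *
    if b = true → SparseAt hL j κ K k x then 1 else 0
  φ_refl b x k := by
    have h : RPM.linkTotal k (matchingEdge hL j (planeReflection i a x)) =
        RPM.linkTotal (k ∘ (torusEdgeReflection hL i a).refl) (matchingEdge hL j x) := by
      rw [matchingEdge_planeReflection]
      rfl
    refine congrArg₂ (· * ·) ?_ (if_congr ?_ rfl rfl) <;>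
      simp only [SparseAt, RPM.closedTime, h, deg_planeReflection hL]
  φ_local b x k k' hx h := by
    have h1 := deg_congr_half hL i a hx h
    have h2 : RPM.linkTotal k (matchingEdge hL j x) = RPM.linkTotal k' (matchingEdge hL j x) := by
      rw [RPM.linkTotal, RPM.linkTotal, h _ (not_plus_of_mem hL i a hx (by simp [matchingEdge]))]
    refine congrArg₂ (· * ·) ?_ (if_congr ?_ rfl rfl) <;>
      simp only [SparseAt, RPM.closedTime, h1, h2]
  n x k := (RPM.closedTime k x : ℝ)
  n_refl x k := by simp only [RPM.closedTime, deg_planeReflection hL]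
  n_local x k k' hx h := by simp only [RPM.closedTime, deg_congr_half hL i a hx h]
  v := periodicPotential v L
  v_symm := periodicPotential_symm v hv
  v_refl := periodicPotential_planeReflection hL hv hsep i a

lemma torusModel_term (hL : Even L) {v : (Fin d → ℤ) → ℝ} (hv : ∀ x, v (-x) = v x)
    (hsep : Separable v) (U : ℕ → ℝ≥0) {lam : ℝ} (hlam : 0 ≤ lam) (j : Fin d) (κ K : ℕ)
    (i : Fin d) (a : ZMod L) (b : Torus d L → Bool)
    (k : (torusGraph d L).edgeSet → Fin N → ℕ) :
    (torusModel hL hv hsep U hlam j κ K i a).term b k =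
      RPM.closedWeight U (periodicPotential v L) lam k * sparseIndicator hL j κ K b k := by
  have h : ∏ x, (if b x = true → SparseAt hL j κ K k x then (1 : ℝ) else 0) =
      sparseIndicator hL j κ K b k := by
    rw [sparseIndicator, Finset.prod_ite_zero]
    simp
  rw [RPM.ReflectionModel.term, RPM.closedWeight, RPM.linkMass, RPM.gibbs, ← h]
  simp only [torusModel, Finset.prod_mul_distrib]
  ring

lemma sparseIndicator_nonneg (hL : Even L) (j : Fin d) (κ K : ℕ) (b : Torus d L → Bool)
    (k : (torusGraph d L).edgeSet → Fin N → ℕ) : 0 ≤ sparseIndicator hL j κ K b k := by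
  unfold sparseIndicator
  split_ifs <;> norm_num

lemma sparseIndicator_le_one (hL : Even L) (j : Fin d) (κ K : ℕ) (b : Torus d L → Bool)
    (k : (torusGraph d L).edgeSet → Fin N → ℕ) : sparseIndicator hL j κ K b k ≤ 1 := by
  unfold sparseIndicator
  split_ifs <;> norm_num

/-- The probability of sparseness at one vertex is bounded by the pressure of sparseness
everywhere. -/
theorem torus_chessboard (hL : Even L) {v : (Fin d → ℤ) → ℝ} (hv : ∀ x, v (-x) = v x)
    (hsep : Separable v) (U : ℕ → ℝ≥0) {lam : ℝ} (hlam : 0 ≤ lam) (j : Fin d) (κ K : ℕ)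
    (hs : Summable fun k : (torusGraph d L).edgeSet → Fin N → ℕ =>
      RPM.closedWeight U (periodicPotential v L) lam k)
    (hpos : 0 < ∑' k : (torusGraph d L).edgeSet → Fin N → ℕ,
      RPM.closedWeight U (periodicPotential v L) lam k) (x : Torus d L) :
    ((∑' k : (torusGraph d L).edgeSet → Fin N → ℕ,
        RPM.closedWeight U (periodicPotential v L) lam k *
          if SparseAt hL j κ K k x then 1 else 0) /
      ∑' k : (torusGraph d L).edgeSet → Fin N → ℕ,
        RPM.closedWeight U (periodicPotential v L) lam k) ^ Fintype.card (Torus d L) ≤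
    (∑' k : (torusGraph d L).edgeSet → Fin N → ℕ,
        RPM.closedWeight U (periodicPotential v L) lam k *
          if ∀ x, SparseAt hL j κ K k x then 1 else 0) /
      ∑' k : (torusGraph d L).edgeSet → Fin N → ℕ,
        RPM.closedWeight U (periodicPotential v L) lam k := by
  set W : ((torusGraph d L).edgeSet → Fin N → ℕ) → ℝ :=
    fun k => RPM.closedWeight U (periodicPotential v L) lam k with hW
  have hW0 : ∀ k, 0 ≤ W k := fun k => RPM.closedWeight_nonneg U _ hlam k
  have hsum : ∀ b, Summable fun k => W k * sparseIndicator hL j κ K b k := fun b =>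
    Summable.of_nonneg_of_le (fun k => mul_nonneg (hW0 k) (sparseIndicator_nonneg hL j κ K b k))
      (fun k => mul_le_of_le_one_right (hW0 k) (sparseIndicator_le_one hL j κ K b k)) hs
  let F : (Torus d L → Bool) → ℝ := fun b => ∑' k, W k * sparseIndicator hL j κ K b k
  have hF0 : F (fun _ => false) = ∑' k, W k := tsum_congr fun k => by simp [sparseIndicator]
  have hF1 : F (fun _ => true) = ∑' k, W k * if ∀ x, SparseAt hL j κ K k x then 1 else 0 :=
    tsum_congr fun k => by simp [sparseIndicator]
  have hFx : F (fun y => decide (y = x)) = ∑' k, W k * if SparseAt hL j κ K k x then 1 else 0 :=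
    tsum_congr fun k => by simp [sparseIndicator]
  have h := chessboard hL F
    (fun b => tsum_nonneg fun k => mul_nonneg (hW0 k) (sparseIndicator_nonneg hL j κ K b k))
    (fun b => (hsum _).tsum_le_tsum (fun k => mul_le_mul_of_nonneg_left (by
      unfold sparseIndicator
      split_ifs with h1 h2
      · exact le_rfl
      · exact absurd (fun x _ => h1 x rfl) h2
      · norm_num
      · exact le_rfl) (hW0 k)) (hsum _))
    (hF0 ▸ hpos) (fun i a b => by
      have h := (torusModel (N := N) hL hv hsep U hlam j κ K i a).sq_tsum_term_le
        (posSemidef_plane hL hsep i a) (fun b => by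
          have := hsum b
          refine this.congr fun k => ?_
          rw [torusModel_term]) b
      simp only [torusModel_term] at h
      exact h) x
  rwa [hF0, hF1, hFx] at h

end TorusModel

/-! ### Finiteness of the partition function -/

/-- The exponential series over a finite product of alphabets. -/
lemma hasSum_prod_prod_exp {ι κ : Type} [Fintype ι] [Fintype κ] (s : ι → κ → ℝ)
    (hs : ∀ e i, 0 ≤ s e i) :
    HasSum (fun k : ι → κ → ℕ => ∏ e, ∏ i, s e i ^ k e i / (k e i).factorial)
      (∏ e, ∏ i, Real.exp (s e i)) := by
  have h0 : ∀ k : ι → κ → ℕ, 0 ≤ ∏ e, ∏ i, s e i ^ k e i / (k e i).factorial := fun k =>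
    Finset.prod_nonneg fun e _ => Finset.prod_nonneg fun i _ =>
      div_nonneg (pow_nonneg (hs e i) _) (Nat.cast_nonneg _)
  have hE : ∀ e i, ∑' n : ℕ, ENNReal.ofReal (s e i ^ n / n.factorial) =
      ENNReal.ofReal (Real.exp (s e i)) := by
    intro e i
    have h := NormedSpace.expSeries_div_hasSum_exp (𝔸 := ℝ) (s e i)
    rw [← Real.exp_eq_exp_ℝ] at h
    rw [← h.tsum_eq, ENNReal.ofReal_tsum_of_nonneg
      (fun n => div_nonneg (pow_nonneg (hs e i) _) (Nat.cast_nonneg _)) h.summable]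
  have h1 : ∑' k : ι → κ → ℕ, ENNReal.ofReal (∏ e, ∏ i, s e i ^ k e i / (k e i).factorial) =
      ENNReal.ofReal (∏ e, ∏ i, Real.exp (s e i)) := by
    have h2 : ∀ k : ι → κ → ℕ, ENNReal.ofReal (∏ e, ∏ i, s e i ^ k e i / (k e i).factorial) =
        ∏ e, ∏ i, ENNReal.ofReal (s e i ^ k e i / (k e i).factorial) := by
      intro k
      rw [ENNReal.ofReal_prod_of_nonneg fun e _ => Finset.prod_nonneg fun i _ =>
        div_nonneg (pow_nonneg (hs e i) _) (Nat.cast_nonneg _)]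
      exact Finset.prod_congr rfl fun e _ => ENNReal.ofReal_prod_of_nonneg fun i _ =>
        div_nonneg (pow_nonneg (hs e i) _) (Nat.cast_nonneg _)
    simp_rw [h2]
    rw [ENNReal.tsum_pi_prod (fun _ : ι => κ → ℕ)
      fun e m => ∏ i, ENNReal.ofReal (s e i ^ m i / (m i).factorial)]
    rw [ENNReal.ofReal_prod_of_nonneg fun e _ => Finset.prod_nonneg fun i _ => (Real.exp_pos _).le]
    refine Finset.prod_congr rfl fun e _ => ?_
    rw [ENNReal.tsum_pi_prod (fun _ : κ => ℕ)
      fun i n => ENNReal.ofReal (s e i ^ n / n.factorial)]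
    rw [ENNReal.ofReal_prod_of_nonneg fun i _ => (Real.exp_pos _).le]
    exact Finset.prod_congr rfl fun i _ => hE e i
  have hP : 0 ≤ ∏ e, ∏ i, Real.exp (s e i) := by positivity
  have hsum : Summable fun k : ι → κ → ℕ => ∏ e, ∏ i, s e i ^ k e i / (k e i).factorial := by
    have := ENNReal.summable_toReal (f := fun k : ι → κ → ℕ =>
      ENNReal.ofReal (∏ e, ∏ i, s e i ^ k e i / (k e i).factorial))
      (by rw [h1]; exact ENNReal.ofReal_ne_top)
    exact this.congr fun k => by rw [ENNReal.toReal_ofReal (h0 k)]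
  rw [← ENNReal.ofReal_tsum_of_nonneg h0 hsum] at h1
  have h3 := (ENNReal.ofReal_eq_ofReal_iff (tsum_nonneg h0) hP).1 h1
  exact h3 ▸ hsum.hasSum

namespace RPM

variable {V : Type} [Fintype V] {G : SimpleGraph V} {N : ℕ}

lemma exists_edge_eq (e : G.edgeSet) : ∃ a b : V, a ≠ b ∧ (e : Sym2 V) = s(a, b) := by
  obtain ⟨e, he⟩ := e
  induction e with
  | _ a b => exact ⟨a, b, G.ne_of_adj he, rfl⟩

lemma prod_mem_edge {M : Type*} [CommMonoid M] (f : V → M) {e : Sym2 V} {a b : V} (hab : a ≠ b)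
    (he : e = s(a, b)) : (∏ x, if x ∈ e then f x else 1) = f a * f b := by
  rw [← Finset.prod_filter, ← Finset.prod_pair hab]
  congr 1
  ext x
  simp [he]

/-- Exchange of the product over vertices of powers of degrees with the product over edges. -/
lemma prod_pow_deg {M : Type*} [CommMonoid M] (z : V → Fin N → M) (k : G.edgeSet → Fin N → ℕ) :
    ∏ x, ∏ i, z x i ^ deg k x i =
      ∏ e : G.edgeSet, ∏ i, (∏ x, if x ∈ (e : Sym2 V) then z x i else 1) ^ k e i := by
  calc ∏ x, ∏ i, z x i ^ deg k x i
      = ∏ x, ∏ i, ∏ e : G.edgeSet, (if x ∈ (e : Sym2 V) then z x i else 1) ^ k e i := by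
        refine Finset.prod_congr rfl fun x _ => Finset.prod_congr rfl fun i _ => ?_
        rw [deg, ← Finset.prod_pow_eq_pow_sum]
        refine Finset.prod_congr rfl fun e _ => ?_
        split_ifs <;> simp
    _ = ∏ x, ∏ e : G.edgeSet, ∏ i, (if x ∈ (e : Sym2 V) then z x i else 1) ^ k e i :=
        Finset.prod_congr rfl fun x _ => Finset.prod_comm
    _ = ∏ e : G.edgeSet, ∏ x, ∏ i, (if x ∈ (e : Sym2 V) then z x i else 1) ^ k e i :=
        Finset.prod_comm
    _ = _ := by
        refine Finset.prod_congr rfl fun e _ => ?_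
        rw [Finset.prod_comm]
        exact Finset.prod_congr rfl fun i _ => Finset.prod_pow _ _ _

lemma sum_deg (k : G.edgeSet → Fin N → ℕ) :
    ∑ x, ∑ i, deg k x i = 2 * ∑ e, ∑ i, k e i := by
  -- The double counting of link ends is the multiplicative identity written in `Multiplicative ℕ`.
  have h := prod_pow_deg (M := Multiplicative ℕ) (fun _ _ => Multiplicative.ofAdd 1) k
  have h2 := congrArg Multiplicative.toAdd h
  simp only [toAdd_prod, toAdd_pow, toAdd_ofAdd, smul_eq_mul, mul_one] at h2
  rw [h2, Finset.mul_sum]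
  refine Finset.sum_congr rfl fun e _ => ?_
  rw [Finset.mul_sum]
  refine Finset.sum_congr rfl fun i _ => ?_
  obtain ⟨a, b, hab, he⟩ := exists_edge_eq e
  have h3 := congrArg Multiplicative.toAdd
    (prod_mem_edge (fun _ : V => Multiplicative.ofAdd 1) hab he)
  rw [toAdd_prod, toAdd_mul, toAdd_ofAdd] at h3
  rw [h3, mul_comm]

lemma two_mul_deg_div {k : G.edgeSet → Fin N → ℕ}
    (hk : ∏ x, ∏ i, (involCount (deg k x i) 0 : ℝ) ≠ 0) (x : V) (i : Fin N) :
    2 * (deg k x i / 2) = deg k x i := by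
  rw [Finset.prod_ne_zero_iff] at hk
  have h := Finset.prod_ne_zero_iff.1 (hk x (Finset.mem_univ _)) i (Finset.mem_univ _)
  exact Nat.two_mul_div_two_of_even (even_of_involCount_ne_zero (by exact_mod_cast h))

lemma sum_closedTime {k : G.edgeSet → Fin N → ℕ}
    (hk : ∏ x, ∏ i, (involCount (deg k x i) 0 : ℝ) ≠ 0) :
    ∑ x, closedTime k x = ∑ e, ∑ i, k e i := by
  have h := sum_deg k
  have h2 : ∑ x, ∑ i, deg k x i = 2 * ∑ x, closedTime k x := by
    simp only [closedTime, Finset.mul_sum]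
    exact Finset.sum_congr rfl fun x _ => Finset.sum_congr rfl fun i _ =>
      (two_mul_deg_div hk x i).symm
  omega

lemma linkMass_mul (lam B : ℝ) (k : G.edgeSet → Fin N → ℕ) :
    linkMass (lam * B) k = linkMass lam k * B ^ ∑ e, ∑ i, k e i := by
  simp only [linkMass, ← Finset.prod_pow_eq_pow_sum, ← Finset.prod_mul_distrib]
  refine Finset.prod_congr rfl fun e _ => Finset.prod_congr rfl fun i _ => ?_
  rw [mul_pow]
  ring

lemma summable_linkMass {lam : ℝ} (hlam : 0 ≤ lam) :
    Summable fun k : G.edgeSet → Fin N → ℕ => linkMass lam k :=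
  (hasSum_prod_prod_exp (fun (_ : G.edgeSet) (_ : Fin N) => lam) fun _ _ => hlam).summable

/-- Stability turns the energy into a factor exp(-β n_x²) at each vertex. The number of pairings
there is at most 2^n n!. By `hU` what remains is A B^n, and the local times add up to the number of
links, so B can be absorbed into λ. -/
lemma closedWeight_le (U : ℕ → ℝ≥0) (v : V → V → ℝ) {lam β A B : ℝ} (hlam : 0 ≤ lam)
    (hv : ∀ n : V → ℝ, (∀ x, 0 ≤ n x) → β * ∑ x, n x ^ 2 ≤ ∑ x, ∑ y, v x y * n x * n y)
    (hA : 0 ≤ A) (hB : 0 ≤ B)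
    (hU : ∀ n : ℕ, (U n : ℝ) * Real.exp (-(β * (n : ℝ) ^ 2)) * (2 ^ n * n.factorial) ≤ A * B ^ n)
    (k : G.edgeSet → Fin N → ℕ) :
    closedWeight U v lam k ≤ A ^ Fintype.card V * linkMass (lam * B) k := by
  by_cases hk : ∏ x, ∏ i, (involCount (deg k x i) 0 : ℝ) = 0
  · rw [closedWeight, hk, mul_zero, zero_mul]
    exact mul_nonneg (pow_nonneg hA _) (linkMass_nonneg (mul_nonneg hlam hB) k)
  have h1 : ∀ x, ∏ i, (involCount (deg k x i) 0 : ℝ) ≤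
      2 ^ closedTime k x * (closedTime k x).factorial := by
    intro x
    calc ∏ i, (involCount (deg k x i) 0 : ℝ)
        ≤ ∏ i, (2 ^ (deg k x i / 2) * (deg k x i / 2).factorial : ℝ) := by
          refine Finset.prod_le_prod (fun _ _ => Nat.cast_nonneg _) fun i _ => ?_
          have := involCount_two_mul_le (deg k x i / 2)
          rw [two_mul_deg_div hk] at this
          exact_mod_cast this
      _ = 2 ^ closedTime k x * ((∏ i, (deg k x i / 2).factorial : ℕ) : ℝ) := by
          rw [Finset.prod_mul_distrib, Finset.prod_pow_eq_pow_sum, closedTime]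
          push_cast
          rfl
      _ ≤ _ := by
          refine mul_le_mul_of_nonneg_left ?_ (by positivity)
          exact_mod_cast Nat.le_of_dvd (Nat.factorial_pos _)
            (Nat.prod_factorial_dvd_factorial_sum _ _)
  have h2 : gibbs U v (closedTime k) ≤
      ∏ x, ((U (closedTime k x) : ℝ) * Real.exp (-(β * (closedTime k x : ℝ) ^ 2))) := by
    rw [Finset.prod_mul_distrib, gibbs, ← Real.exp_sum]
    refine mul_le_mul_of_nonneg_left (Real.exp_le_exp.2 ?_) (by positivity)
    rw [Finset.sum_neg_distrib, ← Finset.mul_sum]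
    exact neg_le_neg (hv (fun x => closedTime k x) fun x => Nat.cast_nonneg _)
  calc closedWeight U v lam k
      ≤ linkMass lam k * (∏ x, (2 ^ closedTime k x * (closedTime k x).factorial : ℝ)) *
          ∏ x, ((U (closedTime k x) : ℝ) * Real.exp (-(β * (closedTime k x : ℝ) ^ 2))) := by
        have := linkMass_nonneg hlam k
        have := gibbs_nonneg U v (closedTime k)
        unfold closedWeight
        gcongr with x
        exact h1 x
    _ = linkMass lam k * ∏ x, ((U (closedTime k x) : ℝ) *
          Real.exp (-(β * (closedTime k x : ℝ) ^ 2)) *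
          (2 ^ closedTime k x * (closedTime k x).factorial)) := by
        rw [mul_assoc, ← Finset.prod_mul_distrib]
        congr 1
        exact Finset.prod_congr rfl fun x _ => mul_comm _ _
    _ ≤ linkMass lam k * ∏ x, (A * B ^ closedTime k x) := by
        refine mul_le_mul_of_nonneg_left ?_ (linkMass_nonneg hlam k)
        exact Finset.prod_le_prod (fun x _ => by positivity) fun x _ => hU _
    _ = A ^ Fintype.card V * linkMass (lam * B) k := by
        rw [Finset.prod_mul_distrib, Finset.prod_const, Finset.prod_pow_eq_pow_sum,
          sum_closedTime hk, linkMass_mul, Finset.card_univ]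
        ring

/-- A growth rate of 4 per link only replaces λB by 4λB, and the resulting series is a product of
exponential series. -/
lemma summable_closedWeight_mul (U : ℕ → ℝ≥0) (v : V → V → ℝ) {lam β A B : ℝ} (hlam : 0 ≤ lam)
    (hv : ∀ n : V → ℝ, (∀ x, 0 ≤ n x) → β * ∑ x, n x ^ 2 ≤ ∑ x, ∑ y, v x y * n x * n y)
    (hA : 0 ≤ A) (hB : 0 ≤ B)
    (hU : ∀ n : ℕ, (U n : ℝ) * Real.exp (-(β * (n : ℝ) ^ 2)) * (2 ^ n * n.factorial) ≤ A * B ^ n)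
    (f : (G.edgeSet → Fin N → ℕ) → ℝ) (hf : ∀ k, |f k| ≤ 4 ^ ∑ e, ∑ i, k e i) :
    Summable fun k => closedWeight U v lam k * f k := by
  refine Summable.of_norm_bounded ((summable_linkMass (G := G) (N := N)
    (lam := lam * B * 4) (by positivity)).mul_left (A ^ Fintype.card V)) fun k => ?_
  rw [linkMass_mul, Real.norm_eq_abs, abs_mul, abs_of_nonneg (closedWeight_nonneg U v hlam k),
    ← mul_assoc]
  exact mul_le_mul (closedWeight_le U v hlam hv hA hB hU k) (hf k) (abs_nonneg _)
    (mul_nonneg (pow_nonneg hA _) (linkMass_nonneg (mul_nonneg hlam hB) k))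

lemma linkTotal_le (k : G.edgeSet → Fin N → ℕ) (e : G.edgeSet) :
    linkTotal k e ≤ ∑ e, ∑ i, k e i :=
  Finset.single_le_sum (f := linkTotal k) (fun _ _ => Nat.zero_le _) (Finset.mem_univ e)

lemma le_linkTotal (k : G.edgeSet → Fin N → ℕ) (e : G.edgeSet) (i : Fin N) :
    k e i ≤ linkTotal k e :=
  Finset.single_le_sum (f := k e) (fun _ _ => Nat.zero_le _) (Finset.mem_univ i)

lemma sq_linkTotal_le (k : G.edgeSet → Fin N → ℕ) (e : G.edgeSet) :
    linkTotal k e ^ 2 ≤ 4 ^ ∑ e, ∑ i, k e i := by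
  calc linkTotal k e ^ 2 ≤ (2 ^ ∑ e, ∑ i, k e i) ^ 2 :=
        Nat.pow_le_pow_left ((linkTotal_le k e).trans Nat.lt_two_pow_self.le) 2
    _ = 4 ^ ∑ e, ∑ i, k e i := by rw [← pow_mul, mul_comm, pow_mul]; norm_num

end RPM

/-- The growth of good weight functions. -/
lemma Good.exists_bound {d : ℕ} {v : (Fin d → ℤ) → ℝ} {U : ℕ → ℝ≥0} (hU : Good v U) :
    ∃ A B : ℝ, 0 ≤ A ∧ 0 ≤ B ∧ ∀ n : ℕ,
      (U n : ℝ) * Real.exp (-(vbar v * (n : ℝ) ^ 2)) * (2 ^ n * n.factorial) ≤ A * B ^ n := by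
  obtain ⟨C, hC⟩ := hU
  set u : ℕ → ℝ := fun n => (U n : ℝ) * Real.exp (-(vbar v * (n : ℝ) ^ 2)) with hu
  have hu0 : ∀ n, 0 ≤ u n := fun n => by positivity
  have hC' : ∀ n : ℕ, (n : ℝ) * u (n + 1) ≤ max C 1 * u n := fun n =>
    (hC n).trans (mul_le_mul_of_nonneg_right (le_max_left _ _) (hu0 n))
  have hD : (1 : ℝ) ≤ max C 1 := le_max_right _ _
  set D := max C 1
  have h1 : ∀ n : ℕ, u (n + 1) * (2 ^ (n + 1) * (n + 1).factorial) ≤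
      max (u 0) (u 1) * (4 * D) ^ (n + 1) := by
    intro n
    induction n with
    | zero =>
      have h1 : u 1 ≤ max (u 0) (u 1) := le_max_right _ _
      have h2 := hu0 1
      simp only [zero_add, pow_one, Nat.factorial_one, Nat.cast_one, mul_one]
      nlinarith
    | succ n ih =>
      -- Goodness controls (n+1) u(n+2), and n + 2 ≤ 2(n+1). At n = 0 it says nothing about u(1),
      -- which is why u(1) enters the constant A.
      have h2 : ((n + 2 : ℕ) : ℝ) * u (n + 2) ≤ 2 * D * u (n + 1) := by
        have h3 := hC' (n + 1)
        have h4 := hu0 (n + 2)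
        push_cast at h3 ⊢
        have h5 : (0 : ℝ) ≤ n * u (n + 2) := by positivity
        linarith
      calc u (n + 2) * (2 ^ (n + 2) * (n + 2).factorial)
          = ((n + 2 : ℕ) : ℝ) * u (n + 2) * (2 * (2 ^ (n + 1) * (n + 1).factorial)) := by
            rw [Nat.factorial_succ (n + 1)]
            push_cast
            ring
        _ ≤ 2 * D * u (n + 1) * (2 * (2 ^ (n + 1) * (n + 1).factorial)) := by gcongr
        _ = (4 * D) * (u (n + 1) * (2 ^ (n + 1) * (n + 1).factorial)) := by ring
        _ ≤ (4 * D) * (max (u 0) (u 1) * (4 * D) ^ (n + 1)) := by gcongr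
        _ = _ := by ring
  refine ⟨max (u 0) (u 1), 4 * D, (hu0 0).trans (le_max_left _ _), by positivity, fun n => ?_⟩
  cases n with
  | zero => simp [hu]
  | succ n => exact h1 n

/-! ### The matchings of a factorization -/

namespace MatchingFactorization

variable {V J : Type} {G : SimpleGraph V} (Φ : MatchingFactorization G J)

/-- The edge of the matching `j` at `x`. -/
def edge (j : J) (x : V) : G.edgeSet := ⟨s(x, Φ.p j x), Φ.adj j x⟩

lemma exists_edge_eq (e : G.edgeSet) : ∃ j x, Φ.edge j x = e := by
  obtain ⟨e, he⟩ := e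
  induction e with
  | _ a b =>
    obtain ⟨j, hj⟩ := Φ.surjective a b he
    exact ⟨j, a, Subtype.ext (by simp [edge, hj])⟩

/-- The matching which contains the edge `e`. -/
def label (e : G.edgeSet) : J := (Φ.exists_edge_eq e).choose

lemma label_edge (j : J) (x : V) : Φ.label (Φ.edge j x) = j := by
  obtain ⟨y, hy⟩ := (Φ.exists_edge_eq (Φ.edge j x)).choose_spec
  change Φ.edge (Φ.label (Φ.edge j x)) y = _ at hy
  have h := congrArg Subtype.val hy
  simp only [edge, Sym2.eq_iff] at h
  rcases h with ⟨rfl, h⟩ | ⟨h1, h2⟩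
  · exact Φ.injective _ h
  · subst h1
    refine Φ.injective (Φ.p j x) ?_
    exact h2.trans (Φ.involutive j x).symm

lemma eq_edge_label {e : G.edgeSet} {x : V} (hx : x ∈ (e : Sym2 V)) :
    Φ.edge (Φ.label e) x = e := by
  obtain ⟨j, y, rfl⟩ := Φ.exists_edge_eq e
  rw [label_edge]
  refine Subtype.ext ?_
  simp only [edge, Sym2.mem_iff] at hx ⊢
  rcases hx with rfl | rfl
  · rfl
  · rw [Φ.involutive, Sym2.eq_swap]

lemma mem_edge (j : J) (x : V) : x ∈ (Φ.edge j x : Sym2 V) := by simp [edge]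

variable [Fintype V] [Fintype J]

lemma prod_incident {M : Type*} [CommMonoid M] (x : V) (h : G.edgeSet → M) :
    (∏ e : G.edgeSet, if x ∈ (e : Sym2 V) then h e else 1) = ∏ j, h (Φ.edge j x) := by
  rw [← Finset.prod_filter]
  refine (Finset.prod_nbij (fun j => Φ.edge j x) (fun j _ => by simp [mem_edge])
    (fun j _ j' _ h => by
      have h' : Φ.edge j x = Φ.edge j' x := h
      rw [← Φ.label_edge j x, h', Φ.label_edge]) (fun e he => ?_)
    fun _ _ => rfl).symm
  exact ⟨Φ.label e, by simp, Φ.eq_edge_label (by simpa using he)⟩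

/-- Each edge is met once from each of its two endpoints. Working with squares avoids half the
number of vertices as an exponent. -/
lemma prod_sq {M : Type*} [CommMonoid M] (h : G.edgeSet → M) :
    (∏ e, h e) ^ 2 = ∏ x, ∏ j, h (Φ.edge j x) := by
  simp_rw [← Φ.prod_incident]
  rw [Finset.prod_comm, ← Finset.prod_pow]
  refine Finset.prod_congr rfl fun e _ => ?_
  obtain ⟨a, b, hab, he⟩ := RPM.exists_edge_eq e
  rw [RPM.prod_mem_edge _ hab he, sq]

lemma prod_label_sq {M : Type*} [CommMonoid M] (h : J → M) :
    (∏ e, h (Φ.label e)) ^ 2 = (∏ j, h j) ^ Fintype.card V := by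
  rw [Φ.prod_sq]
  simp [label_edge]

end MatchingFactorization

/-! ### Estimates of factorials -/

/-- The Stirling sequence decreases from its first term e/√2, and the remaining √n is estimated
crudely by n. -/
lemma factorial_le_mul_div_exp_pow (n : ℕ) :
    (n.factorial : ℝ) ≤ Real.exp 1 * (n + 1) * (n / Real.exp 1) ^ n := by
  cases n with
  | zero => simp
  | succ n =>
    have h := Stirling.stirlingSeq'_antitone (Nat.zero_le n)
    simp only [Function.comp, Nat.succ_eq_add_one, zero_add, Stirling.stirlingSeq_one] at h
    rw [Stirling.stirlingSeq, div_le_iff₀ (by positivity)] at h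
    refine h.trans ?_
    rw [← mul_assoc]
    refine mul_le_mul_of_nonneg_right ?_ (by positivity)
    rw [div_mul_eq_mul_div, mul_div_assoc]
    refine mul_le_mul_of_nonneg_left ?_ (Real.exp_pos _).le
    rw [Real.sqrt_mul (by norm_num), mul_div_cancel_left₀ _ (by positivity)]
    have h1 : √((n + 1 : ℕ) : ℝ) ≤ (n + 1 : ℕ) := by
      rw [Real.sqrt_le_left (by positivity)]
      push_cast
      nlinarith [(Nat.cast_nonneg n : (0 : ℝ) ≤ n)]
    linarith

/-- The largest term of the multinomial expansion. -/
lemma exists_prod_factorial_le (J : Type) [Fintype J] (n : ℕ) (hJ : 0 < Fintype.card J) :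
    ∃ t : J → ℕ, ∑ j, t j = n ∧
      (∏ j, (t j).factorial) * Fintype.card J ^ n ≤ n.factorial * (n + 1) ^ Fintype.card J := by
  have h := Finset.sum_pow_eq_sum_piAntidiag (Finset.univ : Finset J) (fun _ => (1 : ℕ)) n
  simp only [Finset.sum_const, Finset.card_univ, smul_eq_mul, mul_one, one_pow,
    Finset.prod_const_one] at h
  have hcard : (Finset.piAntidiag (Finset.univ : Finset J) n).card ≤ (n + 1) ^ Fintype.card J := by
    have h1 : Finset.piAntidiag (Finset.univ : Finset J) n ⊆
        Fintype.piFinset fun _ => Finset.range (n + 1) := by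
      intro t ht
      rw [Finset.mem_piAntidiag] at ht
      rw [Fintype.mem_piFinset]
      intro j
      rw [Finset.mem_range, Nat.lt_succ_iff, ← ht.1]
      exact Finset.single_le_sum (fun _ _ => Nat.zero_le _) (Finset.mem_univ j)
    simpa using Finset.card_le_card h1
  have hne : (Finset.piAntidiag (Finset.univ : Finset J) n).Nonempty := by
    by_contra hne
    rw [Finset.not_nonempty_iff_eq_empty] at hne
    rw [hne, Finset.sum_empty] at h
    exact absurd h (pow_pos hJ n).ne'
  obtain ⟨t, ht, hmax⟩ := Finset.exists_max_image _
    (fun t => Nat.multinomial (Finset.univ : Finset J) t) hne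
  have ht' := (Finset.mem_piAntidiag.1 ht).1
  refine ⟨t, ht', ?_⟩
  -- |J|^n is a sum of at most (n+1)^|J| multinomial coefficients, so the largest is at least the
  -- average.
  have h2 : Fintype.card J ^ n ≤ (n + 1) ^ Fintype.card J * Nat.multinomial Finset.univ t := by
    rw [h]
    refine (Finset.sum_le_card_nsmul _ _ _ hmax).trans ?_
    rw [smul_eq_mul]
    exact Nat.mul_le_mul_right _ hcard
  calc (∏ j, (t j).factorial) * Fintype.card J ^ n
      ≤ (∏ j, (t j).factorial) * ((n + 1) ^ Fintype.card J * Nat.multinomial Finset.univ t) :=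
        Nat.mul_le_mul_left _ h2
    _ = (∏ j, (t j).factorial) * Nat.multinomial Finset.univ t * (n + 1) ^ Fintype.card J := by
        ring
    _ = _ := by rw [Nat.multinomial_spec, ht']

namespace RPM

/-- The number of pairings of `2 κ` elements, compared with the factorial. -/
lemma factorial_le_involCount_sq (κ : ℕ) :
    (2 * κ).factorial ≤ (2 * κ + 1) * involCount (2 * κ) 0 ^ 2 := by
  have h1 := involCount_two_mul κ
  have h2 : 4 ^ κ ≤ (2 * κ + 1) * Nat.centralBinom κ := by
    rcases Nat.eq_zero_or_pos κ with rfl | h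
    · simp
    · have := Nat.four_pow_le_two_mul_self_mul_centralBinom κ h
      nlinarith
  have h3 : Nat.centralBinom κ * (κ.factorial * κ.factorial) = (2 * κ).factorial := by
    have := Nat.choose_mul_factorial_mul_factorial (show κ ≤ 2 * κ by omega)
    rw [show 2 * κ - κ = κ by omega] at this
    rw [Nat.centralBinom_eq_two_mul_choose, ← mul_assoc, this]
  have hpos : 0 < 4 ^ κ * (κ.factorial * κ.factorial) := by positivity
  refine Nat.le_of_mul_le_mul_left ?_ hpos
  calc 4 ^ κ * (κ.factorial * κ.factorial) * (2 * κ).factorial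
      ≤ (2 * κ + 1) * Nat.centralBinom κ * (κ.factorial * κ.factorial) * (2 * κ).factorial := by
        gcongr
    _ = (2 * κ + 1) * (2 * κ).factorial ^ 2 := by rw [mul_assoc (2 * κ + 1), h3]; ring
    _ = (2 * κ + 1) * (involCount (2 * κ) 0 * (2 ^ κ * κ.factorial)) ^ 2 := by rw [h1]
    _ = _ := by
        rw [show (4 : ℕ) = 2 ^ 2 by norm_num, ← pow_mul, mul_comm 2 κ, pow_mul]
        ring

lemma involCount_le_exp (c : ℕ) :
    (involCount (2 * c) 0 : ℝ) ≤ Real.exp 1 * (c + 1) * (2 * c / Real.exp 1) ^ c := by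
  calc (involCount (2 * c) 0 : ℝ) ≤ 2 ^ c * c.factorial := by exact_mod_cast involCount_two_mul_le c
    _ ≤ 2 ^ c * (Real.exp 1 * (c + 1) * (c / Real.exp 1) ^ c) := by
        gcongr
        exact factorial_le_mul_div_exp_pow c
    _ = _ := by rw [mul_div_assoc, mul_pow]; ring

variable {N : ℕ}

/-- The number of pairings of links with given colour degrees. -/
lemma prod_involCount_le {κ : ℕ} (c : Fin N → ℕ) (hc : ∑ i, c i = κ) :
    ∏ i, (involCount (2 * c i) 0 : ℝ) ≤
      (Real.exp 1 * (κ + 1)) ^ N * (2 * κ / Real.exp 1) ^ κ * ∏ i, √(c i / κ) ^ (2 * c i) := by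
  calc ∏ i, (involCount (2 * c i) 0 : ℝ)
      ≤ ∏ i, ((Real.exp 1 * (κ + 1)) * (2 * κ / Real.exp 1) ^ c i * √(c i / κ) ^ (2 * c i)) := by
        refine Finset.prod_le_prod (fun _ _ => Nat.cast_nonneg _) fun i _ => ?_
        have hle : c i ≤ κ := hc ▸ Finset.single_le_sum (fun _ _ => Nat.zero_le _)
          (Finset.mem_univ i)
        refine (involCount_le_exp (c i)).trans ?_
        rw [pow_mul, Real.sq_sqrt (by positivity), mul_assoc (Real.exp 1 * _), ← mul_pow]
        have h1 : (2 * κ / Real.exp 1 * (c i / κ) : ℝ) ^ c i = (2 * c i / Real.exp 1) ^ c i := by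
          rcases Nat.eq_zero_or_pos κ with h | h
          · rw [show c i = 0 by omega]
            simp
          · congr 1
            field_simp
        rw [h1]
        gcongr
    _ = _ := by
        rw [Finset.prod_mul_distrib, Finset.prod_mul_distrib, Finset.prod_const,
          Finset.prod_pow_eq_pow_sum, hc]
        simp

end RPM

/-! ### Bounds for homogeneous local times -/

namespace RPM

variable {V J : Type} [Fintype V] [Fintype J] {G : SimpleGraph V} {N : ℕ}

lemma gibbs_const (U : ℕ → ℝ≥0) (v : V → V → ℝ) (κ : ℕ) :
    gibbs U v (fun _ => κ) =
      (U κ : ℝ) ^ Fintype.card V * Real.exp (-((κ : ℝ) ^ 2 * ∑ x, ∑ y, v x y)) := by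
  rw [gibbs, Finset.prod_const, Finset.card_univ]
  congr 3
  simp only [Finset.mul_sum]
  exact Finset.sum_congr rfl fun x _ => Finset.sum_congr rfl fun y _ => by ring

/-- This is the trial configuration of the lower bound: all links have one colour, and their number
is constant on every matching. The local time is then κ at all vertices. -/
lemma sq_closedWeight_label (Φ : MatchingFactorization G J) (U : ℕ → ℝ≥0) (v : V → V → ℝ)
    (lam : ℝ) {κ : ℕ} (t : J → ℕ) (ht : ∑ j, t j = 2 * κ) (i₀ : Fin N) :
    closedWeight U v lam (fun (e : G.edgeSet) i => if i = i₀ then t (Φ.label e) else 0) ^ 2 =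
      ((∏ j, lam ^ t j / (t j).factorial) * (involCount (2 * κ) 0 : ℝ) ^ 2 * (U κ : ℝ) ^ 2) ^
        Fintype.card V * Real.exp (-((κ : ℝ) ^ 2 * ∑ x, ∑ y, v x y)) ^ 2 := by
  set k : G.edgeSet → Fin N → ℕ := fun e i => if i = i₀ then t (Φ.label e) else 0 with hk
  have hdeg : ∀ x i, deg k x i = if i = i₀ then 2 * κ else 0 := by
    intro x i
    rw [deg]
    by_cases hi : i = i₀
    · have h := Φ.prod_incident (M := Multiplicative ℕ) x
        fun e => Multiplicative.ofAdd (t (Φ.label e))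
      have h2 := congrArg Multiplicative.toAdd h
      simp only [toAdd_prod, Φ.label_edge, toAdd_ofAdd, ht] at h2
      rw [if_pos hi, ← h2]
      refine Finset.sum_congr rfl fun e _ => ?_
      split_ifs <;> simp [hk, hi]
    · simp [hk, hi]
  have htime : closedTime k = fun _ => κ := by
    funext x
    rw [closedTime, Finset.sum_eq_single i₀]
    · simp [hdeg]
    · intro i _ hi
      simp [hdeg, hi]
    · simp
  have hinv : ∀ x, ∏ i, (involCount (deg k x i) 0 : ℝ) = involCount (2 * κ) 0 := by
    intro x
    rw [Finset.prod_eq_single i₀]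
    · simp [hdeg]
    · intro i _ hi
      simp [hdeg, hi, involCount_zero_zero]
    · simp
  have hmass : linkMass lam k = ∏ e, lam ^ t (Φ.label e) / (t (Φ.label e)).factorial := by
    refine Finset.prod_congr rfl fun e _ => ?_
    rw [Finset.prod_eq_single i₀]
    · simp [hk]
    · intro i _ hi
      simp [hk, hi]
    · simp
  rw [closedWeight, htime, gibbs_const, hmass]
  simp only [hinv, Finset.prod_const, Finset.card_univ]
  rw [mul_pow, mul_pow, Φ.prod_label_sq fun j => lam ^ t j / (t j).factorial]
  ring

/-- Lower bound for the partition function. -/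
lemma le_sq_tsum_closedWeight (Φ : MatchingFactorization G J) (U : ℕ → ℝ≥0) (v : V → V → ℝ)
    {lam : ℝ} (hlam : 0 ≤ lam) (hN : 0 < N) (hJ : 0 < Fintype.card J) (κ : ℕ)
    (hs : Summable fun k : G.edgeSet → Fin N → ℕ => closedWeight U v lam k) :
    (lam ^ (2 * κ) * (U κ : ℝ) ^ 2 * (Fintype.card J : ℝ) ^ (2 * κ) /
        (2 * κ + 1) ^ (Fintype.card J + 1)) ^ Fintype.card V *
      Real.exp (-((κ : ℝ) ^ 2 * ∑ x, ∑ y, v x y)) ^ 2 ≤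
    (∑' k : G.edgeSet → Fin N → ℕ, closedWeight U v lam k) ^ 2 := by
  obtain ⟨t, ht, hle⟩ := exists_prod_factorial_le J (2 * κ) hJ
  refine le_trans ?_ (pow_le_pow_left₀ (closedWeight_nonneg U v hlam _)
    (hs.le_tsum (fun (e : G.edgeSet) i => if i = (⟨0, hN⟩ : Fin N) then t (Φ.label e) else 0)
      fun k _ => closedWeight_nonneg U v hlam k) 2)
  rw [sq_closedWeight_label Φ U v lam t ht]
  refine mul_le_mul_of_nonneg_right (pow_le_pow_left₀ (by positivity) ?_ _) (by positivity)
  rw [Finset.prod_div_distrib, Finset.prod_pow_eq_pow_sum, ht, div_mul_eq_mul_div,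
    div_mul_eq_mul_div, div_le_div_iff₀ (by positivity)
      (Finset.prod_pos fun j _ => Nat.cast_pos.2 (Nat.factorial_pos _))]
  have h1 : ((2 * κ).factorial : ℝ) ≤ (2 * κ + 1) * (involCount (2 * κ) 0 : ℝ) ^ 2 := by
    exact_mod_cast factorial_le_involCount_sq κ
  have h2 : (∏ j, ((t j).factorial : ℝ)) * (Fintype.card J : ℝ) ^ (2 * κ) ≤
      (2 * κ).factorial * (2 * κ + 1) ^ Fintype.card J := by exact_mod_cast hle
  calc lam ^ (2 * κ) * (U κ : ℝ) ^ 2 * (Fintype.card J : ℝ) ^ (2 * κ) *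
        ∏ j, ((t j).factorial : ℝ)
      = lam ^ (2 * κ) * (U κ : ℝ) ^ 2 *
        ((∏ j, ((t j).factorial : ℝ)) * (Fintype.card J : ℝ) ^ (2 * κ)) := by ring
    _ ≤ lam ^ (2 * κ) * (U κ : ℝ) ^ 2 *
        (((2 * κ + 1) * (involCount (2 * κ) 0 : ℝ) ^ 2) * (2 * κ + 1) ^ Fintype.card J) := by
        refine mul_le_mul_of_nonneg_left (h2.trans ?_) (by positivity)
        gcongr
    _ = _ := by ring

/-- Upper bound for a configuration of link numbers in terms of tilted exponential weights. -/
lemma linkMass_mul_involCount_le (Φ : MatchingFactorization G J) (j₀ : J) {lam r : ℝ}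
    (hlam : 0 ≤ lam) (hr : 1 ≤ r) {κ K : ℕ} (k : G.edgeSet → Fin N → ℕ)
    (hk : ∏ x, ∏ i, (involCount (deg k x i) 0 : ℝ) ≠ 0) (htime : ∀ x, closedTime k x = κ)
    (hK : ∀ x, linkTotal k (Φ.edge j₀ x) ≤ K) :
    linkMass lam k * ∏ x, ∏ i, (involCount (deg k x i) 0 : ℝ) ≤
      ((lam / r) ^ κ * ((Real.exp 1 * (κ + 1)) ^ N * (2 * κ / Real.exp 1) ^ κ)) ^ Fintype.card V *
      ((∏ e, if Φ.label e = j₀ then r ^ K else 1) *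
        ∏ e : G.edgeSet, ∏ i, ((if Φ.label e = j₀ then 1 else r) *
          ∏ x, if x ∈ (e : Sym2 V) then √((deg k x i / 2 : ℕ) / κ) else 1) ^ k e i /
            (k e i).factorial) := by
  have hr0 : 0 < r := by linarith
  -- There are exactly κ|V| links, so λ may be replaced by any r at the price of the fixed factor
  -- (λ/r)^(κ|V|).
  have h1 : linkMass lam k = (lam / r) ^ (κ * Fintype.card V) * linkMass r k := by
    have h := linkMass_mul r (lam / r) k
    rw [mul_div_cancel₀ _ hr0.ne'] at h
    rw [h, ← sum_closedTime hk]
    simp only [htime, Finset.sum_const, Finset.card_univ, smul_eq_mul]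
    rw [mul_comm κ, mul_comm]
  -- With c_i half the degree of colour i at x, the factor (c_i/κ)^(c_i) is split among the ends of
  -- the links: every end receives √(c_i/κ).
  have h2 : ∏ x, ∏ i, (involCount (deg k x i) 0 : ℝ) ≤
      ((Real.exp 1 * (κ + 1)) ^ N * (2 * κ / Real.exp 1) ^ κ) ^ Fintype.card V *
      ∏ e : G.edgeSet, ∏ i, (∏ x, if x ∈ (e : Sym2 V) then
        √((deg k x i / 2 : ℕ) / κ) else 1) ^ k e i := by
    rw [← prod_pow_deg fun x i => √(((deg k x i / 2 : ℕ) : ℝ) / κ), ← Finset.card_univ,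
      ← Finset.prod_const, ← Finset.prod_mul_distrib]
    refine Finset.prod_le_prod (fun _ _ => by positivity) fun x _ => ?_
    have h := prod_involCount_le (fun i => deg k x i / 2) (htime x)
    simp only [two_mul_deg_div hk] at h
    exact h
  -- On the sparse matching r^m is at most r^K, which frees the sum over its links from the large
  -- parameter r.
  have h3 : linkMass r k ≤ (∏ e, if Φ.label e = j₀ then r ^ K else 1) *
      ∏ e, ∏ i, (if Φ.label e = j₀ then 1 else r) ^ k e i / (k e i).factorial := by
    rw [← Finset.prod_mul_distrib]
    refine Finset.prod_le_prod (fun e _ => by positivity) fun e _ => ?_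
    by_cases he : Φ.label e = j₀
    · simp only [if_pos he, one_pow, Finset.prod_div_distrib, Finset.prod_const_one,
        Finset.prod_pow_eq_pow_sum]
      rw [mul_one_div]
      gcongr
      obtain ⟨a, b, -, hab⟩ := exists_edge_eq e
      have h4 : Φ.edge j₀ a = e := he ▸ Φ.eq_edge_label (by rw [hab]; simp)
      exact h4 ▸ hK a
    · simp [he]
  rw [h1]
  calc (lam / r) ^ (κ * Fintype.card V) * linkMass r k *
        ∏ x, ∏ i, (involCount (deg k x i) 0 : ℝ)
      ≤ (lam / r) ^ (κ * Fintype.card V) * ((∏ e, if Φ.label e = j₀ then r ^ K else 1) *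
          ∏ e, ∏ i, (if Φ.label e = j₀ then 1 else r) ^ k e i / (k e i).factorial) *
        (((Real.exp 1 * (κ + 1)) ^ N * (2 * κ / Real.exp 1) ^ κ) ^ Fintype.card V *
          ∏ e : G.edgeSet, ∏ i, (∏ x, if x ∈ (e : Sym2 V) then
            √((deg k x i / 2 : ℕ) / κ) else 1) ^ k e i) := by
        refine mul_le_mul (mul_le_mul_of_nonneg_left h3 (by positivity)) h2 (by positivity) ?_
        refine mul_nonneg (by positivity) (mul_nonneg ?_ ?_) <;>
          refine Finset.prod_nonneg fun e _ => ?_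
        · split_ifs <;> positivity
        · refine Finset.prod_nonneg fun i _ => ?_
          split_ifs <;> positivity
    _ = _ := by
        have h5 : ∀ e : G.edgeSet, ∀ i, ((if Φ.label e = j₀ then 1 else r) *
            ∏ x, if x ∈ (e : Sym2 V) then √((deg k x i / 2 : ℕ) / κ) else 1) ^ k e i /
            (k e i).factorial = ((if Φ.label e = j₀ then 1 else r) ^ k e i / (k e i).factorial) *
            (∏ x, if x ∈ (e : Sym2 V) then √((deg k x i / 2 : ℕ) / κ) else 1) ^ k e i := by
          intro e i
          rw [mul_pow]
          ring
        simp only [h5, Finset.prod_mul_distrib]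
        rw [mul_pow _ _ (Fintype.card V), ← pow_mul]
        ring

/-- At each vertex the proportions c_i/κ sum to at most 1, and by the inequality of the means so do
the sums over colours of the products for the two endpoints of an edge. -/
lemma sum_prod_sqrt_le {κ : ℕ} (c : V → Fin N → ℕ) (hc : ∀ x, ∑ i, c x i = κ) (e : G.edgeSet) :
    ∑ i, ∏ x, (if x ∈ (e : Sym2 V) then √((c x i : ℝ) / κ) else 1) ≤ 1 := by
  obtain ⟨a, b, hab, he⟩ := exists_edge_eq e
  calc ∑ i, ∏ x, (if x ∈ (e : Sym2 V) then √((c x i : ℝ) / κ) else 1)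
      = ∑ i, √((c a i : ℝ) / κ) * √((c b i : ℝ) / κ) :=
        Finset.sum_congr rfl fun i _ => prod_mem_edge _ hab he
    _ ≤ ∑ i, ((c a i : ℝ) / κ + (c b i : ℝ) / κ) / 2 := by
        refine Finset.sum_le_sum fun i _ => ?_
        have h1 := Real.sq_sqrt (show 0 ≤ (c a i : ℝ) / κ by positivity)
        have h2 := Real.sq_sqrt (show 0 ≤ (c b i : ℝ) / κ by positivity)
        nlinarith [sq_nonneg (√((c a i : ℝ) / κ) - √((c b i : ℝ) / κ))]
    _ = ((κ : ℝ) / κ + (κ : ℝ) / κ) / 2 := by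
        rw [← Finset.sum_div, Finset.sum_add_distrib, ← Finset.sum_div, ← Finset.sum_div]
        norm_cast
        rw [hc, hc]
    _ ≤ 1 := by
        have := div_self_le_one (κ : ℝ)
        linarith

/-- Upper bound for the partition function of configurations with few links in one matching. -/
lemma sq_tsum_sparse_le (Φ : MatchingFactorization G J) (j₀ : J) (U : ℕ → ℝ≥0) (v : V → V → ℝ)
    {lam r : ℝ} (hlam : 0 ≤ lam) (hr : 1 ≤ r) (κ K : ℕ)
    (hs : Summable fun k : G.edgeSet → Fin N → ℕ => closedWeight U v lam k) :
    (∑' k : G.edgeSet → Fin N → ℕ, closedWeight U v lam k *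
      if ∀ x, closedTime k x = κ ∧ linkTotal k (Φ.edge j₀ x) ≤ K then 1 else 0) ^ 2 ≤
    ((U κ : ℝ) ^ 2 * (lam / r) ^ (2 * κ) * ((κ + 1) ^ N *
        ((Real.exp 1 * (κ + 1)) ^ N * (2 * κ / Real.exp 1) ^ κ)) ^ 2 *
        (r ^ K * Real.exp 1 * Real.exp r ^ (Fintype.card J - 1))) ^ Fintype.card V *
      Real.exp (-((κ : ℝ) ^ 2 * ∑ x, ∑ y, v x y)) ^ 2 := by
  have hr0 : 0 < r := by linarith
  set n := Fintype.card V with hn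
  set E := Real.exp (-((κ : ℝ) ^ 2 * ∑ x, ∑ y, v x y)) with hE
  set C : ℝ := (lam / r) ^ κ * ((Real.exp 1 * (κ + 1)) ^ N * (2 * κ / Real.exp 1) ^ κ) with hC
  have hC0 : 0 ≤ C := by positivity
  set ρ : ℝ := ∏ e : G.edgeSet, if Φ.label e = j₀ then r ^ K else 1 with hρ
  have hρ0 : 0 ≤ ρ := Finset.prod_nonneg fun e _ => by split_ifs <;> positivity
  let s : (V → Fin N → ℕ) → G.edgeSet → Fin N → ℝ := fun c e i =>
    (if Φ.label e = j₀ then 1 else r) *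
      ∏ x, if x ∈ (e : Sym2 V) then √((c x i : ℝ) / κ) else 1
  have hs0 : ∀ c e i, 0 ≤ s c e i := fun c e i =>
    mul_nonneg (by split_ifs <;> positivity)
      (Finset.prod_nonneg fun x _ => by split_ifs <;> positivity)
  let T : (V → Fin N → ℕ) → (G.edgeSet → Fin N → ℕ) → ℝ := fun c k =>
    ∏ e, ∏ i, s c e i ^ k e i / (k e i).factorial
  have hT0 : ∀ c k, 0 ≤ T c k := fun c k => Finset.prod_nonneg fun e _ =>
    Finset.prod_nonneg fun i _ => div_nonneg (pow_nonneg (hs0 c e i) _) (Nat.cast_nonneg _)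
  -- S contains the possible colour profiles of the local times. There are at most (κ+1)^(N|V|) of
  -- them, which costs only a polynomial factor per vertex.
  let S : Finset (V → Fin N → ℕ) := (Fintype.piFinset fun _ : V =>
    Fintype.piFinset fun _ : Fin N => Finset.range (κ + 1)).filter fun c => ∀ x, ∑ i, c x i = κ
  have hScard : (S.card : ℝ) ≤ (((κ : ℝ) + 1) ^ N) ^ n := by
    have : S.card ≤ ((κ + 1) ^ N) ^ n := by
      refine (Finset.card_filter_le _ _).trans ?_
      simp [hn]
    exact_mod_cast this
  let H : ℝ := ∏ e : G.edgeSet, if Φ.label e = j₀ then r ^ K * Real.exp 1 else Real.exp r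
  have hTsum : ∀ c ∈ S, ρ * ∑' k, T c k ≤ H := by
    intro c hc
    rw [(hasSum_prod_prod_exp (s c) (hs0 c)).tsum_eq, hρ, ← Finset.prod_mul_distrib]
    refine Finset.prod_le_prod (fun e _ => by split_ifs <;> positivity) fun e _ => ?_
    have h1 := sum_prod_sqrt_le (G := G) c (Finset.mem_filter.1 hc).2 e
    have h2 : ∏ i, Real.exp (s c e i) ≤ Real.exp (if Φ.label e = j₀ then 1 else r) := by
      rw [← Real.exp_sum, Real.exp_le_exp, ← Finset.mul_sum]
      refine mul_le_of_le_one_right (by split_ifs <;> positivity) h1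
    split_ifs with he
    · rw [if_pos he] at h2
      exact mul_le_mul_of_nonneg_left h2 (by positivity)
    · rwa [if_neg he, ← one_mul (∏ i, _)] at h2
  have hpt : ∀ k : G.edgeSet → Fin N → ℕ, closedWeight U v lam k *
      (if ∀ x, closedTime k x = κ ∧ linkTotal k (Φ.edge j₀ x) ≤ K then 1 else 0) ≤
      (U κ : ℝ) ^ n * E * C ^ n * (ρ * ∑ c ∈ S, T c k) := by
    intro k
    have hRHS : 0 ≤ (U κ : ℝ) ^ n * E * C ^ n * (ρ * ∑ c ∈ S, T c k) :=
      mul_nonneg (by positivity) (mul_nonneg hρ0 (Finset.sum_nonneg fun c _ => hT0 c k))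
    split_ifs with h
    swap
    · rwa [mul_zero]
    by_cases hk : ∏ x, ∏ i, (involCount (deg k x i) 0 : ℝ) = 0
    · rwa [closedWeight, hk, mul_zero, zero_mul, zero_mul]
    have h1 := linkMass_mul_involCount_le Φ j₀ hlam hr k hk (fun x => (h x).1) fun x => (h x).2
    have h2 : closedTime k = fun _ => κ := funext fun x => (h x).1
    have hmem : (fun x i => deg k x i / 2) ∈ S := by
      simp only [S, Finset.mem_filter, Fintype.mem_piFinset, Finset.mem_range, Nat.lt_succ_iff]
      refine ⟨fun x i => ?_, fun x => (h x).1⟩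
      rw [← (h x).1]
      exact Finset.single_le_sum (f := fun i => deg k x i / 2) (fun _ _ => Nat.zero_le _)
        (Finset.mem_univ i)
    rw [mul_one, closedWeight, h2, gibbs_const]
    calc linkMass lam k * (∏ x, ∏ i, (involCount (deg k x i) 0 : ℝ)) * ((U κ : ℝ) ^ n * E)
        ≤ (C ^ n * (ρ * T (fun x i => deg k x i / 2) k)) * ((U κ : ℝ) ^ n * E) :=
          mul_le_mul_of_nonneg_right h1 (by positivity)
      _ = (U κ : ℝ) ^ n * E * C ^ n * (ρ * T (fun x i => deg k x i / 2) k) := by ring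
      _ ≤ _ := by
          refine mul_le_mul_of_nonneg_left (mul_le_mul_of_nonneg_left ?_ hρ0) (by positivity)
          -- Summing over all profiles c separates c from k. For fixed c the sum over k then runs
          -- over unrestricted link numbers and is a product of exponentials.
          exact Finset.single_le_sum (f := fun c => T c k) (fun c _ => hT0 c k) hmem
  have hsT : ∀ c, Summable (T c) := fun c => (hasSum_prod_prod_exp (s c) (hs0 c)).summable
  have hsum : ∑' k : G.edgeSet → Fin N → ℕ, closedWeight U v lam k *
      (if ∀ x, closedTime k x = κ ∧ linkTotal k (Φ.edge j₀ x) ≤ K then 1 else 0) ≤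
      (U κ : ℝ) ^ n * E * C ^ n * ((((κ : ℝ) + 1) ^ N) ^ n * H) := by
    calc _ ≤ ∑' k, (U κ : ℝ) ^ n * E * C ^ n * (ρ * ∑ c ∈ S, T c k) := by
          refine Summable.tsum_le_tsum hpt ?_
            (((summable_sum fun c _ => hsT c).mul_left ρ).mul_left _)
          refine Summable.of_nonneg_of_le (fun k => ?_) (fun k => ?_) hs
          · exact mul_nonneg (closedWeight_nonneg U v hlam k) (by split_ifs <;> norm_num)
          · exact mul_le_of_le_one_right (closedWeight_nonneg U v hlam k)
              (by split_ifs <;> norm_num)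
      _ = (U κ : ℝ) ^ n * E * C ^ n * ∑ c ∈ S, ρ * ∑' k, T c k := by
          rw [tsum_mul_left, tsum_mul_left, Summable.tsum_finsetSum fun c _ => hsT c,
            Finset.mul_sum]
      _ ≤ (U κ : ℝ) ^ n * E * C ^ n * ((((κ : ℝ) + 1) ^ N) ^ n * H) := by
          refine mul_le_mul_of_nonneg_left ?_ (by positivity)
          refine (Finset.sum_le_card_nsmul _ _ _ hTsum).trans ?_
          rw [nsmul_eq_mul]
          refine mul_le_mul_of_nonneg_right hScard (Finset.prod_nonneg fun e _ => ?_)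
          split_ifs <;> positivity
  -- An edge of the sparse matching contributes r^K·e instead of exp r: this is the gain.
  have hH : H ^ 2 = (r ^ K * Real.exp 1 * Real.exp r ^ (Fintype.card J - 1)) ^ n := by
    have h := Φ.prod_label_sq fun j => if j = j₀ then r ^ K * Real.exp 1 else Real.exp r
    refine h.trans ?_
    congr 1
    rw [← Finset.mul_prod_erase _ _ (Finset.mem_univ j₀), if_pos rfl]
    congr 1
    rw [Finset.prod_congr rfl fun j hj => if_neg (Finset.ne_of_mem_erase hj), Finset.prod_const,
      Finset.card_erase_of_mem (Finset.mem_univ _), Finset.card_univ]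
  refine (pow_le_pow_left₀ (tsum_nonneg fun k => mul_nonneg (closedWeight_nonneg U v hlam k)
    (by split_ifs <;> norm_num)) hsum 2).trans (le_of_eq ?_)
  rw [mul_pow, mul_pow _ H, hH, hC]
  ring

end RPM

/-! ### Few links on an edge are unlikely -/

/-- A bound for the probability of sparseness with local time `κ`. -/
def sparseBound (d N K κ : ℕ) : ℝ :=
  Real.exp (N + 1) * (2 * κ + 1) ^ (d + 1 + 2 * N + K) * Real.exp (-(κ / (2 * d)))

lemma sparseBound_nonneg (d N K κ : ℕ) : 0 ≤ sparseBound d N K κ := by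
  unfold sparseBound
  positivity

lemma summable_sparseBound {d : ℕ} (hd : 1 ≤ d) (N K : ℕ) : Summable (sparseBound d N K) := by
  set q := d + 1 + 2 * N + K with hq
  have hd0 : (0 : ℝ) < d := by exact_mod_cast hd
  have h := (Real.summable_pow_mul_exp_neg_nat_mul q (show 0 < 1 / (2 * (d : ℝ)) by positivity))
  refine (summable_nat_add_iff 1).1 ?_
  refine Summable.of_nonneg_of_le (fun κ => sparseBound_nonneg _ _ _ _) (fun κ => ?_)
    (((summable_nat_add_iff 1).2 h).mul_left (Real.exp (N + 1) * 3 ^ q))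
  rw [sparseBound, ← hq]
  have h1 : (2 * ((κ + 1 : ℕ) : ℝ) + 1) ^ q ≤ 3 ^ q * ((κ + 1 : ℕ) : ℝ) ^ q := by
    rw [← mul_pow]
    gcongr
    push_cast
    nlinarith [(Nat.cast_nonneg κ : (0 : ℝ) ≤ κ)]
  calc Real.exp (N + 1) * (2 * ((κ + 1 : ℕ) : ℝ) + 1) ^ q *
        Real.exp (-(((κ + 1 : ℕ) : ℝ) / (2 * d)))
      ≤ Real.exp (N + 1) * (3 ^ q * ((κ + 1 : ℕ) : ℝ) ^ q) *
        Real.exp (-(((κ + 1 : ℕ) : ℝ) / (2 * d))) := by gcongr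
    _ = _ := by
        rw [show -(((κ + 1 : ℕ) : ℝ) / (2 * d)) = -(1 / (2 * d)) * ((κ + 1 : ℕ) : ℝ) by ring]
        ring

/-- Comparison of the upper and the lower bound at the same local time. -/
lemma sparse_ratio_le {d N K κ Δ : ℕ} (hΔ : 1 ≤ Δ) (hΔd : Δ ≤ 2 * d) (hκ : d ≤ κ) (lam u : ℝ) :
    u ^ 2 * (lam / (2 * κ / Δ)) ^ (2 * κ) *
        ((κ + 1) ^ N * ((Real.exp 1 * (κ + 1)) ^ N * (2 * κ / Real.exp 1) ^ κ)) ^ 2 *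
        ((2 * κ / Δ) ^ K * Real.exp 1 * Real.exp (2 * κ / Δ) ^ (Δ - 1)) ≤
      sparseBound d N K κ ^ 2 *
        (lam ^ (2 * κ) * u ^ 2 * (Δ : ℝ) ^ (2 * κ) / (2 * κ + 1) ^ (Δ + 1)) := by
  have hκ0 : (0 : ℝ) < κ := by exact_mod_cast (show 0 < κ by omega)
  have hd0 : (0 : ℝ) < d := by exact_mod_cast (show 0 < d by omega)
  have hΔ0 : (0 : ℝ) < Δ := by exact_mod_cast (show 0 < Δ by omega)
  have hΔd' : (Δ : ℝ) ≤ 2 * d := by exact_mod_cast hΔd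
  set r : ℝ := 2 * κ / Δ with hr
  have hr0 : 0 < r := by positivity
  have hrΔ : r * Δ = 2 * κ := by rw [hr]; field_simp
  have h1 : Real.exp r ^ (Δ - 1) = Real.exp (2 * κ) * Real.exp (-r) := by
    rw [← Real.exp_nat_mul, ← Real.exp_add, Nat.cast_sub hΔ, ← hrΔ]
    congr 1
    push_cast
    ring
  -- With r = 2κ/Δ, the mean number of links per edge, the leading terms of both bounds agree
  -- exactly. What remains is exp(-r) and polynomial factors.
  have h2 : (lam / r) ^ (2 * κ) * ((2 * κ / Real.exp 1) ^ κ) ^ 2 * Real.exp (2 * κ) =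
      lam ^ (2 * κ) * (Δ : ℝ) ^ (2 * κ) := by
    rw [← pow_mul, mul_comm κ 2, ← mul_pow, ← mul_pow,
      show (2 * κ : ℝ) = ((2 * κ : ℕ) : ℝ) * 1 by push_cast; ring, Real.exp_nat_mul, ← mul_pow]
    congr 1
    have := Real.exp_pos 1
    push_cast
    rw [mul_one, ← hrΔ]
    field_simp
  -- Since Δ ≤ 2d, r ≥ κ/d; the square root of the comparison halves this exponent.
  have h3 : Real.exp (-r) ≤ Real.exp (-(κ / (2 * d))) ^ 2 := by
    rw [← Real.exp_nat_mul, Real.exp_le_exp]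
    have : (κ : ℝ) / d ≤ r := by
      rw [hr, div_le_div_iff₀ hd0 hΔ0]
      nlinarith
    have h4 : ((2 : ℕ) : ℝ) * (-(κ / (2 * d))) = -((κ : ℝ) / d) := by
      push_cast
      field_simp
    rw [h4]
    linarith
  have hr2 : r ≤ 2 * κ + 1 := by
    have : r ≤ 2 * κ := div_le_self (by positivity) (by exact_mod_cast hΔ)
    linarith
  have h5 : (κ : ℝ) + 1 ≤ 2 * κ + 1 := by linarith
  have h6 : (1 : ℝ) ≤ 2 * κ + 1 := by linarith
  have hexp : Real.exp 1 ^ N = Real.exp N := by rw [← Real.exp_nat_mul, mul_one]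
  have h7 : ((κ : ℝ) + 1) ^ (4 * N) * r ^ K * (2 * κ + 1) ^ (Δ + 1) * (Real.exp N ^ 2 * Real.exp 1)
      ≤ (Real.exp (N + 1) * (2 * κ + 1) ^ (d + 1 + 2 * N + K)) ^ 2 := by
    calc _ ≤ (2 * κ + 1 : ℝ) ^ (4 * N) * (2 * κ + 1) ^ (2 * K) * (2 * κ + 1) ^ (2 * d + 2) *
          (Real.exp N ^ 2 * Real.exp 1 ^ 2) := by
          gcongr ?_ * ?_ * ?_ * (_ * ?_)
          · exact pow_le_pow_left₀ (by positivity) h5 _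
          · exact (pow_le_pow_left₀ hr0.le hr2 _).trans (pow_le_pow_right₀ h6 (by omega))
          · exact pow_le_pow_right₀ h6 (by omega)
          · exact le_self_pow₀ (Real.one_le_exp (by norm_num)) (by norm_num)
      _ = _ := by
          rw [Real.exp_add]
          ring
  have hY : 0 ≤ lam ^ (2 * κ) * u ^ 2 * (Δ : ℝ) ^ (2 * κ) / (2 * κ + 1) ^ (Δ + 1) := by
    have : 0 ≤ lam ^ (2 * κ) := by rw [pow_mul]; positivity
    positivity
  calc u ^ 2 * (lam / r) ^ (2 * κ) *
        ((κ + 1) ^ N * ((Real.exp 1 * (κ + 1)) ^ N * (2 * κ / Real.exp 1) ^ κ)) ^ 2 *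
        (r ^ K * Real.exp 1 * Real.exp r ^ (Δ - 1))
      = ((lam / r) ^ (2 * κ) * ((2 * κ / Real.exp 1) ^ κ) ^ 2 * Real.exp (2 * κ)) *
        (u ^ 2 * ((κ : ℝ) + 1) ^ (4 * N) * r ^ K * (Real.exp N ^ 2 * Real.exp 1)) *
        Real.exp (-r) := by
        rw [h1, mul_pow (Real.exp 1), hexp]
        ring
    _ = (((κ : ℝ) + 1) ^ (4 * N) * r ^ K * (2 * κ + 1) ^ (Δ + 1) *
          (Real.exp N ^ 2 * Real.exp 1)) * Real.exp (-r) *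
        (lam ^ (2 * κ) * u ^ 2 * (Δ : ℝ) ^ (2 * κ) / (2 * κ + 1) ^ (Δ + 1)) := by
        rw [h2]
        field_simp
    _ ≤ (Real.exp (N + 1) * (2 * κ + 1) ^ (d + 1 + 2 * N + K)) ^ 2 *
          Real.exp (-(κ / (2 * d))) ^ 2 *
        (lam ^ (2 * κ) * u ^ 2 * (Δ : ℝ) ^ (2 * κ) / (2 * κ + 1) ^ (Δ + 1)) :=
        mul_le_mul_of_nonneg_right (mul_le_mul h7 h3 (Real.exp_pos _).le (by positivity)) hY
    _ = _ := by
        rw [sparseBound]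
        ring

/-- From bounds on pressures to a bound for a probability. -/
lemma le_of_pow_le_div {p F Z X Y D δ : ℝ} {n : ℕ} (hn : n ≠ 0) (hp : 0 ≤ p) (hZ : 0 < Z)
    (hδ : 0 ≤ δ) (hX : 0 ≤ X) (h : p ^ n ≤ F / Z) (hFX : F ^ 2 ≤ X ^ n * D)
    (hYZ : Y ^ n * D ≤ Z ^ 2) (hD : 0 ≤ D) (hXY : X ≤ δ ^ 2 * Y) : p ≤ δ := by
  have h1 : F ^ 2 ≤ (δ ^ 2) ^ n * Z ^ 2 := by
    calc F ^ 2 ≤ X ^ n * D := hFX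
      _ ≤ (δ ^ 2 * Y) ^ n * D := by gcongr
      _ = (δ ^ 2) ^ n * (Y ^ n * D) := by ring
      _ ≤ _ := by gcongr
  have h2 : (p ^ 2) ^ n ≤ (δ ^ 2) ^ n := by
    calc (p ^ 2) ^ n = (p ^ n) ^ 2 := by ring
      _ ≤ (F / Z) ^ 2 := by gcongr
      _ = F ^ 2 / Z ^ 2 := by rw [div_pow]
      _ ≤ _ := by rwa [div_le_iff₀ (by positivity)]
  exact (pow_le_pow_iff_left₀ hp hδ two_ne_zero).1
    ((pow_le_pow_iff_left₀ (by positivity) (by positivity) hn).1 h2)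

/-! ### Probability of sparseness at the origin -/

section

variable {d L N : ℕ} [NeZero L]

lemma card_torusMatching_pos (hd : 1 ≤ d) : 1 ≤ Fintype.card (TorusMatching d L) :=
  Fintype.card_pos_iff.2 ⟨⟨(⟨0, hd⟩, false), fun _ => rfl⟩⟩

lemma card_torusMatching_le : Fintype.card (TorusMatching d L) ≤ 2 * d := by
  refine (Fintype.card_subtype_le _).trans ?_
  simp [mul_comm]

/-- The probability of sparseness at the origin. -/
def sparseProb (hL : Even L) (v : (Fin d → ℤ) → ℝ) (U : ℕ → ℝ≥0) (N : ℕ) (lam : ℝ) (j : Fin d)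
    (κ K : ℕ) : ℝ :=
  (∑' k : (torusGraph d L).edgeSet → Fin N → ℕ,
      RPM.closedWeight U (periodicPotential v L) lam k * if SparseAt hL j κ K k 0 then 1 else 0) /
    ∑' k : (torusGraph d L).edgeSet → Fin N → ℕ,
      RPM.closedWeight U (periodicPotential v L) lam k

/-- Upper bound for the partition function of the configurations which are sparse everywhere. -/
lemma sq_tsum_sparseAt_le (hL : Even L) (v : (Fin d → ℤ) → ℝ) (U : ℕ → ℝ≥0) {lam r : ℝ}
    (hlam : 0 ≤ lam) (hr : 1 ≤ r) (j : Fin d) (κ K : ℕ)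
    (hs : Summable fun k : (torusGraph d L).edgeSet → Fin N → ℕ =>
      RPM.closedWeight U (periodicPotential v L) lam k) :
    (∑' k : (torusGraph d L).edgeSet → Fin N → ℕ,
      RPM.closedWeight U (periodicPotential v L) lam k *
        if ∀ x, SparseAt hL j κ K k x then 1 else 0) ^ 2 ≤
    ((U κ : ℝ) ^ 2 * (lam / r) ^ (2 * κ) * ((κ + 1) ^ N *
        ((Real.exp 1 * (κ + 1)) ^ N * (2 * κ / Real.exp 1) ^ κ)) ^ 2 *
        (r ^ K * Real.exp 1 * Real.exp r ^ (Fintype.card (TorusMatching d L) - 1))) ^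
        Fintype.card (Torus d L) *
      Real.exp (-((κ : ℝ) ^ 2 * ∑ x : Torus d L, ∑ y : Torus d L,
        periodicPotential v L x y)) ^ 2 := by
  refine le_of_eq_of_le ?_ (RPM.sq_tsum_sparse_le (torusFactorization d hL)
    ⟨(j, false), fun _ => rfl⟩ U (periodicPotential v L) hlam hr κ K hs)
  refine congrArg (· ^ 2) (tsum_congr fun k => congrArg _ (if_congr ?_ rfl rfl))
  exact Iff.rfl

variable (hL : Even L) {v : (Fin d → ℤ) → ℝ} (U : ℕ → ℝ≥0) {lam : ℝ}

lemma sparseProb_nonneg (hlam : 0 ≤ lam) (j : Fin d) (κ K : ℕ) :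
    0 ≤ sparseProb hL v U N lam j κ K :=
  div_nonneg (tsum_nonneg fun k => mul_nonneg (RPM.closedWeight_nonneg U _ hlam k)
    (by split_ifs <;> norm_num)) (tsum_nonneg fun k => RPM.closedWeight_nonneg U _ hlam k)

lemma tsum_closedWeight_pos (hL : Even L) (v : (Fin d → ℤ) → ℝ) (U : ℕ → ℝ≥0) {lam : ℝ} (hN : 0 < N) (hd : 1 ≤ d) (hlam : 0 < lam) {κ : ℕ} (hκ : 0 < U κ)
    (hs : Summable fun k : (torusGraph d L).edgeSet → Fin N → ℕ =>
      RPM.closedWeight U (periodicPotential v L) lam k) :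
    0 < ∑' k : (torusGraph d L).edgeSet → Fin N → ℕ,
      RPM.closedWeight U (periodicPotential v L) lam k := by
  have h := RPM.le_sq_tsum_closedWeight (torusFactorization d hL) U (periodicPotential v L)
    hlam.le hN (card_torusMatching_pos hd) κ hs
  have hκ' : (0 : ℝ) < U κ := hκ
  have hΔ : (0 : ℝ) < Fintype.card (TorusMatching d L) := by
    exact_mod_cast card_torusMatching_pos hd
  have h2 := lt_of_lt_of_le (by positivity) h
  exact lt_of_le_of_ne (tsum_nonneg fun k => RPM.closedWeight_nonneg U _ hlam.le k)
    fun h0 => by rw [← h0] at h2; norm_num at h2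

/-- Upper and lower bound are taken at the same local time κ, where the factors U(κ) and the energy
cancel. The result is therefore uniform in U, λ and L. The condition d ≤ κ ensures 2κ/Δ ≥ 1. -/
lemma sparseProb_le (hv : ∀ x, v (-x) = v x) (hsep : Separable v) (hN : 0 < N) (hlam : 0 < lam)
    (j : Fin d) {κ K : ℕ} (hκ : d ≤ κ)
    (hs : Summable fun k : (torusGraph d L).edgeSet → Fin N → ℕ =>
      RPM.closedWeight U (periodicPotential v L) lam k)
    (hpos : 0 < ∑' k : (torusGraph d L).edgeSet → Fin N → ℕ,
      RPM.closedWeight U (periodicPotential v L) lam k) :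
    sparseProb hL v U N lam j κ K ≤ sparseBound d N K κ := by
  have hd : 1 ≤ d := by have := j.2; omega
  have hΔ := card_torusMatching_pos (L := L) hd
  have hΔd := card_torusMatching_le (d := d) (L := L)
  have hr : (1 : ℝ) ≤ 2 * κ / Fintype.card (TorusMatching d L) := by
    rw [one_le_div (by exact_mod_cast hΔ)]
    exact_mod_cast hΔd.trans (by omega)
  refine le_of_pow_le_div (n := Fintype.card (Torus d L)) Fintype.card_ne_zero
    (sparseProb_nonneg hL U hlam.le j κ K) hpos (sparseBound_nonneg _ _ _ _) (by positivity)
    (torus_chessboard hL hv hsep U hlam.le j κ K hs hpos 0)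
    (sq_tsum_sparseAt_le hL v U hlam.le hr j κ K hs)
    (RPM.le_sq_tsum_closedWeight (torusFactorization d hL) U (periodicPotential v L)
      hlam.le hN hΔ κ hs) (by positivity) (sparse_ratio_le hΔ hΔd hκ lam (U κ))

/-- The comparison is with local time κ₀ > κ. That configuration has at least one more power of λ
per vertex in the squared weights, and this beats the energies, which are bounded by a constant
times the volume. Sparseness plays no role, so the upper bound is used with r = 1. -/
lemma sparseProb_small_le (hv : ∀ x, v (-x) = v x) (ht : Tempered v) (hsep : Separable v)
    (hN : 0 < N) (hlam : 1 ≤ lam) (j : Fin d) {κ κ₀ K : ℕ} (hκ : κ < κ₀) {ε : ℝ} (hε : 0 ≤ ε)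
    (hlam' : (U κ : ℝ) ^ 2 * ((κ + 1) ^ N *
      ((Real.exp 1 * (κ + 1)) ^ N * (2 * κ / Real.exp 1) ^ κ)) ^ 2 * Real.exp (2 * d) *
      Real.exp (4 * κ₀ ^ 2 * ∑' x, |v x|) ≤
      lam * (ε ^ 2 * ((U κ₀ : ℝ) ^ 2 / (2 * κ₀ + 1) ^ (2 * d + 1))))
    (hs : Summable fun k : (torusGraph d L).edgeSet → Fin N → ℕ =>
      RPM.closedWeight U (periodicPotential v L) lam k)
    (hpos : 0 < ∑' k : (torusGraph d L).edgeSet → Fin N → ℕ,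
      RPM.closedWeight U (periodicPotential v L) lam k) :
    sparseProb hL v U N lam j κ K ≤ ε := by
  have hd : 1 ≤ d := by have := j.2; omega
  have hΔ := card_torusMatching_pos (L := L) hd
  have hΔd := card_torusMatching_le (d := d) (L := L)
  have hlam0 : 0 < lam := by linarith
  set S := ∑ x : Torus d L, ∑ y : Torus d L, periodicPotential v L x y with hS
  set s := ∑' x, |v x| with hsdef
  have hs0 : 0 ≤ s := tsum_nonneg fun x => abs_nonneg _
  have hSabs : |S| ≤ Fintype.card (Torus d L) * s := abs_sum_periodicPotential_le v ht.2
  set n := Fintype.card (Torus d L) with hn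
  set C : ℝ := (κ + 1) ^ N * ((Real.exp 1 * (κ + 1)) ^ N * (2 * κ / Real.exp 1) ^ κ) with hC
  have hF := sq_tsum_sparseAt_le hL v U hlam0.le le_rfl j κ K hs
  have hZ := RPM.le_sq_tsum_closedWeight (torusFactorization d hL) U (periodicPotential v L)
      hlam0.le hN hΔ κ₀ hs
  rw [← hS, ← hn] at hF hZ
  have hκκ : (κ : ℝ) ^ 2 ≤ κ₀ ^ 2 := by gcongr
  have hE1 : Real.exp (-((κ : ℝ) ^ 2 * S)) ^ 2 ≤ Real.exp (2 * κ₀ ^ 2 * s) ^ n := by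
    rw [← Real.exp_nat_mul, ← Real.exp_nat_mul, Real.exp_le_exp]
    have h1 := neg_le_of_abs_le hSabs
    have h2 : (κ : ℝ) ^ 2 * (-S) ≤ κ₀ ^ 2 * (n * s) :=
      mul_le_mul_of_nonneg hκκ (by linarith) (by positivity) (by positivity)
    push_cast
    linarith
  have hE2 : Real.exp (-(2 * κ₀ ^ 2 * s)) ^ n ≤ Real.exp (-((κ₀ : ℝ) ^ 2 * S)) ^ 2 := by
    rw [← Real.exp_nat_mul, ← Real.exp_nat_mul, Real.exp_le_exp]
    have h1 := le_of_abs_le hSabs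
    have h2 : (κ₀ : ℝ) ^ 2 * S ≤ κ₀ ^ 2 * (n * s) := by gcongr
    push_cast
    linarith
  refine le_of_pow_le_div (n := n) (D := 1) Fintype.card_ne_zero
    (sparseProb_nonneg hL U hlam0.le j κ K) hpos hε
    (X := (U κ : ℝ) ^ 2 * lam ^ (2 * κ) * C ^ 2 * Real.exp (2 * d) * Real.exp (2 * κ₀ ^ 2 * s))
    (Y := lam ^ (2 * κ₀) * (U κ₀ : ℝ) ^ 2 / (2 * κ₀ + 1) ^ (2 * d + 1) *
      Real.exp (-(2 * κ₀ ^ 2 * s))) (by positivity)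
    (torus_chessboard hL hv hsep U hlam0.le j κ K hs hpos 0) (hF.trans ?_) (le_trans ?_ hZ)
    zero_le_one ?_
  · rw [mul_one, mul_pow _ (Real.exp (2 * κ₀ ^ 2 * s))]
    refine mul_le_mul (pow_le_pow_left₀ (by positivity) ?_ _) hE1 (by positivity) (by positivity)
    rw [div_one, one_pow, one_mul, ← pow_succ', Nat.sub_add_cancel hΔ, ← Real.exp_nat_mul, mul_one]
    gcongr
    exact_mod_cast hΔd
  · rw [mul_one, mul_pow _ (Real.exp (-(2 * κ₀ ^ 2 * s)))]
    refine mul_le_mul (pow_le_pow_left₀ (by positivity) ?_ _) hE2 (by positivity) (by positivity)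
    refine div_le_div₀ (by positivity)
      (le_mul_of_one_le_right (by positivity) (one_le_pow₀ (by exact_mod_cast hΔ)))
      (by positivity) (pow_le_pow_right₀ ?_ (by omega))
    linarith [(Nat.cast_nonneg κ₀ : (0 : ℝ) ≤ κ₀)]
  · have h1 : lam ^ (2 * κ) * lam ≤ lam ^ (2 * κ₀) := by
      rw [← pow_succ]
      exact pow_le_pow_right₀ hlam (by omega)
    have h2 : Real.exp (4 * κ₀ ^ 2 * s) * Real.exp (-(2 * κ₀ ^ 2 * s)) =
        Real.exp (2 * κ₀ ^ 2 * s) := by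
      rw [← Real.exp_add]
      congr 1
      ring
    calc (U κ : ℝ) ^ 2 * lam ^ (2 * κ) * C ^ 2 * Real.exp (2 * d) * Real.exp (2 * κ₀ ^ 2 * s)
        = lam ^ (2 * κ) * Real.exp (-(2 * κ₀ ^ 2 * s)) *
          ((U κ : ℝ) ^ 2 * C ^ 2 * Real.exp (2 * d) * Real.exp (4 * κ₀ ^ 2 * s)) := by
          rw [← h2]
          ring
      _ ≤ lam ^ (2 * κ) * Real.exp (-(2 * κ₀ ^ 2 * s)) *
          (lam * (ε ^ 2 * ((U κ₀ : ℝ) ^ 2 / (2 * κ₀ + 1) ^ (2 * d + 1)))) := by gcongr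
      _ = (lam ^ (2 * κ) * lam) * (Real.exp (-(2 * κ₀ ^ 2 * s)) *
          (ε ^ 2 * ((U κ₀ : ℝ) ^ 2 / (2 * κ₀ + 1) ^ (2 * d + 1)))) := by ring
      _ ≤ lam ^ (2 * κ₀) * (Real.exp (-(2 * κ₀ ^ 2 * s)) *
          (ε ^ 2 * ((U κ₀ : ℝ) ^ 2 / (2 * κ₀ + 1) ^ (2 * d + 1)))) := by gcongr
      _ = _ := by ring

/-- The probability that there are few links on the edge of a matching at the origin. -/
lemma tsum_sparseProb (j : Fin d) (K : ℕ)
    (hlam : 0 ≤ lam) (hs : Summable fun k : (torusGraph d L).edgeSet → Fin N → ℕ =>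
      RPM.closedWeight U (periodicPotential v L) lam k) :
    HasSum (fun κ => sparseProb hL v U N lam j κ K)
      ((∑' k : (torusGraph d L).edgeSet → Fin N → ℕ,
        RPM.closedWeight U (periodicPotential v L) lam k *
          if RPM.linkTotal k (matchingEdge hL j 0) ≤ K then 1 else 0) /
      ∑' k : (torusGraph d L).edgeSet → Fin N → ℕ,
        RPM.closedWeight U (periodicPotential v L) lam k) := by
  have hs' : Summable fun k : (torusGraph d L).edgeSet → Fin N → ℕ =>
      RPM.closedWeight U (periodicPotential v L) lam k *
        if RPM.linkTotal k (matchingEdge hL j 0) ≤ K then 1 else 0 :=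
    Summable.of_nonneg_of_le (fun k => mul_nonneg (RPM.closedWeight_nonneg U _ hlam k)
      (by split_ifs <;> norm_num)) (fun k => mul_le_of_le_one_right
      (RPM.closedWeight_nonneg U _ hlam k) (by split_ifs <;> norm_num)) hs
  have h := (hs'.hasSum.tsum_fiberwise fun k => RPM.closedTime k 0).div_const
    (∑' k : (torusGraph d L).edgeSet → Fin N → ℕ,
      RPM.closedWeight U (periodicPotential v L) lam k)
  have e : (fun κ => sparseProb hL v U N lam j κ K) = fun κ =>
      (∑' k : (fun k : (torusGraph d L).edgeSet → Fin N → ℕ => RPM.closedTime k 0) ⁻¹' {κ},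
        RPM.closedWeight U (periodicPotential v L) lam k.1 *
          if RPM.linkTotal k.1 (matchingEdge hL j 0) ≤ K then 1 else 0) /
      ∑' k : (torusGraph d L).edgeSet → Fin N → ℕ,
        RPM.closedWeight U (periodicPotential v L) lam k := by
    funext κ
    rw [sparseProb, tsum_subtype ((fun k : (torusGraph d L).edgeSet → Fin N → ℕ =>
      RPM.closedTime k 0) ⁻¹' {κ}) fun k => RPM.closedWeight U (periodicPotential v L) lam k *
        if RPM.linkTotal k (matchingEdge hL j 0) ≤ K then (1 : ℝ) else 0]
    congr 1
    refine tsum_congr fun k => ?_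
    by_cases h1 : RPM.closedTime k 0 = κ <;>
      by_cases h2 : RPM.linkTotal k (matchingEdge hL j 0) ≤ K <;>
      simp [SparseAt, h1, h2]
  rw [e]
  exact h

end

/-! ### Expectations in terms of the numbers of links -/

lemma tsum_eq_of_tsum_ofReal_eq {α β : Type*} {f : α → ℝ} {g : β → ℝ} (hf : ∀ a, 0 ≤ f a)
    (hg : ∀ b, 0 ≤ g b) (h : ∑' a, ENNReal.ofReal (f a) = ∑' b, ENNReal.ofReal (g b)) :
    ∑' a, f a = ∑' b, g b := by
  have h1 := congrArg ENNReal.toReal h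
  rw [ENNReal.tsum_toReal_eq fun _ => ENNReal.ofReal_ne_top,
    ENNReal.tsum_toReal_eq fun _ => ENNReal.ofReal_ne_top] at h1
  simpa only [ENNReal.toReal_ofReal (hf _), ENNReal.toReal_ofReal (hg _)] using h1

lemma summable_of_tsum_ofReal_eq {α β : Type*} {f : α → ℝ} {g : β → ℝ} (hf : ∀ a, 0 ≤ f a)
    (hg : ∀ b, 0 ≤ g b) (h : ∑' a, ENNReal.ofReal (f a) = ∑' b, ENNReal.ofReal (g b))
    (hs : Summable g) : Summable f := by
  have h1 : ∑' a, ENNReal.ofReal (f a) ≠ ⊤ := by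
    rw [h, ← ENNReal.ofReal_tsum_of_nonneg hg hs]
    exact ENNReal.ofReal_ne_top
  exact (ENNReal.summable_toReal h1).congr fun a => by rw [ENNReal.toReal_ofReal (hf a)]

namespace RPM

variable {V : Type} [Fintype V] {G : SimpleGraph V} {N : ℕ}

lemma tsum_closed_eq (U : ℕ → ℝ≥0) (v : V → V → ℝ) {lam : ℝ} (hlam : 0 ≤ lam)
    {f : (G.edgeSet → Fin N → ℕ) → ℝ} (hf : ∀ k, 0 ≤ f k) :
    ∑' w : {w : Config G N // w.IsClosed}, w.1.weight U v lam * f (colourCount w.1.c) =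
      ∑' k : G.edgeSet → Fin N → ℕ, closedWeight U v lam k * f k :=
  tsum_eq_of_tsum_ofReal_eq (fun w => mul_nonneg (w.1.weight_nonneg U v hlam) (hf _))
    (fun k => mul_nonneg (closedWeight_nonneg U v hlam k) (hf k)) (tsum_closed U v hlam f)

lemma summable_closed (U : ℕ → ℝ≥0) (v : V → V → ℝ) {lam : ℝ} (hlam : 0 ≤ lam)
    {f : (G.edgeSet → Fin N → ℕ) → ℝ} (hf : ∀ k, 0 ≤ f k)
    (hs : Summable fun k : G.edgeSet → Fin N → ℕ => closedWeight U v lam k * f k) :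
    Summable fun w : {w : Config G N // w.IsClosed} =>
      w.1.weight U v lam * f (colourCount w.1.c) :=
  summable_of_tsum_ofReal_eq (fun w => mul_nonneg (w.1.weight_nonneg U v hlam) (hf _))
    (fun k => mul_nonneg (closedWeight_nonneg U v hlam k) (hf k)) (tsum_closed U v hlam f) hs

lemma partitionFunction_eq (U : ℕ → ℝ≥0) (v : V → V → ℝ) {lam : ℝ} (hlam : 0 ≤ lam) :
    partitionFunction G U v N lam = ∑' k : G.edgeSet → Fin N → ℕ, closedWeight U v lam k := by
  have h := tsum_closed_eq (G := G) (N := N) U v hlam (f := fun _ => 1) fun _ => zero_le_one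
  simpa [partitionFunction] using h

/-- The two-point function of the end points of an edge. -/
lemma twoPoint_eq (hN : 2 ≤ N) (U : ℕ → ℝ≥0) (v : V → V → ℝ) {lam : ℝ} (hlam : 0 ≤ lam)
    {x y : V} (hxy : s(x, y) ∈ G.edgeSet) :
    twoPoint G U v N lam x y = (∑' k : G.edgeSet → Fin N → ℕ, closedWeight U v lam k *
      (k ⟨s(x, y), hxy⟩ ⟨0, by omega⟩ * k ⟨s(x, y), hxy⟩ ⟨1, by omega⟩)) /
        ∑' k : G.edgeSet → Fin N → ℕ, closedWeight U v lam k := by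
  have h := tsum_twoOpen hN U v hlam hxy
  rw [← ENNReal.tsum_mul_left] at h
  simp_rw [← ENNReal.ofReal_mul (sq_nonneg lam)] at h
  have h2 := tsum_eq_of_tsum_ofReal_eq
    (fun w => mul_nonneg (sq_nonneg lam) (w.1.weight_nonneg U v hlam))
    (fun k => mul_nonneg (closedWeight_nonneg U v hlam k) (by positivity)) h
  rw [tsum_mul_left] at h2
  rw [twoPoint, partitionFunction_eq U v hlam, ← mul_div_assoc, directedPartitionFunction, h2]

/-- The colours are exchangeable. -/
lemma tsum_closedWeight_colour (U : ℕ → ℝ≥0) (v : V → V → ℝ) (lam : ℝ) (e : G.edgeSet)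
    (i i' : Fin N) :
    ∑' k : G.edgeSet → Fin N → ℕ, closedWeight U v lam k * k e i =
      ∑' k : G.edgeSet → Fin N → ℕ, closedWeight U v lam k * k e i' := by
  let σ := Equiv.swap i i'
  let T : (G.edgeSet → Fin N → ℕ) ≃ (G.edgeSet → Fin N → ℕ) :=
    Equiv.piCongrRight fun _ => Equiv.arrowCongr σ (Equiv.refl ℕ)
  have hT : ∀ k e j, T k e j = k e (σ j) := fun k e j => rfl
  have hdeg : ∀ k x j, deg (T k) x j = deg k x (σ j) := fun k x j => by simp only [deg, hT]
  have htime : ∀ k, closedTime (T k) = closedTime k := fun k => by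
    funext x
    simp only [closedTime, hdeg]
    exact Equiv.sum_comp σ fun j => deg k x j / 2
  have hW : ∀ k, closedWeight U v lam (T k) = closedWeight U v lam k := by
    intro k
    rw [closedWeight, closedWeight, htime]
    congr 2
    · refine Finset.prod_congr rfl fun e _ => ?_
      simp only [hT]
      exact Equiv.prod_comp σ fun j => lam ^ k e j / ((k e j).factorial : ℝ)
    · refine Finset.prod_congr rfl fun x _ => ?_
      simp only [hdeg]
      exact Equiv.prod_comp σ fun j => (involCount (deg k x j) 0 : ℝ)
  rw [← Equiv.tsum_eq T]
  refine tsum_congr fun k => ?_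
  rw [hW, hT, Equiv.swap_apply_left]

/-- By exchangeability every colour has the same mean, so the total is N times the mean of one
colour. -/
lemma tsum_closedWeight_linkTotal (U : ℕ → ℝ≥0) (v : V → V → ℝ) (lam : ℝ) (e : G.edgeSet)
    (i : Fin N)
    (hs : ∀ j, Summable fun k : G.edgeSet → Fin N → ℕ => closedWeight U v lam k * k e j) :
    ∑' k : G.edgeSet → Fin N → ℕ, closedWeight U v lam k * linkTotal k e =
      N * ∑' k : G.edgeSet → Fin N → ℕ, closedWeight U v lam k * k e i := by
  simp only [linkTotal, Nat.cast_sum, Finset.mul_sum]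
  rw [Summable.tsum_finsetSum fun j _ => hs j,
    Finset.sum_congr rfl fun j _ => tsum_closedWeight_colour U v lam e j i]
  simp

/-- If it is likely that there are many links on an edge, then the correlation of the numbers of
links of two colours is large. -/
lemma le_correlation {U : ℕ → ℝ≥0} {v : V → V → ℝ} {lam : ℝ} (hlam : 0 ≤ lam) (e : G.edgeSet)
    {i₀ i₁ : Fin N} (hi : i₀ ≠ i₁) {M a : ℝ} (ha : 0 ≤ a) {K : ℕ}
    (hK : 2 + a * (N + 2) + (2 * (N * (N + 2) * M) + (2 + a * (N + 2)) ^ 2 / 4) ≤ K) (hM : 0 ≤ M)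
    (hs : ∀ f : (G.edgeSet → Fin N → ℕ) → ℝ, (∀ k, |f k| ≤ (linkTotal k e : ℝ) ^ 2) →
      Summable fun k => closedWeight U v lam k * f k)
    (hs0 : Summable fun k : G.edgeSet → Fin N → ℕ => closedWeight U v lam k)
    (hpos : 0 < ∑' k : G.edgeSet → Fin N → ℕ, closedWeight U v lam k)
    (hp : (∑' k : G.edgeSet → Fin N → ℕ, closedWeight U v lam k *
        if linkTotal k e ≤ K then 1 else 0) /
      (∑' k : G.edgeSet → Fin N → ℕ, closedWeight U v lam k) ≤ 1 / 2) :
    M ≤ (∑' k : G.edgeSet → Fin N → ℕ, closedWeight U v lam k * (k e i₀ * k e i₁)) /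
        (∑' k : G.edgeSet → Fin N → ℕ, closedWeight U v lam k) -
      a * ((∑' k : G.edgeSet → Fin N → ℕ, closedWeight U v lam k * k e i₁) /
        (∑' k : G.edgeSet → Fin N → ℕ, closedWeight U v lam k)) := by
  set W : (G.edgeSet → Fin N → ℕ) → ℝ := fun k => closedWeight U v lam k with hW
  have hW0 : ∀ k, 0 ≤ W k := closedWeight_nonneg U v hlam
  set Z := ∑' k, W k with hZ
  set B : ℝ := 2 + a * (N + 2) with hB
  have hN : (0 : ℝ) < N := by exact_mod_cast (Fin.pos i₀)
  have hle : ∀ (k : G.edgeSet → Fin N → ℕ) i, (k e i : ℝ) ≤ linkTotal k e := fun k i => by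
    exact_mod_cast le_linkTotal k e i
  have hsq : ∀ n : ℕ, (n : ℝ) ≤ (n : ℝ) ^ 2 := fun n => by exact_mod_cast Nat.le_self_pow two_ne_zero n
  have hs1 : ∀ i, Summable fun k => W k * k e i := fun i => hs (fun k => k e i) fun k => by
    rw [Nat.abs_cast]
    exact (hle k i).trans (hsq _)
  have hs01 : Summable fun k => W k * (k e i₀ * k e i₁) :=
    hs (fun k => k e i₀ * k e i₁) fun k => by
      rw [abs_of_nonneg (by positivity), sq]
      exact mul_le_mul (hle k _) (hle k _) (by positivity) (by positivity)
  have hsm : Summable fun k => W k * linkTotal k e := hs (fun k => linkTotal k e) fun k => by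
    rw [Nat.abs_cast]
    exact hsq _
  have hsmm : Summable fun k => W k * ((linkTotal k e * (linkTotal k e - 2) : ℕ) : ℝ) :=
    hs (fun k => ((linkTotal k e * (linkTotal k e - 2) : ℕ) : ℝ)) fun k => by
      rw [Nat.abs_cast]
      have : linkTotal k e * (linkTotal k e - 2) ≤ linkTotal k e ^ 2 := by
        rw [sq]
        exact Nat.mul_le_mul_left _ (Nat.sub_le _ _)
      exact_mod_cast this
  have hsi : Summable fun k => W k * if linkTotal k e ≤ K then (1 : ℝ) else 0 :=
    Summable.of_nonneg_of_le (fun k => mul_nonneg (hW0 k) (by split_ifs <;> norm_num))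
      (fun k => mul_le_of_le_one_right (hW0 k) (by split_ifs <;> norm_num)) hs0
  have hstrand : ∑' k, W k * ((linkTotal k e * (linkTotal k e - 2) : ℕ) : ℝ) ≤
      N * (N + 2) * ∑' k, W k * (k e i₀ * k e i₁) := by
    have h := tsum_closedWeight_le U v hlam e hi
    rw [← ENNReal.ofReal_tsum_of_nonneg (fun k => mul_nonneg (hW0 k) (Nat.cast_nonneg _)) hsmm,
      ← ENNReal.ofReal_tsum_of_nonneg (fun k => mul_nonneg (hW0 k) (by positivity)) hs01,
      ← ENNReal.ofReal_mul (by positivity)] at h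
    exact (ENNReal.ofReal_le_ofReal_iff (mul_nonneg (by positivity)
      (tsum_nonneg fun k => mul_nonneg (hW0 k) (by positivity)))).1 h
  have hcol := tsum_closedWeight_linkTotal U v lam e i₁ hs1
  -- The quadratic m² - Bm is at least -B²/4 everywhere and at least K(K-B) for m ≥ K. If m ≤ K has
  -- probability at most 1/2, its mean is at least (K(K-B) - B²/4)/2, which by the choice of K is at
  -- least N(N+2)M.
  have hpt : ∀ k : G.edgeSet → Fin N → ℕ,
      W k * (K * (K - B)) - (K * (K - B) + B ^ 2 / 4) * (W k * if linkTotal k e ≤ K then 1 else 0) ≤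
      W k * ((linkTotal k e * (linkTotal k e - 2) : ℕ) : ℝ) -
        a * (N + 2) * (W k * linkTotal k e) := by
    intro k
    set m := linkTotal k e
    -- The truncation of m - 2 only helps: for m ≤ 2 the left side is not positive.
    have h1 : (m : ℝ) ^ 2 - 2 * m ≤ ((m * (m - 2) : ℕ) : ℝ) := by
      rcases le_total 2 m with h | h
      · push_cast [Nat.cast_sub h]
        linarith
      · have : (m : ℝ) ≤ 2 := by exact_mod_cast h
        refine le_trans ?_ (Nat.cast_nonneg _)
        nlinarith [(Nat.cast_nonneg m : (0 : ℝ) ≤ m)]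
    have h2 : K * (K - B) - (K * (K - B) + B ^ 2 / 4) * (if m ≤ K then 1 else 0) ≤
        (m : ℝ) ^ 2 - B * m := by
      split_ifs with h
      · nlinarith [sq_nonneg ((m : ℝ) - B / 2)]
      · have h3 : (K : ℝ) ≤ m := by exact_mod_cast (not_le.1 h).le
        have h4 : B ≤ K := by
          refine le_trans ?_ hK
          have : 0 ≤ 2 * (N * (N + 2) * M) + B ^ 2 / 4 := by positivity
          linarith
        have h5 : 0 ≤ B := by positivity
        nlinarith
    have h3 := mul_le_mul_of_nonneg_left (h2.trans (sub_le_sub_right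
      (show (m : ℝ) ^ 2 ≤ ((m * (m - 2) : ℕ) : ℝ) + 2 * m by linarith) (B * m))) (hW0 k)
    rw [hB] at h3 ⊢
    linarith
  have hint : Z * (K * (K - B)) - (K * (K - B) + B ^ 2 / 4) *
        ∑' k, W k * (if linkTotal k e ≤ K then 1 else 0) ≤
      (∑' k, W k * ((linkTotal k e * (linkTotal k e - 2) : ℕ) : ℝ)) -
        a * (N + 2) * ∑' k, W k * linkTotal k e := by
    rw [hZ, ← tsum_mul_right, ← tsum_mul_left, ← tsum_mul_left,
      ← (hs0.mul_right _).tsum_sub (hsi.mul_left _), ← hsmm.tsum_sub (hsm.mul_left _)]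
    exact Summable.tsum_le_tsum hpt ((hs0.mul_right _).sub (hsi.mul_left _))
      (hsmm.sub (hsm.mul_left _))
  rw [div_le_iff₀ hpos] at hp
  set Q := ∑' k, W k * if linkTotal k e ≤ K then (1 : ℝ) else 0
  set X := ∑' k, W k * ((k e i₀ : ℝ) * k e i₁)
  set Y := ∑' k, W k * (k e i₁ : ℝ)
  change ∑' k, W k * (linkTotal k e : ℝ) = N * Y at hcol
  rw [hcol] at hint
  rw [← mul_div_assoc, ← sub_div, le_div_iff₀ hpos]
  have hB2 : 2 ≤ B := by
    have : 0 ≤ a * ((N : ℝ) + 2) := by positivity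
    linarith
  have hT : 0 ≤ 2 * (N * (N + 2) * M) + B ^ 2 / 4 := by positivity
  have hK1 : (1 : ℝ) ≤ K := by linarith
  have hKB : 2 * (N * (N + 2) * M) + B ^ 2 / 4 ≤ K * (K - B) := by nlinarith
  have h1 : (K * (K - B) + B ^ 2 / 4) * Q ≤ (K * (K - B) + B ^ 2 / 4) * (1 / 2 * Z) :=
    mul_le_mul_of_nonneg_left hp (by nlinarith [sq_nonneg B])
  have h2 : N * (N + 2) * M * Z ≤ N * (N + 2) * (X - a * Y) := by nlinarith
  have h3 : (0 : ℝ) < N * (N + 2) := by positivity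
  refine le_of_mul_le_mul_left ?_ h3
  linarith

end RPM

/-! ### Weight functions of large range -/

/-- Goodness carries positivity downwards: if U(n+1) > 0 and n ≥ 1 then U(n) > 0. -/
lemma Good.pos_of_range {d : ℕ} {v : (Fin d → ℤ) → ℝ} {U : ℕ → ℝ≥0} (hU : Good v U) {κ : ℕ}
    (hκ : 1 ≤ κ) (hR : ENNReal.ofReal κ ≤ (weightRange U : ℝ≥0∞)) : 0 < U κ := by
  have h1 : ∃ n, κ ≤ n ∧ 0 < U n := by
    by_contra! h
    have h2 : weightRange U ≤ ((κ - 1 : ℕ) : ℕ∞) := by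
      refine iSup₂_le fun n hn => ?_
      have : n < κ := by
        by_contra hc
        exact absurd (h n (not_lt.1 hc)) (not_le.2 hn)
      exact_mod_cast (show n ≤ κ - 1 by omega)
    rw [ENNReal.ofReal_natCast] at hR
    have h3 : ((κ : ℕ∞) : ℝ≥0∞) ≤ ((κ - 1 : ℕ) : ℕ∞) := by
      refine le_trans ?_ (ENat.toENNReal_le.2 h2)
      simpa using hR
    rw [ENat.toENNReal_le] at h3
    have : κ ≤ κ - 1 := by exact_mod_cast h3
    omega
  obtain ⟨n, hn, hUn⟩ := h1
  obtain ⟨C, hC⟩ := hU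
  induction n, hn using Nat.le_induction with
  | base => exact hUn
  | succ n hn ih =>
    refine ih ?_
    by_contra h0
    have h1 : U n = 0 := nonpos_iff_eq_zero.1 (not_lt.1 h0)
    have h2 := hC n
    rw [h1, NNReal.coe_zero, zero_mul, mul_zero] at h2
    have h3 : (0 : ℝ) < U (n + 1) := hUn
    have h4 : (0 : ℝ) < n := by exact_mod_cast (show 0 < n by omega)
    have := mul_pos h4 (mul_pos h3 (Real.exp_pos (-(vbar v * ((n + 1 : ℕ) : ℝ) ^ 2))))
    linarith

/-- It is unlikely that there are few links on an edge. -/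
lemma exists_small_sparseProb {d N : ℕ} (hd : 1 ≤ d) (hN : 0 < N) {v : (Fin d → ℤ) → ℝ}
    (hv : ∀ x, v (-x) = v x) (ht : Tempered v) (hsep : Separable v) (K : ℕ) :
    ∃ κ₀ : ℕ, 1 ≤ κ₀ ∧ ∀ U : ℕ → ℝ≥0, 0 < U κ₀ → ∃ lam₀ : ℝ, 1 ≤ lam₀ ∧
      ∀ lam : ℝ, lam₀ ≤ lam → ∀ (L : ℕ) [NeZero L] (hL : Even L) (j : Fin d),
        (Summable fun k : (torusGraph d L).edgeSet → Fin N → ℕ =>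
          RPM.closedWeight U (periodicPotential v L) lam k) →
        (∑' k : (torusGraph d L).edgeSet → Fin N → ℕ,
            RPM.closedWeight U (periodicPotential v L) lam k *
              if RPM.linkTotal k (matchingEdge hL j 0) ≤ K then 1 else 0) /
          (∑' k : (torusGraph d L).edgeSet → Fin N → ℕ,
            RPM.closedWeight U (periodicPotential v L) lam k) ≤ 1 / 2 := by
  have hsb := summable_sparseBound hd N K
  have htail := tendsto_sum_nat_add (sparseBound d N K)
  obtain ⟨κ₀, hκ₀, hκd⟩ := ((htail.eventually (gt_mem_nhds (show (0 : ℝ) < 1 / 4 by norm_num))).and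
    (Filter.eventually_ge_atTop d)).exists
  have hκ1 : (1 : ℝ) ≤ κ₀ := by exact_mod_cast hd.trans hκd
  refine ⟨κ₀, hd.trans hκd, fun U hU => ?_⟩
  -- The κ₀ small local times contribute at most 1/4 in total, as does the tail beyond κ₀. Only λ₀
  -- depends on U; κ₀ does not.
  set ε : ℝ := 1 / (4 * κ₀) with hε
  have hε0 : 0 < ε := by positivity
  set q : ℝ := ε ^ 2 * ((U κ₀ : ℝ) ^ 2 / (2 * κ₀ + 1) ^ (2 * d + 1)) with hq
  have hq0 : 0 < q := by
    have : (0 : ℝ) < U κ₀ := hU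
    positivity
  let g : ℕ → ℝ := fun κ => (U κ : ℝ) ^ 2 * ((κ + 1) ^ N *
      ((Real.exp 1 * (κ + 1)) ^ N * (2 * κ / Real.exp 1) ^ κ)) ^ 2 * Real.exp (2 * d) *
      Real.exp (4 * κ₀ ^ 2 * ∑' x, |v x|)
  have hg0 : ∀ κ, 0 ≤ g κ := fun κ => by positivity
  refine ⟨1 + ∑ κ ∈ Finset.range κ₀, g κ / q, ?_, fun lam hlam L _ hL j hs => ?_⟩
  · have : 0 ≤ ∑ κ ∈ Finset.range κ₀, g κ / q :=
      Finset.sum_nonneg fun κ _ => div_nonneg (hg0 κ) hq0.le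
    linarith
  have hlam1 : 1 ≤ lam := by
    have : 0 ≤ ∑ κ ∈ Finset.range κ₀, g κ / q :=
      Finset.sum_nonneg fun κ _ => div_nonneg (hg0 κ) hq0.le
    linarith
  have hlam0 : 0 < lam := by linarith
  have hpos := tsum_closedWeight_pos hL v U hN hd hlam0 hU hs
  have hsum := tsum_sparseProb hL (v := v) (N := N) U j K hlam0.le hs
  have hsmall : ∀ κ ∈ Finset.range κ₀, sparseProb hL v U N lam j κ K ≤ ε := by
    intro κ hκ
    refine sparseProb_small_le hL U hv ht hsep hN hlam1 j (Finset.mem_range.1 hκ) hε0.le ?_ hs hpos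
    have h1 : g κ / q ≤ lam := by
      refine le_trans (Finset.single_le_sum (f := fun κ => g κ / q)
        (fun κ _ => div_nonneg (hg0 κ) hq0.le) hκ) ?_
      linarith
    exact (div_le_iff₀ hq0).1 h1
  have hlarge : ∀ κ, sparseProb hL v U N lam j (κ + κ₀) K ≤ sparseBound d N K (κ + κ₀) := fun κ =>
    sparseProb_le hL U hv hsep hN hlam0 j (by omega) hs hpos
  rw [← hsum.tsum_eq, ← hsum.summable.sum_add_tsum_nat_add κ₀]
  have h1 : ∑ κ ∈ Finset.range κ₀, sparseProb hL v U N lam j κ K ≤ 1 / 4 := by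
    refine (Finset.sum_le_card_nsmul _ _ _ hsmall).trans (le_of_eq ?_)
    rw [Finset.card_range, nsmul_eq_mul, hε]
    field_simp
  have h2 : ∑' κ, sparseProb hL v U N lam j (κ + κ₀) K ≤ 1 / 4 :=
    (((summable_nat_add_iff κ₀).2 hsum.summable).tsum_le_tsum hlarge
      ((summable_nat_add_iff κ₀).2 hsb)).trans hκ₀.le
  linarith

/-! ### Summability on the torus and the edge at the origin -/

section

variable {d L N : ℕ} [NeZero L] {v : (Fin d → ℤ) → ℝ} {U : ℕ → ℝ≥0} {lam : ℝ}

lemma summable_torus_mul (hv : ∀ x, v (-x) = v x) (ht : Tempered v) (hU : Good v U)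
    (hlam : 0 ≤ lam) (f : ((torusGraph d L).edgeSet → Fin N → ℕ) → ℝ)
    (hf : ∀ k, |f k| ≤ 4 ^ ∑ e, ∑ i, k e i) :
    Summable fun k => RPM.closedWeight U (periodicPotential v L) lam k * f k := by
  obtain ⟨A, B, hA, hB, hAB⟩ := hU.exists_bound
  exact RPM.summable_closedWeight_mul U _ hlam (energy_ge v hv ht) hA hB hAB f hf

lemma summable_torus (hv : ∀ x, v (-x) = v x) (ht : Tempered v) (hU : Good v U)
    (hlam : 0 ≤ lam) :
    Summable fun k : (torusGraph d L).edgeSet → Fin N → ℕ =>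
      RPM.closedWeight U (periodicPotential v L) lam k := by
  have h := summable_torus_mul (L := L) (N := N) hv ht hU hlam (fun _ => 1) fun k => by
    rw [abs_one]
    exact one_le_pow₀ (by norm_num)
  simpa only [mul_one] using h

lemma summable_torus_mul_of_le_sq (hv : ∀ x, v (-x) = v x) (ht : Tempered v) (hU : Good v U)
    (hlam : 0 ≤ lam) (e : (torusGraph d L).edgeSet)
    (f : ((torusGraph d L).edgeSet → Fin N → ℕ) → ℝ)
    (hf : ∀ k, |f k| ≤ (RPM.linkTotal k e : ℝ) ^ 2) :
    Summable fun k => RPM.closedWeight U (periodicPotential v L) lam k * f k :=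
  summable_torus_mul hv ht hU hlam f fun k => (hf k).trans (by
    exact_mod_cast RPM.sq_linkTotal_le k e)

lemma torusGraph_adj_zero_single (hL : Even L) (j : Fin d) :
    (torusGraph d L).Adj 0 (Pi.single j 1) :=
  ⟨(single_one_ne_zero hL j).symm, j, Or.inl (zero_add _).symm⟩

lemma matchingEdge_zero (hL : Even L) (j : Fin d) :
    matchingEdge hL j 0 =
      ⟨s(0, Pi.single j 1), torusGraph_adj_zero_single hL j⟩ := by
  refine Subtype.ext ?_
  simp [matchingEdge, torusPartner]

end

end

theorem proposition5 (d N : ℕ) (hd : 1 ≤ d) (hN : 2 ≤ N)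
    (v : (Fin d → ℤ) → ℝ) (hsymm : ∀ x, v (-x) = v x)
    (htemp : Tempered v) (hsep : Separable v)
    (M a : ℝ) (hM : 0 < M) (ha : 0 < a) :
    ∃ R : ℝ, 0 < R ∧ ∀ U : ℕ → ℝ≥0, Good v U →
      ENNReal.ofReal R ≤ (weightRange U : ℝ≥0∞) →
      ∃ lam₀ : ℝ, 0 < lam₀ ∧ ∀ lam : ℝ, lam₀ ≤ lam →
        ∀ (L : ℕ) [NeZero L], Even L →
          let G := torusGraph d L
          let vL := periodicPotential v L
          let o : Torus d L := 0
          let e₁ : Torus d L := Pi.single ⟨0, hd⟩ 1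
          -- the numbers of links of the first and of the second colour on the edge `{o, e₁}`
          let m₁ : RPM.Config G N → ℝ := fun w => (w.linkCount s(o, e₁) ⟨0, by omega⟩ : ℝ)
          let m₂ : RPM.Config G N → ℝ := fun w => (w.linkCount s(o, e₁) ⟨1, by omega⟩ : ℝ)
          (Summable fun w : {w : RPM.Config G N // w.IsClosed} => w.1.weight U vL lam) ∧
          0 < RPM.partitionFunction G U vL N lam ∧
          RPM.HasMean U vL N lam (fun w => m₁ w * m₂ w) ∧
          RPM.HasMean U vL N lam m₂ ∧
          RPM.mean U vL N lam (fun w => m₁ w * m₂ w) = RPM.twoPoint G U vL N lam o e₁ ∧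
          M ≤ RPM.mean U vL N lam (fun w => m₁ w * m₂ w) - a * RPM.mean U vL N lam m₂ := by
  -- K is the threshold required by `le_correlation`. The cutoff κ₀ obtained from it serves as R,
  -- and only λ₀ is chosen after U.
  obtain ⟨K, hK⟩ := exists_nat_ge
    (2 + a * (N + 2) + (2 * (N * (N + 2) * M) + (2 + a * (N + 2)) ^ 2 / 4))
  obtain ⟨κ₀, hκ₀, h⟩ := exists_small_sparseProb (N := N) hd (by omega) hsymm htemp hsep K
  refine ⟨κ₀, by exact_mod_cast hκ₀, fun U hU hR => ?_⟩
  obtain ⟨lam₀, hlam₀, hsmall⟩ := h U (hU.pos_of_range hκ₀ hR)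
  refine ⟨lam₀, by linarith, fun lam hlam L _ hL => ?_⟩
  intro G vL o e₁ m₁ m₂
  have hlam0 : 0 < lam := by linarith
  have hadj : s(o, e₁) ∈ G.edgeSet := torusGraph_adj_zero_single hL ⟨0, hd⟩
  have hs0 := summable_torus (L := L) (N := N) hsymm htemp hU hlam0.le
  have hsq := summable_torus_mul_of_le_sq (N := N) hsymm htemp hU hlam0.le
    (⟨s(o, e₁), hadj⟩ : G.edgeSet)
  have hpos := tsum_closedWeight_pos hL v U (by omega) hd hlam0 (hU.pos_of_range hκ₀ hR) hs0
  have hp := hsmall lam hlam L hL ⟨0, hd⟩ hs0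
  rw [matchingEdge_zero] at hp
  let i₀ : Fin N := ⟨0, by omega⟩
  let i₁ : Fin N := ⟨1, by omega⟩
  let e : G.edgeSet := ⟨s(o, e₁), hadj⟩
  have hm₁ : ∀ w, m₁ w = (RPM.colourCount w.c e i₀ : ℝ) := fun w =>
    congrArg Nat.cast (w.linkCount_eq e i₀)
  have hm₂ : ∀ w, m₂ w = (RPM.colourCount w.c e i₁ : ℝ) := fun w =>
    congrArg Nat.cast (w.linkCount_eq e i₁)
  have hle : ∀ (k : G.edgeSet → Fin N → ℕ) i, (k e i : ℝ) ≤ RPM.linkTotal k e := fun k i => by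
    exact_mod_cast RPM.le_linkTotal k e i
  have hs1 := hsq (fun k => k e i₁) fun k => by
    rw [Nat.abs_cast]
    refine (hle k i₁).trans ?_
    exact_mod_cast Nat.le_self_pow two_ne_zero _
  have hs01 := hsq (fun k => k e i₀ * k e i₁) fun k => by
    rw [abs_of_nonneg (by positivity), sq]
    exact mul_le_mul (hle k _) (hle k _) (by positivity) (by positivity)
  have hmean₂ := RPM.tsum_closed_eq U vL hlam0.le
    (f := fun k : G.edgeSet → Fin N → ℕ => (k e i₁ : ℝ)) fun k => Nat.cast_nonneg _
  have hmean₁₂ := RPM.tsum_closed_eq U vL hlam0.le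
    (f := fun k : G.edgeSet → Fin N → ℕ => (k e i₀ * k e i₁ : ℝ)) fun k => by positivity
  have hE : RPM.mean U vL N lam (fun w => m₁ w * m₂ w) =
      (∑' k : G.edgeSet → Fin N → ℕ, RPM.closedWeight U vL lam k * (k e i₀ * k e i₁)) /
        ∑' k : G.edgeSet → Fin N → ℕ, RPM.closedWeight U vL lam k := by
    rw [RPM.mean, RPM.partitionFunction_eq U vL hlam0.le, ← hmean₁₂]
    simp only [hm₁, hm₂]
  have hE₂ : RPM.mean U vL N lam m₂ =
      (∑' k : G.edgeSet → Fin N → ℕ, RPM.closedWeight U vL lam k * k e i₁) /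
        ∑' k : G.edgeSet → Fin N → ℕ, RPM.closedWeight U vL lam k := by
    rw [RPM.mean, RPM.partitionFunction_eq U vL hlam0.le, ← hmean₂]
    simp only [hm₂]
  refine ⟨?_, ?_, ?_, ?_, ?_, ?_⟩
  · have h := RPM.summable_closed U vL hlam0.le (f := fun _ : G.edgeSet → Fin N → ℕ => 1)
      (fun _ => zero_le_one) (by simpa only [mul_one] using hs0)
    simpa only [mul_one] using h
  · rw [RPM.partitionFunction_eq U vL hlam0.le]
    exact hpos
  · have h := RPM.summable_closed U vL hlam0.le (fun k => by positivity) hs01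
    simpa only [RPM.HasMean, hm₁, hm₂] using h
  · have h := RPM.summable_closed U vL hlam0.le (fun k => by positivity) hs1
    simpa only [RPM.HasMean, hm₂] using h
  · rw [hE, RPM.twoPoint_eq hN U vL hlam0.le hadj]
  · rw [hE, hE₂]
    exact RPM.le_correlation hlam0.le e (by simp [i₀, i₁]) ha.le hK hM.le hsq hs0 hpos hp
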